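/- **Conventions.** All vector spaces are over $\mathbb C$; $\mathbb F_n(\mathbb C)=\{z\in\mathbb C^n : z_i\neq z_j \text{ for } i\ne j\}$. For a graded space $F=\coprod_i F_{(i)}$ let $\overline F=\prod_i F_{(i)}$, $F'=\coprod_i F_{(i)}^*$, and let $P_i$ be the projections. Smoothness, derivatives and absolute convergence of $\overline F$-valued expressions are tested on all $f'\in F'$. Vertex operator algebras (VOAs) $(V,Y,\mathbf 1,\omega)$ are $\mathbb Z$-graded with finite-dimensional homogeneous subspaces, zero in sufficiently low degree; modules for a VOA are $\mathbb R$-graded by the eigenvalues of $L(0)$, with finite-dimensional homogeneous subspaces and weights bounded below. A *full field algebra* is an $\mathbb R$-graded space $F=\coprod_r F_{(r)}$ with grading operator $\mathbf d$, a vacuum $\mathbf 1\in F$ and correlation function maps $m_n:F^{\otimes n}\times\mathbb F_n(\mathbb C)\to\overline F$, $n\ge1$ (written $m_n(u_1,\dots,u_n;z_1,\bar z_1,\dots,z_n,\bar z_n)$), linear in the $u_i$ and smooth in the real and imaginary parts of the $z_i$, such that: (1) $m_1(u;0,0)=u$; (2) $m_{n+1}(u_1,\dots,u_n,\mathbf 1;z_1,\bar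 z_1,\dots,z_{n+1},\bar z_{n+1})=m_n(u_1,\dots,u_n;z_1,\bar z_1,\dots,z_n,\bar z_n)$; (3) for $k,l_1,\dots,l_k\ge1$, points $z^{(0)}\in\mathbb F_k(\mathbb C)$, $z^{(i)}\in\mathbb F_{l_i}(\mathbb C)$ with $|z^{(i)}_p|+|z^{(j)}_q|<|z^{(0)}_i-z^{(0)}_j|$ for all $i\neq j$, $p$, $q$, the series over $r_1,\dots,r_k\in\mathbb R$ of $m_k$ at the points $z^{(0)}_i$ of the vectors $P_{r_i}m_{l_i}(u^{(i)}_1,\dots,u^{(i)}_{l_i};z^{(i)}_1,\bar z^{(i)}_1,\dots)$ converges absolutely to $m_{l_1+\dots+l_k}$ of all the $u^{(i)}_p$ at the points $z^{(i)}_p+z^{(0)}_i$; (4) $m_n$ is invariant under simultaneous permutations of the $u_i$ and the $z_i$; (5) $e^{a\mathbf d}m_n(u_1,\dots;z_1,\bar z_1,\dots)=m_n(e^{a\mathbf d}u_1,\dots;e^az_1,e^a\bar z_1,\dots)$ for $a\in\mathbb R$. Homomorphisms are the linear maps preserving the grading, the vacuum and the maps $m_n$. Put $\mathbb Y(u;z,\bar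 z)v=m_2(u,v;z,\bar z,0,0)$, $z\ne0$. An *$\mathbb R\times\mathbb R$-graded full field algebra* has in addition a grading $F=\coprod_{m,n\in\mathbb R} F_{(m,n)}$, with left and right grading operators $\mathbf d^L,\mathbf d^R$, and operators $D^L,D^R$ on $F$ such that $\mathbf d=\mathbf d^L+\mathbf d^R$, $e^{2\pi i(\mathbf d^L-\mathbf d^R)}=I_F$, property (3) holds also with the projections $P_{p,q}$ onto $F_{(p,q)}$ in place of $P_r$, and $$[\mathbf d^L,\mathbb Y(u;z,\bar z)]=z\tfrac{\partial}{\partial z}\mathbb Y(u;z,\bar z)+\mathbb Y(\mathbf d^Lu;z,\bar z),\qquad [D^L,\mathbb Y(u;z,\bar z)]=\mathbb Y(D^Lu;z,\bar z)=\tfrac{\partial}{\partial z}\mathbb Y(u;z,\bar z),$$ and likewise with $R$, $\bar z$, $\partial/\partial\bar z$ in place of $L$, $z$, $\partial/\partial z$. It is *grading restricted* if all $F_{(m,n)}$ are finite-dimensional and, for some $M$, $F_{(m,n)}=0$ whenever $m<M$ or $n<M$. For such an algebra, with $\log z=\log|z|+i\arg z$, $0\le\arg z<2\pi$, one has a unique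 expansion $$\mathbb Y(u;z,\bar z)=\sum_{l,r\in\mathbb R}\mathbb Y_{l,r}(u)\,e^{(-l-1)\log z}e^{(-r-1)\overline{\log z}},\qquad \mathbb Y_{l,r}(u)\in\mathrm{End}\,F,$$ where, if $u$ has left and right weights $a$ and $b$, $\mathbb Y_{l,r}(u)$ changes the left and right weights by $a-l-1$ and $b-r-1$. The formal full vertex operator is $\mathbb Y_f(u;x,\bar x)=\sum_{l,r}\mathbb Y_{l,r}(u)x^{-l-1}\bar x^{-r-1}$, and $\mathbb Y_f(u;x,x)=\sum_{k\in\mathbb R}\bigl(\sum_{l+r=k-1}\mathbb Y_{l,r}(u)\bigr)x^{-k-1}$. For VOAs $V^L,V^R$, the *full field algebra $V^L\otimes V^R$* has vacuum $\mathbf 1^L\otimes\mathbf 1^R$, the grading by total weight, and $m_n(u_1^L\otimes u_1^R,\dots,u_n^L\otimes u_n^R;z_1,\bar z_1,\dots)$ equal to the (real-)analytic extension to $\mathbb F_n(\mathbb C)$ of $$(Y^L(u_1^L,z_1)\otimes Y^R(u_1^R,\bar z_1))\cdots(Y^L(u_n^L,z_n)\otimes Y^R(u_n^R,\bar z_n))(\mathbf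 1^L\otimes\mathbf 1^R),\qquad |z_1|>\dots>|z_n|>0 .$$ The *VOA $V^L\otimes V^R$* has $Y(u^L\otimes u^R,x)=Y^L(u^L,x)\otimes Y^R(u^R,x)$ and conformal element $\omega^L\otimes\mathbf 1^R+\mathbf 1^L\otimes\omega^R$. A *full field algebra over $V^L\otimes V^R$*, $(F,m,\rho)$, is a grading-restricted $\mathbb R\times\mathbb R$-graded full field algebra $F$ with an injective homomorphism $\rho$ from the full field algebra $V^L\otimes V^R$ to $F$ such that $\mathbf d^L=L^L(0)$, $D^L=L^L(-1)$, $\mathbf d^R=L^R(0)$, $D^R=L^R(-1)$, where $L^L(0)$ and $L^L(-1)$ are the coefficients of $x^{-2}\bar x^0$ and $x^{-1}\bar x^0$ in $\mathbb Y_f(\rho(\omega^L\otimes\mathbf 1^R);x,\bar x)$, and $L^R(0)$ and $L^R(-1)$ are the coefficients of $x^0\bar x^{-2}$ and $x^0\bar x^{-1}$ in $\mathbb Y_f(\rho(\mathbf 1^L\otimes\omega^R);x,\bar x)$. **Theorem.** Let $V^L$ and $V^R$ be vertex operator algebras and let $(F,m,\rho)$ be a full field algebra over $V^L\otimes V^R$.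 Then $F$, graded by total weight, is a module for the vertex operator algebra $V^L\otimes V^R$ with vertex operator map $u\mapsto\mathbb Y_f(\rho(u);x,x)$; in particular, only integral powers of $x$ occur in $\mathbb Y_f(\rho(u);x,x)$ for $u\in V^L\otimes V^R$. Moreover, $\mathbb Y_f(\cdot\,;x,x)$ is an intertwining operator of type $\binom{F}{F\,F}$ for this module structure: it satisfies the lower truncation property, the Jacobi identity and the $L(-1)$-derivative property. -/

import Mathlib

open scoped TensorProduct ContDiff ComplexConjugate

noncomputable section

/-! ## Graded vector spaces -/

section Graded

variable {ι F : Type*} [DecidableEq ι] [AddCommGroup F] [Module ℂ F]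

theorem bijective_coeLinearMap (G : ι → Submodule ℂ F) (hG : DirectSum.IsInternal G) :
    Function.Bijective (DirectSum.coeLinearMap G) := hG

/-- The isomorphism `∐ G i ≃ F` of an internally graded vector space. -/
def gradedEquiv (G : ι → Submodule ℂ F) (hG : DirectSum.IsInternal G) :
    DirectSum ι (fun i => G i) ≃ₗ[ℂ] F :=
  LinearEquiv.ofBijective (DirectSum.coeLinearMap G) (bijective_coeLinearMap G hG)

/-- The projection `P_i` of `F = ∐ G i` onto the homogeneous subspace `G i`. -/
def gradedProj (G : ι → Submodule ℂ F) (hG : DirectSum.IsInternal G) (i : ι) : F →ₗ[ℂ] F :=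
  (G i).subtype ∘ₗ DirectSum.component ℂ ι (fun j => G j) i ∘ₗ (gradedEquiv G hG).symm.toLinearMap

/-- The operator on `F = ∐ G i` acting on `G i` as multiplication by the scalar `c i`. -/
def diagOp (G : ι → Submodule ℂ F) (hG : DirectSum.IsInternal G) (c : ι → ℂ) : F →ₗ[ℂ] F :=
  DirectSum.toModule ℂ ι F (fun i => c i • (G i).subtype) ∘ₗ (gradedEquiv G hG).symm.toLinearMap

end Graded

/-! ## Vertex operator algebras, modules, intertwining operators -/

/-- The component form of the Jacobi identity: the coefficients of the identity
`x₀⁻¹ δ((x₁-x₂)/x₀) Y₃(u,x₁) I(w₁,x₂) w₂ - x₀⁻¹ δ((x₂-x₁)/(-x₀)) I(w₁,x₂) Y₂(u,x₁) w₂`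
`= x₂⁻¹ δ((x₁-x₀)/x₂) I(Y₁(u,x₀) w₁, x₂) w₂`, where `Yᵢ(u,x) = ∑ₙ Yᵢ n u x⁻ⁿ⁻¹` and
`I(w₁,x) = ∑ₖ I k w₁ x⁻ᵏ⁻¹`.  All the sums are finite under the truncation conditions that
accompany this identity wherever it is used. -/
def JacobiIdentity {V W₁ W₂ W₃ K : Type*} [AddCommGroup W₃] [Module ℂ W₃] [Ring K]
    (Y₁ : ℤ → V → W₁ → W₁) (Y₂ : ℤ → V → W₂ → W₂) (Y₃ : ℤ → V → W₃ → W₃)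
    (I : K → W₁ → W₂ → W₃) : Prop :=
  ∀ (u : V) (w₁ : W₁) (w₂ : W₂) (p r : ℤ) (q : K),
    ∑ᶠ i : ℕ, ((Ring.choose p i : ℤ) : ℂ) • I ((p : K) + q - (i : K)) (Y₁ (r + i) u w₁) w₂ =
    ∑ᶠ i : ℕ, ((-1 : ℂ) ^ i * ((Ring.choose r i : ℤ) : ℂ)) •
      (Y₃ (p + r - i) u (I (q + (i : K)) w₁ w₂)
        - (-1 : ℂ) ^ r • I (q + (r : K) - (i : K)) w₁ (Y₂ (p + i) u w₂))

/-- The data of a vertex operator algebra: the `ℤ`-grading, the vertex operator map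
`Y(u,x)v = ∑ₙ mode n u v x⁻ⁿ⁻¹`, the vacuum, the conformal element and the central charge. -/
structure VertexData (V : Type*) [AddCommGroup V] [Module ℂ V] where
  gr : ℤ → Submodule ℂ V
  mode : ℤ → V →ₗ[ℂ] V →ₗ[ℂ] V
  vac : V
  conf : V
  charge : ℂ

/-- A vertex operator algebra over `ℂ`. -/
structure VertexOperatorAlgebra (V : Type*) [AddCommGroup V] [Module ℂ V]
    extends VertexData V where
  internal : DirectSum.IsInternal gr
  finite_dim : ∀ n, FiniteDimensional ℂ (gr n)
  bounded : ∃ N : ℤ, ∀ n < N, gr n = ⊥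
  truncation : ∀ u v, ∃ N : ℤ, ∀ n ≥ N, mode n u v = 0
  vacuum : ∀ n v, mode n vac v = if n = -1 then v else 0
  creation : ∀ u, mode (-1) u vac = u ∧ ∀ n ≥ 0, mode n u vac = 0
  jacobi : JacobiIdentity (fun n u v => mode n u v) (fun n u v => mode n u v)
    (fun n u v => mode n u v) (fun (n : ℤ) u v => mode n u v)
  /-- the Virasoro relations for `L(n) = mode (n + 1) conf` -/
  virasoro : ∀ (m n : ℤ) (v : V),
    mode (m + 1) conf (mode (n + 1) conf v) - mode (n + 1) conf (mode (m + 1) conf v) =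
      ((m : ℂ) - n) • mode (m + n + 1) conf v
        + (if m + n = 0 then charge / 12 * ((m : ℂ) ^ 3 - m) else 0) • v
  /-- `L(0)` is the grading operator -/
  grading : ∀ n, ∀ v ∈ gr n, mode 1 conf v = (n : ℂ) • v
  /-- the `L(-1)`-derivative property `Y(L(-1)u,x) = (d/dx) Y(u,x)` -/
  derivative : ∀ n u v, mode n (mode 0 conf u) v = (-(n : ℂ)) • mode (n - 1) u v

section Modules

variable {V W W₁ W₂ W₃ : Type*} [AddCommGroup V] [Module ℂ V] [AddCommGroup W] [Module ℂ W]
  [AddCommGroup W₁] [Module ℂ W₁] [AddCommGroup W₂] [Module ℂ W₂] [AddCommGroup W₃] [Module ℂ W₃]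

/-- `W`, graded by the subspaces `G r`, `r ∈ ℝ`, and equipped with the vertex operator map
`Y(u,x)w = ∑ₙ Y n u w x⁻ⁿ⁻¹`, is an (`ℝ`-graded) module for the vertex operator algebra `T`. -/
structure IsVOAModule (T : VertexData V) (G : ℝ → Submodule ℂ W) (Y : ℤ → V → W → W) :
    Prop where
  internal : DirectSum.IsInternal G
  finite_dim : ∀ r, FiniteDimensional ℂ (G r)
  bounded : ∃ N : ℝ, ∀ r < N, G r = ⊥
  linear_left : ∀ n w, IsLinearMap ℂ (fun u => Y n u w)
  linear_right : ∀ n u, IsLinearMap ℂ (fun w => Y n u w)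
  truncation : ∀ u w, ∃ N : ℤ, ∀ n ≥ N, Y n u w = 0
  vacuum : ∀ n w, Y n T.vac w = if n = -1 then w else 0
  jacobi : JacobiIdentity (fun n u v => T.mode n u v) Y Y Y
  virasoro : ∀ (m n : ℤ) (w : W),
    Y (m + 1) T.conf (Y (n + 1) T.conf w) - Y (n + 1) T.conf (Y (m + 1) T.conf w) =
      ((m : ℂ) - n) • Y (m + n + 1) T.conf w
        + (if m + n = 0 then T.charge / 12 * ((m : ℂ) ^ 3 - m) else 0) • w
  grading : ∀ r, ∀ w ∈ G r, Y 1 T.conf w = (r : ℂ) • w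
  derivative : ∀ n u w, Y n (T.mode 0 T.conf u) w = (-(n : ℂ)) • Y (n - 1) u w

/-- `I(w₁,x)w₂ = ∑ I k w₁ w₂ x⁻ᵏ⁻¹` (sum over `k ∈ ℝ`) is an intertwining operator of type
`(W₃; W₁ W₂)`, where `Yᵢ` is the vertex operator map of the `T`-module `Wᵢ`. -/
structure IsIntertwiningOperator (T : VertexData V) (Y₁ : ℤ → V → W₁ → W₁)
    (Y₂ : ℤ → V → W₂ → W₂) (Y₃ : ℤ → V → W₃ → W₃) (I : ℝ → W₁ → W₂ → W₃) : Prop where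
  linear_left : ∀ k w₂, IsLinearMap ℂ (fun w₁ => I k w₁ w₂)
  linear_right : ∀ k w₁, IsLinearMap ℂ (fun w₂ => I k w₁ w₂)
  truncation : ∀ w₁ w₂, ∃ N : ℝ, ∀ k ≥ N, I k w₁ w₂ = 0
  jacobi : JacobiIdentity Y₁ Y₂ Y₃ I
  derivative : ∀ k w₁ w₂, I k (Y₁ 0 T.conf w₁) w₂ = (-(k : ℂ)) • I (k - 1) w₁ w₂

end Modules

/-! ## The tensor product of two vertex operator algebras -/

section Tensor

variable {A B : Type*} [AddCommGroup A] [Module ℂ A] [AddCommGroup B] [Module ℂ B]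
  (VL : VertexOperatorAlgebra A) (VR : VertexOperatorAlgebra B)

/-- The bilinear operation with `(uL ⊗ uR, vL ⊗ vR) ↦ (uL)ₖ vL ⊗ (uR)ₗ vR`. -/
def tensorBimode (k l : ℤ) : A ⊗[ℂ] B →ₗ[ℂ] A ⊗[ℂ] B →ₗ[ℂ] A ⊗[ℂ] B :=
  TensorProduct.map₂ (VL.mode k) (VR.mode l)

/-- The subspace of total weight `n` of `VL ⊗ VR`. -/
def tensorGr (n : ℤ) : Submodule ℂ (A ⊗[ℂ] B) :=
  ⨆ i : ℤ, Submodule.map₂ (TensorProduct.mk ℂ A B) (VL.gr i) (VR.gr (n - i))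

theorem tensorBimode_finite (n : ℤ) (u v : A ⊗[ℂ] B) :
    (Function.support fun i : ℤ => tensorBimode VL VR i (n - 1 - i) u v).Finite := by
  induction u using TensorProduct.induction_on with
  | zero => simp
  | add x y hx hy =>
    refine (hx.union hy).subset fun i hi => ?_
    by_contra h
    simp only [Set.mem_union, Function.mem_support, not_or, not_not] at h
    exact hi (by simp [h.1, h.2])
  | tmul a b =>
    induction v using TensorProduct.induction_on with
    | zero => simp
    | add x y hx hy =>
      refine (hx.union hy).subset fun i hi => ?_
      by_contra h
      simp only [Set.mem_union, Function.mem_support, not_or, not_not] at h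
      exact hi (by simp [h.1, h.2])
    | tmul a' b' =>
      obtain ⟨N, hN⟩ := VL.truncation a a'
      obtain ⟨M, hM⟩ := VR.truncation b b'
      refine (Set.finite_Icc (n - 1 - M) N).subset fun i hi => ?_
      by_contra h
      apply hi
      simp only [Set.mem_Icc, not_and_or, not_le] at h
      rcases h with h | h
      · simp [tensorBimode, hM (n - 1 - i) (by omega)]
      · simp [tensorBimode, hN i (by omega)]

/-- The tensor product of two vertex operator algebras, with
`Y(uL ⊗ uR, x) = YL(uL, x) ⊗ YR(uR, x)` and conformal element `ωL ⊗ 1 + 1 ⊗ ωR`. -/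
def tensorVOA : VertexData (A ⊗[ℂ] B) where
  gr := tensorGr VL VR
  mode n := LinearMap.mk₂ ℂ (fun u v => ∑ᶠ i : ℤ, tensorBimode VL VR i (n - 1 - i) u v)
    (fun u u' v => by
      rw [← finsum_add_distrib (tensorBimode_finite VL VR n u v)
        (tensorBimode_finite VL VR n u' v)]
      simp)
    (fun c u v => by
      rw [smul_finsum' c (tensorBimode_finite VL VR n u v)]
      simp)
    (fun u v v' => by
      rw [← finsum_add_distrib (tensorBimode_finite VL VR n u v)
        (tensorBimode_finite VL VR n u v')]
      simp)
    (fun c u v => by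
      rw [smul_finsum' c (tensorBimode_finite VL VR n u v)]
      simp)
  vac := VL.vac ⊗ₜ VR.vac
  conf := VL.conf ⊗ₜ VR.vac + VL.vac ⊗ₜ VR.conf
  charge := VL.charge + VR.charge

end Tensor

/-! ## Full field algebras -/

/-- The configuration space `𝔽ₙ(ℂ)`. -/
def configSpace (n : ℕ) : Set (Fin n → ℂ) := {z | Function.Injective z}

/-- The data underlying a full field algebra: total weight grading, correlation function maps and
vacuum.  The element `mₙ(u₁, …, uₙ; z₁, …, zₙ)` of the algebraic completion `∏ F_(r)` is
`corr n u z`; only `n ≥ 1` and `z ∈ configSpace n` are meaningful. -/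
structure FieldData (F : Type*) [AddCommGroup F] [Module ℂ F] where
  gr : ℝ → Submodule ℂ F
  corr : (n : ℕ) → (Fin n → F) → (Fin n → ℂ) → (r : ℝ) → gr r
  vac : F

/-- The full vertex operator `𝕐(u; z, z̄)v = m₂(u, v; z, z̄, 0, 0)`. -/
def FieldData.vertexOp {F : Type*} [AddCommGroup F] [Module ℂ F] (X : FieldData F)
    (u : F) (z : ℂ) (v : F) : (r : ℝ) → X.gr r :=
  X.corr 2 ![u, v] ![z, 0]

/-- The map `ρ` is a homomorphism of full field algebras (only the underlying data matter). -/
structure IsFieldHom {E F : Type*} [AddCommGroup E] [Module ℂ E] [AddCommGroup F] [Module ℂ F]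
    (X : FieldData E) (Z : FieldData F) (ρ : E →ₗ[ℂ] F) : Prop where
  map_gr : ∀ r, ∀ u ∈ X.gr r, ρ u ∈ Z.gr r
  map_vac : ρ X.vac = Z.vac
  map_corr : ∀ n, 1 ≤ n → ∀ (u : Fin n → E), ∀ z ∈ configSpace n, ∀ r,
    ρ (X.corr n u z r) = Z.corr n (fun i => ρ (u i)) z r

/-- A full field algebra.  An element `f'` of the graded dual of `F` is a finite sum of linear
functionals on the `F_(r)`, so statements tested on all `f'` are tested here on `φ ∘ P_r` with
`r : ℝ` and `φ` a linear functional on `F`; for complex series, `HasSum` is absolute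
convergence to the given sum. -/
structure FullFieldAlgebra (F : Type*) [AddCommGroup F] [Module ℂ F] extends FieldData F where
  internal : DirectSum.IsInternal gr
  map_update_add : ∀ n, 1 ≤ n → ∀ z ∈ configSpace n, ∀ (u : Fin n → F) (i : Fin n) (x y : F),
    corr n (Function.update u i (x + y)) z =
      corr n (Function.update u i x) z + corr n (Function.update u i y) z
  map_update_smul : ∀ n, 1 ≤ n → ∀ z ∈ configSpace n, ∀ (u : Fin n → F) (i : Fin n) (c : ℂ)
    (x : F), corr n (Function.update u i (c • x)) z = c • corr n (Function.update u i x) z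
  smooth : ∀ n, 1 ≤ n → ∀ (u : Fin n → F) (r : ℝ) (φ : Module.Dual ℂ F),
    ContDiffOn ℝ ∞ (fun z => φ (corr n u z r)) (configSpace n)
  corr_one : ∀ (u : F) (r : ℝ), (corr 1 ![u] ![0] r : F) = gradedProj gr internal r u
  corr_vac : ∀ n, 1 ≤ n → ∀ (u : Fin n → F) (z : Fin n → ℂ) (w : ℂ),
    (Fin.snoc z w : Fin (n + 1) → ℂ) ∈ configSpace (n + 1) →
    corr (n + 1) (Fin.snoc u vac : Fin (n + 1) → F) (Fin.snoc z w : Fin (n + 1) → ℂ) = corr n u z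
  convergence : ∀ k, 1 ≤ k → ∀ l : Fin k → ℕ, (∀ i, 1 ≤ l i) →
    ∀ (u : (i : Fin k) → Fin (l i) → F) (z : (i : Fin k) → Fin (l i) → ℂ) (z₀ : Fin k → ℂ),
    (∀ i, z i ∈ configSpace (l i)) → z₀ ∈ configSpace k →
    (∀ i j, i ≠ j → ∀ p q, ‖z i p‖ + ‖z j q‖ < ‖z₀ i - z₀ j‖) →
    ∀ (s : ℝ) (φ : Module.Dual ℂ F),
      HasSum (fun r : Fin k → ℝ => φ (corr k (fun i => corr (l i) (u i) (z i) (r i)) z₀ s))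
        (φ (corr (∑ i, l i)
          (fun a => u (finSigmaFinEquiv.symm a).1 (finSigmaFinEquiv.symm a).2)
          (fun a => z (finSigmaFinEquiv.symm a).1 (finSigmaFinEquiv.symm a).2
            + z₀ (finSigmaFinEquiv.symm a).1) s))
  permutation : ∀ n, 1 ≤ n → ∀ (σ : Equiv.Perm (Fin n)) (u : Fin n → F), ∀ z ∈ configSpace n,
    corr n u z = corr n (u ∘ σ) (z ∘ σ)
  /-- `e^{a𝐝} mₙ(u₁, …; z₁, …) = mₙ(e^{a𝐝}u₁, …; eᵃz₁, …)` -/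
  scaling : ∀ n, 1 ≤ n → ∀ (a : ℝ) (u : Fin n → F), ∀ z ∈ configSpace n, ∀ r : ℝ,
    Complex.exp (a * r) • corr n u z r =
      corr n (fun i => diagOp gr internal (fun s => Complex.exp (a * s)) (u i))
        (fun i => Complex.exp a * z i) r

/-- The Wirtinger derivative `∂f/∂z`. -/
def wirtinger (f : ℂ → ℂ) (z : ℂ) : ℂ :=
  (fderiv ℝ f z 1 - Complex.I * fderiv ℝ f z Complex.I) / 2

/-- The Wirtinger derivative `∂f/∂z̄`. -/
def wirtingerBar (f : ℂ → ℂ) (z : ℂ) : ℂ :=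
  (fderiv ℝ f z 1 + Complex.I * fderiv ℝ f z Complex.I) / 2

/-- A full field algebra with an `ℝ × ℝ`-grading `F = ∐ F_(m,n)` compatible with the total
weight, and with two operators `DL`, `DR`. -/
structure BigradedFieldData (F : Type*) [AddCommGroup F] [Module ℂ F]
    extends FullFieldAlgebra F where
  bigr : ℝ × ℝ → Submodule ℂ F
  bi_internal : DirectSum.IsInternal bigr
  /-- `𝐝 = 𝐝ᴸ + 𝐝ᴿ` -/
  compat : diagOp gr internal (fun r => (r : ℂ)) =
    diagOp bigr bi_internal (fun p => (p.1 : ℂ)) + diagOp bigr bi_internal (fun p => (p.2 : ℂ))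
  DL : Module.End ℂ F
  DR : Module.End ℂ F

namespace BigradedFieldData

variable {F : Type*} [AddCommGroup F] [Module ℂ F] (X : BigradedFieldData F)

/-- The left grading operator. -/
def dL : Module.End ℂ F := diagOp X.bigr X.bi_internal (fun p => (p.1 : ℂ))

/-- The right grading operator. -/
def dR : Module.End ℂ F := diagOp X.bigr X.bi_internal (fun p => (p.2 : ℂ))

/-- The projection `P_{m,n}` on `F`. -/
def P (p : ℝ × ℝ) : F →ₗ[ℂ] F := gradedProj X.bigr X.bi_internal p

/-- The projection `P_{m,n}` on the algebraic completion; as `F_(m,n) ⊆ F_(m+n)`, it is the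
`(m,n)`-part of the component of total weight `m + n`. -/
def comp (p : ℝ × ℝ) (x : (r : ℝ) → X.gr r) : F := X.P p (x (p.1 + p.2))

/-- The coefficient `𝕐_{l,r}(u)v` of the formal full vertex operator
`𝕐_f(u; x, x̄)v = ∑ 𝕐_{l,r}(u)v x^{-l-1} x̄^{-r-1}`.  For `u ∈ F_(a)`, `v ∈ F_(b)`,
`a, b ∈ ℝ × ℝ`, the function `P_c 𝕐(u; z, z̄)v` is a constant vector times
`e^{(c-a-b).1 log z} e^{(c-a-b).2 conj(log z)}`; that vector is the value at `z = 1`, and it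
is `𝕐_{l,r}(u)v` for `(-l-1, -r-1) = c - a - b`.  The definition is extended bilinearly. -/
def mode (l r : ℝ) (u v : F) : F :=
  ∑ᶠ ab : (ℝ × ℝ) × (ℝ × ℝ),
    X.comp (ab.1 + ab.2 - (l + 1, r + 1)) (X.vertexOp (X.P ab.1 u) 1 (X.P ab.2 v))

/-- The coefficient of `x^{-k-1}` in `𝕐_f(u; x, x)v`. -/
def diagMode (k : ℝ) (u v : F) : F := ∑ᶠ l : ℝ, X.mode l (k - 1 - l) u v

end BigradedFieldData

/-- An `ℝ × ℝ`-graded full field algebra.  The operators `𝐝ᴸ`, `DL`, … and derivatives act on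
elements of the completion through their components; `DL 𝕐(u; z, z̄)v` is the sum of the series
of the `DL P_q 𝕐(u; z, z̄)v`, `q ∈ ℝ × ℝ`. -/
structure BigradedFullFieldAlgebra (F : Type*) [AddCommGroup F] [Module ℂ F]
    extends BigradedFieldData F where
  /-- `e^{2πi(𝐝ᴸ-𝐝ᴿ)} = 1` -/
  single_valued : diagOp bigr bi_internal
    (fun p => Complex.exp (2 * Real.pi * Complex.I * ((p.1 : ℂ) - p.2))) = LinearMap.id
  bi_convergence : ∀ k, 1 ≤ k → ∀ l : Fin k → ℕ, (∀ i, 1 ≤ l i) →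
    ∀ (u : (i : Fin k) → Fin (l i) → F) (z : (i : Fin k) → Fin (l i) → ℂ) (z₀ : Fin k → ℂ),
    (∀ i, z i ∈ configSpace (l i)) → z₀ ∈ configSpace k →
    (∀ i j, i ≠ j → ∀ p q, ‖z i p‖ + ‖z j q‖ < ‖z₀ i - z₀ j‖) →
    ∀ (s : ℝ × ℝ) (φ : Module.Dual ℂ F),
      HasSum (fun r : Fin k → ℝ × ℝ => φ (toBigradedFieldData.comp s
          (corr k (fun i => toBigradedFieldData.comp (r i) (corr (l i) (u i) (z i))) z₀)))
        (φ (toBigradedFieldData.comp s (corr (∑ i, l i)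
          (fun a => u (finSigmaFinEquiv.symm a).1 (finSigmaFinEquiv.symm a).2)
          (fun a => z (finSigmaFinEquiv.symm a).1 (finSigmaFinEquiv.symm a).2
            + z₀ (finSigmaFinEquiv.symm a).1))))
  dL_bracket : ∀ (u v : F) (z : ℂ), z ≠ 0 → ∀ (p : ℝ × ℝ) (φ : Module.Dual ℂ F),
    (p.1 : ℂ) * φ (toBigradedFieldData.comp p (toFieldData.vertexOp u z v))
        - φ (toBigradedFieldData.comp p (toFieldData.vertexOp u z (toBigradedFieldData.dL v))) =
      z * wirtinger (fun ζ => φ (toBigradedFieldData.comp p (toFieldData.vertexOp u ζ v))) z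
        + φ (toBigradedFieldData.comp p (toFieldData.vertexOp (toBigradedFieldData.dL u) z v))
  dR_bracket : ∀ (u v : F) (z : ℂ), z ≠ 0 → ∀ (p : ℝ × ℝ) (φ : Module.Dual ℂ F),
    (p.2 : ℂ) * φ (toBigradedFieldData.comp p (toFieldData.vertexOp u z v))
        - φ (toBigradedFieldData.comp p (toFieldData.vertexOp u z (toBigradedFieldData.dR v))) =
      conj z * wirtingerBar
          (fun ζ => φ (toBigradedFieldData.comp p (toFieldData.vertexOp u ζ v))) z
        + φ (toBigradedFieldData.comp p (toFieldData.vertexOp (toBigradedFieldData.dR u) z v))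
  /-- `[DL, 𝕐(u; z, z̄)] = 𝕐(DL u; z, z̄)` -/
  DL_bracket : ∀ (u v : F) (z : ℂ), z ≠ 0 → ∀ (p : ℝ × ℝ) (φ : Module.Dual ℂ F),
    HasSum (fun q : ℝ × ℝ => φ (toBigradedFieldData.P p
        (DL (toBigradedFieldData.comp q (toFieldData.vertexOp u z v)))))
      (φ (toBigradedFieldData.comp p (toFieldData.vertexOp u z (DL v)))
        + φ (toBigradedFieldData.comp p (toFieldData.vertexOp (DL u) z v)))
  /-- `𝕐(DL u; z, z̄) = ∂/∂z 𝕐(u; z, z̄)` -/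
  DL_derivative : ∀ (u v : F) (z : ℂ), z ≠ 0 → ∀ (p : ℝ × ℝ) (φ : Module.Dual ℂ F),
    φ (toBigradedFieldData.comp p (toFieldData.vertexOp (DL u) z v)) =
      wirtinger (fun ζ => φ (toBigradedFieldData.comp p (toFieldData.vertexOp u ζ v))) z
  /-- `[DR, 𝕐(u; z, z̄)] = 𝕐(DR u; z, z̄)` -/
  DR_bracket : ∀ (u v : F) (z : ℂ), z ≠ 0 → ∀ (p : ℝ × ℝ) (φ : Module.Dual ℂ F),
    HasSum (fun q : ℝ × ℝ => φ (toBigradedFieldData.P p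
        (DR (toBigradedFieldData.comp q (toFieldData.vertexOp u z v)))))
      (φ (toBigradedFieldData.comp p (toFieldData.vertexOp u z (DR v)))
        + φ (toBigradedFieldData.comp p (toFieldData.vertexOp (DR u) z v)))
  /-- `𝕐(DR u; z, z̄) = ∂/∂z̄ 𝕐(u; z, z̄)` -/
  DR_derivative : ∀ (u v : F) (z : ℂ), z ≠ 0 → ∀ (p : ℝ × ℝ) (φ : Module.Dual ℂ F),
    φ (toBigradedFieldData.comp p (toFieldData.vertexOp (DR u) z v)) =
      wirtingerBar (fun ζ => φ (toBigradedFieldData.comp p (toFieldData.vertexOp u ζ v))) z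

/-- Grading-restricted: both weights are bounded below and the `F_(m,n)` are finite-dimensional. -/
structure BigradedFullFieldAlgebra.IsGradingRestricted {F : Type*} [AddCommGroup F] [Module ℂ F]
    (X : BigradedFullFieldAlgebra F) : Prop where
  lower_truncated : ∃ M : ℝ, ∀ m n : ℝ, (n < M ∨ m < M) → X.bigr (m, n) = ⊥
  finite_dim : ∀ m n : ℝ, FiniteDimensional ℂ (X.bigr (m, n))

/-! ## The full field algebra `VL ⊗ VR` and full field algebras over it -/

section Over

variable {A B : Type*} [AddCommGroup A] [Module ℂ A] [AddCommGroup B] [Module ℂ B]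
  (VL : VertexOperatorAlgebra A) (VR : VertexOperatorAlgebra B)

/-- `(u₁)_{k₁,l₁} ⋯ (uₙ)_{kₙ,lₙ} 𝟏` in `VL ⊗ VR`, where `κ i = (kᵢ, lᵢ)`. -/
def iterBimode : (n : ℕ) → (Fin n → A ⊗[ℂ] B) → (Fin n → ℤ × ℤ) → A ⊗[ℂ] B
  | 0, _, _ => VL.vac ⊗ₜ VR.vac
  | n + 1, u, κ => tensorBimode VL VR (κ 0).1 (κ 0).2 (u 0)
      (iterBimode n (fun i => u i.succ) (fun i => κ i.succ))

/-- The grading of `VL ⊗ VR` by total weight, as an `ℝ`-grading. -/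
def tensorGrReal (r : ℝ) : Submodule ℂ (A ⊗[ℂ] B) :=
  ⨆ (n : ℤ) (_ : (n : ℝ) = r), tensorGr VL VR n

/-- `g` is the component of total weight `r` of the (real) analytic extension to `𝔽ₙ(ℂ)` of
`(YL(·, z₁) ⊗ YR(·, z̄₁))(u₁) ⋯ (YL(·, zₙ) ⊗ YR(·, z̄ₙ))(uₙ) 𝟏`, a series which converges
absolutely when `|z₁| > ⋯ > |zₙ| > 0`.  Here `φ` runs through the elements of the graded dual
supported in weight `r`. -/
def IsTensorCorrelator (n : ℕ) (u : Fin n → A ⊗[ℂ] B) (r : ℝ)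
    (g : (Fin n → ℂ) → tensorGrReal VL VR r) : Prop :=
  ∀ φ : Module.Dual ℂ (A ⊗[ℂ] B), (∀ s, s ≠ r → ∀ x ∈ tensorGrReal VL VR s, φ x = 0) →
    AnalyticOnNhd ℝ (fun z => φ (g z)) (configSpace n) ∧
    ∀ z : Fin n → ℂ, StrictAnti (fun i => ‖z i‖) → (∀ i, z i ≠ 0) →
      HasSum (fun κ : Fin n → ℤ × ℤ =>
        (∏ i, z i ^ (-(κ i).1 - 1) * conj (z i) ^ (-(κ i).2 - 1)) * φ (iterBimode VL VR n u κ))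
        (φ (g z))

open Classical in
/-- The full field algebra `VL ⊗ VR` (its underlying data). -/
def tensorField : FieldData (A ⊗[ℂ] B) where
  gr := tensorGrReal VL VR
  corr n u z r :=
    if h : ∃ g, IsTensorCorrelator VL VR n u r g then h.choose z else 0
  vac := VL.vac ⊗ₜ VR.vac

/-- A full field algebra over `VL ⊗ VR`: a grading-restricted `ℝ × ℝ`-graded full field algebra
with an injective homomorphism `ρ` from the full field algebra `VL ⊗ VR` such that
`𝐝ᴸ = Lᴸ(0)`, `𝐝ᴿ = Lᴿ(0)`, `DL = Lᴸ(-1)`, `DR = Lᴿ(-1)`.  Here `Lᴸ(0)` and `Lᴸ(-1)` are the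
coefficients of `x⁻² x̄⁰` and `x⁻¹ x̄⁰` in `𝕐_f(ρ(ωL ⊗ 1); x, x̄)`, and symmetrically for
`Lᴿ`. -/
structure FullFieldAlgebraOver (F : Type*) [AddCommGroup F] [Module ℂ F]
    extends BigradedFullFieldAlgebra F where
  restricted : toBigradedFullFieldAlgebra.IsGradingRestricted
  ρ : A ⊗[ℂ] B →ₗ[ℂ] F
  ρ_hom : IsFieldHom (tensorField VL VR) toFieldData ρ
  ρ_injective : Function.Injective ρ
  dL_eq : ∀ v, toBigradedFieldData.dL v =
    toBigradedFieldData.mode 1 (-1) (ρ (VL.conf ⊗ₜ VR.vac)) v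
  dR_eq : ∀ v, toBigradedFieldData.dR v =
    toBigradedFieldData.mode (-1) 1 (ρ (VL.vac ⊗ₜ VR.conf)) v
  DL_eq : ∀ v, DL v = toBigradedFieldData.mode 0 (-1) (ρ (VL.conf ⊗ₜ VR.vac)) v
  DR_eq : ∀ v, DR v = toBigradedFieldData.mode (-1) 0 (ρ (VL.vac ⊗ₜ VR.conf)) v

end Over

end

/-! For bihomogeneous `u` and `v` the brackets with `𝐝ᴸ` and `𝐝ᴿ` force each bigraded component of
`𝕐(u; z, z̄)v` to be a fixed vector times a power of `z` and a power of `z̄` (`comp_vertexOp_exp`).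
A full vertex operator is thus determined by its components at `z = 1` (`atOne`), and the modes are
these components, relabelled by weight.

The map `ρ` carries modes to modes (`bimode_rho`). The two-point functions of `VL ⊗ VR` are explicit
finite sums of products of a rational function of `z₁, z₂` and one of `z̄₁, z̄₂`; putting the second
point at `0` exhibits the modes, and the linear independence of exponentials transfers the equality
of functions to coefficients in `F`. Consequently `DR` kills `ρ (a ⊗ 𝟏)` and `DL` kills `ρ (𝟏 ⊗ b)`:
the first field is holomorphic and preserves the right weight, the second is antiholomorphic and
preserves the left weight. As the difference of left and right weights is always an integer, only
integral powers occur in them.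

Let `u` be such a chiral vector. The three-point function of `u` at `z`, `w₁` at `1` and `w₂` at `0`
expands, by the convergence axiom and permutation symmetry, in products for `|z| > 1`, in products
in the opposite order for `|z| < 1`, and in iterates for `|z - 1| < 1`. It is smooth on `ℂ ∖ {0,
1}`, holomorphic off the unit circle and hence everywhere there, and has at most poles because
weights are bounded below. Liouville's theorem makes it a polynomial over a power of `z (z - 1)`
(`isRationalTriple_of_hasSum`, `HasModes.isRationalTriple`). For the coefficients of such a function
the Jacobi identity is the residue theorem for `zᵖ (z - 1)ʳ f(z)`; it is proved algebraically
(`IsRationalTriple.jacobiDefect_eq_zero`). Antichiral vectors are treated in the variable `z̄`.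

Applied to `a ⊗ 𝟏` and `𝟏 ⊗ b` themselves, this shows that their modes commute and that the field of
`a ⊗ b` is their product, `𝕐_{k,l}(ρ(a ⊗ b)) = a_k b_l` (`leftMode_rightMode`, `bimode_tmul`). With
general `w₁` and `w₂`, the correlation function of `a ⊗ b` is rational in `z` and in `z̄` regarded
as independent variables, and restriction to the diagonal keeps it rational with poles only at `0`,
`1`, `∞` (`IsRationalTriple.diag`). This gives the Jacobi identity for `𝕐_f(·; x, x)` (`jacobiAt`).

The remaining axioms follow: truncation from the lower bound on weights, the `L(-1)`-property by
comparing `DL`, `DR` with the weight brackets at `z = 1`, and the Virasoro relations from the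
commutator formula. The module Jacobi identity is the intertwining one with the middle vector in the
image of `ρ`. -/

noncomputable section

/-! ## Expansions of rational functions at `∞`, `0` and `1` -/

section LaurentTriples

variable {M : Type*} [AddCommGroup M] [Module ℂ M]

/-- The shift `(E c) n = c (n + 1)`, i.e. multiplication by `z` of `∑ c n z⁻ⁿ⁻¹`. -/
def shiftSeq : Module.End ℂ (ℤ → M) := LinearMap.funLeft ℂ M (fun n : ℤ => n + 1)

@[simp] theorem shiftSeq_apply (c : ℤ → M) (n : ℤ) : shiftSeq c n = c (n + 1) := rfl

/-- Multiplication by `z (z - 1)` of `∑ c n z⁻ⁿ⁻¹`. -/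
def clearPole : Module.End ℂ (ℤ → M) := shiftSeq * (shiftSeq - 1)

@[simp] theorem clearPole_apply (c : ℤ → M) (n : ℤ) :
    clearPole c n = c (n + 1 + 1) - c (n + 1) := rfl

/-- Multiplication by `z (z - 1)` of `∑ e n (z - 1)⁻ⁿ⁻¹`. -/
def clearPoleOne : Module.End ℂ (ℤ → M) := (shiftSeq + 1) * shiftSeq

@[simp] theorem clearPoleOne_apply (c : ℤ → M) (n : ℤ) :
    clearPoleOne c n = c (n + 1 + 1) + c (n + 1) := rfl

/-- Multiplication by `(z (z - 1))ᴺ` of `∑ c n z⁻ⁿ⁻¹`. -/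
def clearPoles (N : ℕ) : Module.End ℂ (ℤ → M) := clearPole ^ N

/-- Multiplication by `(z (z - 1))ᴺ` of `∑ e n (z - 1)⁻ⁿ⁻¹`. -/
def clearPolesOne (N : ℕ) : Module.End ℂ (ℤ → M) := clearPoleOne ^ N

theorem finsum_eq_sum_range {g : ℕ → M} {B : ℕ} (h : ∀ i ≥ B, g i = 0) :
    ∑ᶠ i, g i = ∑ i ∈ Finset.range B, g i := by
  refine finsum_eq_sum_of_support_subset _ fun i hi => ?_
  simp only [Finset.coe_range, Set.mem_Iio]
  by_contra hB
  exact hi (h i (not_lt.1 hB))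

/-- Pascal's rule under the sum. The sign `ε = 1` serves the iterate in the Jacobi identity, `ε =
-1` the two products. -/
theorem finsum_pascal (ε : ℂ) (p : ℤ) {x : ℕ → M} (hx : ∃ B : ℕ, ∀ i ≥ B, x i = 0) :
    ∑ᶠ i : ℕ, (ε ^ i * ((Ring.choose (p + 1) i : ℤ) : ℂ)) • x i =
      ∑ᶠ i : ℕ, (ε ^ i * ((Ring.choose p i : ℤ) : ℂ)) • x i +
        ε • ∑ᶠ i : ℕ, (ε ^ i * ((Ring.choose p i : ℤ) : ℂ)) • x (i + 1) := by
  obtain ⟨B, hB⟩ := hx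
  rw [finsum_eq_sum_range (B := B + 1) (fun i hi => by rw [hB i (by omega), smul_zero]),
    finsum_eq_sum_range (B := B + 1) (fun i hi => by rw [hB i (by omega), smul_zero]),
    finsum_eq_sum_range (B := B) (fun i hi => by rw [hB (i + 1) (by omega), smul_zero]),
    Finset.sum_range_succ', Finset.sum_range_succ' _ B, Finset.smul_sum]
  simp only [Ring.choose_succ_succ, Ring.choose_zero_right]
  rw [add_right_comm, ← Finset.sum_add_distrib]
  congr 1
  refine Finset.sum_congr rfl fun i _ => ?_
  rw [smul_smul, ← add_smul]
  congr 1
  push_cast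
  ring

/-- The left side of the Jacobi identity. -/
def jacobiIterate (e : ℤ → M) (p r : ℤ) : M :=
  ∑ᶠ i : ℕ, ((Ring.choose p i : ℤ) : ℂ) • e (r + i)

/-- The first product in the Jacobi identity. -/
def jacobiLeft (c : ℤ → M) (p r : ℤ) : M :=
  ∑ᶠ i : ℕ, ((-1 : ℂ) ^ i * ((Ring.choose r i : ℤ) : ℂ)) • c (p + r - i)

/-- The second product in the Jacobi identity. -/
def jacobiRight (d : ℤ → M) (p r : ℤ) : M :=
  ∑ᶠ i : ℕ, ((-1 : ℂ) ^ i * ((Ring.choose r i : ℤ) : ℂ)) • d (p + i)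

/-- The truncation conditions on the coefficients of the expansions at `∞`, `0`, `1`. -/
structure TruncatedTriple (c d e : ℤ → M) : Prop where
  left : ∃ B : ℤ, ∀ n < B, c n = 0
  right : ∃ B : ℤ, ∀ n ≥ B, d n = 0
  iter : ∃ B : ℤ, ∀ n ≥ B, e n = 0

/-- The difference of the two sides of the Jacobi identity. -/
def jacobiDefect (c d e : ℤ → M) (p r : ℤ) : M :=
  jacobiIterate e p r - (jacobiLeft c p r - (-1 : ℂ) ^ r • jacobiRight d p r)

section

variable {c d e : ℤ → M}

theorem jacobiIterate_succ (he : ∃ B : ℤ, ∀ n ≥ B, e n = 0) (p r : ℤ) :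
    jacobiIterate e (p + 1) r = jacobiIterate e p r + jacobiIterate e p (r + 1) := by
  obtain ⟨B, hB⟩ := he
  have := finsum_pascal 1 p (x := fun i : ℕ => e (r + i))
    ⟨(B - r).toNat, fun i hi => hB _ (by omega)⟩
  simp only [one_pow, one_mul, one_smul] at this
  rw [jacobiIterate, this, jacobiIterate, jacobiIterate]
  congr 1
  refine finsum_congr fun i => ?_
  rw [show r + ((i + 1 : ℕ) : ℤ) = r + 1 + i by push_cast; ring]

theorem jacobiLeft_succ (hc : ∃ B : ℤ, ∀ n < B, c n = 0) (p r : ℤ) :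
    jacobiLeft c p (r + 1) = jacobiLeft c (p + 1) r - jacobiLeft c p r := by
  obtain ⟨B, hB⟩ := hc
  have := finsum_pascal (-1) r (x := fun i : ℕ => c (p + (r + 1) - i))
    ⟨(p + r + 1 - B).toNat + 1, fun i hi => hB _ (by omega)⟩
  rw [jacobiLeft, this, jacobiLeft, jacobiLeft, neg_one_smul, sub_eq_add_neg]
  congr 1
  · refine finsum_congr fun i => ?_
    rw [show p + (r + 1) - (i : ℤ) = p + 1 + r - i by ring]
  · congr 1
    refine finsum_congr fun i => ?_
    rw [show p + (r + 1) - ((i + 1 : ℕ) : ℤ) = p + r - i by push_cast; ring]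

theorem jacobiRight_succ (hd : ∃ B : ℤ, ∀ n ≥ B, d n = 0) (p r : ℤ) :
    jacobiRight d p (r + 1) = jacobiRight d p r - jacobiRight d (p + 1) r := by
  obtain ⟨B, hB⟩ := hd
  have := finsum_pascal (-1) r (x := fun i : ℕ => d (p + i))
    ⟨(B - p).toNat, fun i hi => hB _ (by omega)⟩
  rw [jacobiRight, this, jacobiRight, jacobiRight, neg_one_smul, sub_eq_add_neg]
  congr 2
  refine finsum_congr fun i => ?_
  rw [show p + ((i + 1 : ℕ) : ℤ) = p + 1 + i by push_cast; ring]

/-- The defect is the residue at `1` of `zᵖ (z - 1)ʳ f`, minus the coefficient of `z⁻¹` at `∞`, plus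
the residue at `0`. The recursion expresses `z = 1 + (z - 1)` in the weight `zᵖ (z - 1)ʳ`. -/
theorem jacobiDefect_succ (h : TruncatedTriple c d e) (p r : ℤ) :
    jacobiDefect c d e (p + 1) r = jacobiDefect c d e p r + jacobiDefect c d e p (r + 1) := by
  simp only [jacobiDefect, jacobiIterate_succ h.iter, jacobiLeft_succ h.left,
    jacobiRight_succ h.right]
  rw [zpow_add_one₀ (by norm_num)]
  module

theorem jacobiIterate_shift (p r : ℤ) :
    jacobiIterate (shiftSeq e) p r = jacobiIterate e p (r + 1) :=
  finsum_congr fun i => by rw [shiftSeq_apply, add_right_comm]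

theorem jacobiLeft_shift (p r : ℤ) :
    jacobiLeft (shiftSeq c) p r = jacobiLeft c (p + 1) r :=
  finsum_congr fun i => by
    rw [shiftSeq_apply, show p + r - (i : ℤ) + 1 = p + 1 + r - i by ring]

theorem jacobiRight_shift (p r : ℤ) :
    jacobiRight (shiftSeq d) p r = jacobiRight d (p + 1) r :=
  finsum_congr fun i => by rw [shiftSeq_apply, add_right_comm]

theorem jacobiIterate_add {e' : ℤ → M} (he : ∃ B : ℤ, ∀ n ≥ B, e n = 0)
    (he' : ∃ B : ℤ, ∀ n ≥ B, e' n = 0) (p r : ℤ) :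
    jacobiIterate (e + e') p r = jacobiIterate e p r + jacobiIterate e' p r := by
  obtain ⟨B, hB⟩ := he
  obtain ⟨B', hB'⟩ := he'
  simp only [jacobiIterate]
  rw [finsum_eq_sum_range (B := (max B B' - r).toNat), finsum_eq_sum_range (B := (max B B' - r).toNat),
    finsum_eq_sum_range (B := (max B B' - r).toNat), ← Finset.sum_add_distrib]
  · simp
  · intro i hi; rw [hB' _ (by omega), smul_zero]
  · intro i hi; rw [hB _ (by omega), smul_zero]
  · intro i hi; rw [Pi.add_apply, hB _ (by omega), hB' _ (by omega), add_zero, smul_zero]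

theorem jacobiLeft_sub {c' : ℤ → M} (hc : ∃ B : ℤ, ∀ n < B, c n = 0)
    (hc' : ∃ B : ℤ, ∀ n < B, c' n = 0) (p r : ℤ) :
    jacobiLeft (c - c') p r = jacobiLeft c p r - jacobiLeft c' p r := by
  obtain ⟨B, hB⟩ := hc
  obtain ⟨B', hB'⟩ := hc'
  simp only [jacobiLeft]
  rw [finsum_eq_sum_range (B := (p + r - min B B').toNat + 1),
    finsum_eq_sum_range (B := (p + r - min B B').toNat + 1),
    finsum_eq_sum_range (B := (p + r - min B B').toNat + 1), ← Finset.sum_sub_distrib]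
  · simp [smul_sub]
  · intro i hi; rw [hB' _ (by omega), smul_zero]
  · intro i hi; rw [hB _ (by omega), smul_zero]
  · intro i hi; rw [Pi.sub_apply, hB _ (by omega), hB' _ (by omega), sub_zero, smul_zero]

theorem jacobiRight_sub {d' : ℤ → M} (hd : ∃ B : ℤ, ∀ n ≥ B, d n = 0)
    (hd' : ∃ B : ℤ, ∀ n ≥ B, d' n = 0) (p r : ℤ) :
    jacobiRight (d - d') p r = jacobiRight d p r - jacobiRight d' p r := by
  obtain ⟨B, hB⟩ := hd
  obtain ⟨B', hB'⟩ := hd'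
  simp only [jacobiRight]
  rw [finsum_eq_sum_range (B := (max B B' - p).toNat), finsum_eq_sum_range (B := (max B B' - p).toNat),
    finsum_eq_sum_range (B := (max B B' - p).toNat), ← Finset.sum_sub_distrib]
  · simp [smul_sub]
  · intro i hi; rw [hB' _ (by omega), smul_zero]
  · intro i hi; rw [hB _ (by omega), smul_zero]
  · intro i hi; rw [Pi.sub_apply, hB _ (by omega), hB' _ (by omega), sub_zero, smul_zero]

theorem shiftSeq_eventually_zero (he : ∃ B : ℤ, ∀ n ≥ B, e n = 0) :
    ∃ B : ℤ, ∀ n ≥ B, shiftSeq e n = 0 :=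
  he.imp fun _ hB n hn => hB (n + 1) (by omega)

theorem shiftSeq_eventually_zero_left (hc : ∃ B : ℤ, ∀ n < B, c n = 0) :
    ∃ B : ℤ, ∀ n < B, shiftSeq c n = 0 := by
  obtain ⟨B, hB⟩ := hc
  exact ⟨B - 1, fun n hn => hB (n + 1) (by omega)⟩

theorem TruncatedTriple.clear (h : TruncatedTriple c d e) :
    TruncatedTriple (clearPole c) (clearPole d)
      (clearPoleOne e) := by
  obtain ⟨⟨B₁, h₁⟩, ⟨B₂, h₂⟩, ⟨B₃, h₃⟩⟩ := h
  refine ⟨⟨B₁ - 2, fun n hn => ?_⟩, ⟨B₂, fun n hn => ?_⟩, ⟨B₃, fun n hn => ?_⟩⟩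
  · simp [h₁ (n + 1) (by omega), h₁ (n + 1 + 1) (by omega)]
  · simp [h₂ (n + 1) (by omega), h₂ (n + 1 + 1) (by omega)]
  · simp [h₃ (n + 1) (by omega), h₃ (n + 1 + 1) (by omega)]

/-- A factor `z (z - 1)` may be attached to `f` or to the weight `zᵖ (z - 1)ʳ`, where it raises both
exponents. -/
theorem jacobiDefect_clear (h : TruncatedTriple c d e) (p r : ℤ) :
    jacobiDefect (clearPole c) (clearPole d)
      (clearPoleOne e) p r = jacobiDefect c d e (p + 1) (r + 1) := by
  simp only [clearPole, clearPoleOne, Module.End.mul_apply, LinearMap.sub_apply, LinearMap.add_apply, Module.End.one_apply,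
    jacobiDefect]
  have h3 := shiftSeq_eventually_zero h.iter
  rw [jacobiIterate_add (shiftSeq_eventually_zero h3) h3, jacobiLeft_shift, jacobiRight_shift,
    jacobiLeft_sub (shiftSeq_eventually_zero_left h.left) h.left,
    jacobiRight_sub (shiftSeq_eventually_zero h.right) h.right, jacobiIterate_shift,
    jacobiIterate_shift, jacobiIterate_shift, jacobiLeft_shift, jacobiRight_shift,
    jacobiIterate_succ h.iter, jacobiLeft_succ h.left, jacobiRight_succ h.right,
    zpow_add_one₀ (by norm_num)]
  module

theorem TruncatedTriple.clear_pow (h : TruncatedTriple c d e) (N : ℕ) :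
    TruncatedTriple (clearPoles N c) (clearPoles N d) (clearPolesOne N e) := by
  induction N with
  | zero => simpa [clearPoles, clearPolesOne] using h
  | succ N ih =>
    simp only [clearPoles, clearPolesOne, pow_succ'] at ih ⊢
    exact ih.clear

theorem jacobiDefect_clear_pow (h : TruncatedTriple c d e) (N : ℕ) (p r : ℤ) :
    jacobiDefect (clearPoles N c) (clearPoles N d) (clearPolesOne N e) p r =
      jacobiDefect c d e (p + N) (r + N) := by
  induction N generalizing p r with
  | zero => simp [clearPoles, clearPolesOne]
  | succ N ih =>
    have h1 := jacobiDefect_clear (h.clear_pow N) p r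
    rw [ih] at h1
    simp only [clearPoles, clearPolesOne, pow_succ'] at h1 ⊢
    rw [Module.End.mul_apply, Module.End.mul_apply, Module.End.mul_apply, h1]
    congr 1 <;> push_cast <;> ring

/-- A solution of the recursion `J (p + 1, r) = J (p, r) + J (p, r + 1)` vanishing for `r ≥ 0` and
for `p = 0` vanishes. -/
theorem eq_zero_of_recursion {J : ℤ → ℤ → M} (hJ : ∀ p r, J (p + 1) r = J p r + J p (r + 1))
    (h₁ : ∀ p, ∀ r ≥ 0, J p r = 0) (h₀ : ∀ r, J 0 r = 0) (p r : ℤ) : J p r = 0 := by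
  induction p using Int.induction_on generalizing r with
  | zero => exact h₀ r
  | succ p ih => rw [hJ, ih, ih, add_zero]
  | pred p ih =>
    -- For negative `p` the recursion is solved for `J p r`, and induction descends in `r` from the
    -- region `r ≥ 0` covered by `h₁`.
    have key : ∀ m : ℕ, ∀ r : ℤ, -(m : ℤ) ≤ r → J (-(p : ℤ) - 1) r = 0 := by
      intro m
      induction m with
      | zero => intro r hr; exact h₁ _ r (by simpa using hr)
      | succ m ihm =>
        intro r hr
        have := hJ (-(p : ℤ) - 1) r
        rw [sub_add_cancel, ih, ihm (r + 1) (by push_cast at hr; omega), add_zero] at this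
        exact this.symm
    exact key r.natAbs r (by omega)

end

/-- `c`, `d`, `e` are the coefficients of the expansions at `∞`, `0` and `1` of a rational function
`P / (z (z - 1))ᴺ`, where `P` is a polynomial of degree less than `3 N`. -/
structure IsRationalTriple (N : ℕ) (c d e : ℤ → M) : Prop where
  left_trunc : ∀ n < -(N : ℤ), c n = 0
  right_trunc : ∀ n ≥ (N : ℤ), d n = 0
  iter_trunc : ∀ n ≥ (N : ℤ), e n = 0
  comm : clearPoles N c = clearPoles N d
  -- The index `Int.negSucc k` belongs to `zᵏ`. The polynomial `P` is re-expanded at `1` by `zᵏ = ∑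
  -- (k choose m) (z - 1)ᵐ`.
  assoc : ∀ m : ℕ, clearPolesOne N e (Int.negSucc m) =
    ∑ k ∈ Finset.range (3 * N), ((k.choose m : ℕ) : ℂ) • clearPoles N c (Int.negSucc k)

theorem clearPoles_right_trunc {d : ℤ → M} {B : ℤ} (h : ∀ n ≥ B, d n = 0) (N : ℕ) :
    ∀ n ≥ B - N, clearPoles N d n = 0 := by
  induction N with
  | zero => simpa [clearPoles] using h
  | succ N ih =>
    intro n hn
    simp only [clearPoles, pow_succ'] at ih ⊢
    simp [ih (n + 1) (by push_cast at hn; omega), ih (n + 1 + 1) (by push_cast at hn; omega)]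

theorem clearPolesOne_right_trunc {d : ℤ → M} {B : ℤ} (h : ∀ n ≥ B, d n = 0) (N : ℕ) :
    ∀ n ≥ B - N, clearPolesOne N d n = 0 := by
  induction N with
  | zero => simpa [clearPolesOne] using h
  | succ N ih =>
    intro n hn
    simp only [clearPolesOne, pow_succ'] at ih ⊢
    simp [ih (n + 1) (by push_cast at hn; omega), ih (n + 1 + 1) (by push_cast at hn; omega)]

/-- Since `z (z - 1)` has degree two, the bound at `∞` moves by two for each factor, against one at
`0` and at `1`. -/
theorem clearPoles_left_trunc {d : ℤ → M} {B : ℤ} (h : ∀ n < B, d n = 0) (N : ℕ) :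
    ∀ n < B - 2 * N, clearPoles N d n = 0 := by
  induction N with
  | zero => simpa [clearPoles] using h
  | succ N ih =>
    intro n hn
    simp only [clearPoles, pow_succ'] at ih ⊢
    simp [ih (n + 1) (by push_cast at hn; omega), ih (n + 1 + 1) (by push_cast at hn; omega)]

namespace IsRationalTriple

variable {N : ℕ} {c d e : ℤ → M}

theorem truncated (h : IsRationalTriple N c d e) : TruncatedTriple c d e :=
  ⟨⟨_, h.left_trunc⟩, ⟨_, h.right_trunc⟩, ⟨_, h.iter_trunc⟩⟩

theorem clear_nonneg (h : IsRationalTriple N c d e) {n : ℤ} (hn : 0 ≤ n) :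
    clearPoles N c n = 0 := by
  rw [h.comm]
  exact clearPoles_right_trunc h.right_trunc N n (by omega)

theorem clear_left (h : IsRationalTriple N c d e) {n : ℤ} (hn : n < -3 * N) :
    clearPoles N c n = 0 :=
  clearPoles_left_trunc h.left_trunc N n (by omega)

theorem clearOne_nonneg (h : IsRationalTriple N c d e) {n : ℤ} (hn : 0 ≤ n) :
    clearPolesOne N e n = 0 :=
  clearPolesOne_right_trunc h.iter_trunc N n (by omega)

/-- Clearing poles replaces `f` by a polynomial at the cost of shifting `p` and `r`. By the
recursion it then suffices to treat `r ≥ 0`, where all weights expand finitely in `z - 1`, and `p =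
0`, which is the re-expansion at `1`. -/
theorem jacobiDefect_eq_zero (h : IsRationalTriple N c d e) (p r : ℤ) :
    jacobiDefect c d e p r = 0 := by
  have ht := h.truncated.clear_pow N
  rw [show p = p - N + N by ring, show r = r - N + N by ring, ← jacobiDefect_clear_pow h.truncated]
  generalize p - N = p
  generalize r - N = r
  refine eq_zero_of_recursion (J := jacobiDefect _ _ _) (jacobiDefect_succ ht) ?_ ?_ p r
  · intro p r hr
    lift r to ℕ using hr
    have hch : ∀ i : ℕ, Ring.choose (r : ℤ) i = (r.choose i : ℤ) := fun i => by
      rw [Ring.choose_natCast]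
    rw [jacobiDefect, jacobiIterate, jacobiLeft, jacobiRight, ← h.comm]
    simp only [hch, Int.cast_natCast]
    have h1 : ∑ᶠ i : ℕ, ((-1 : ℂ) ^ i * (r.choose i : ℂ)) • clearPoles N c (p + r - i) =
        ∑ i ∈ Finset.range (r + 1), ((-1 : ℂ) ^ i * (r.choose i : ℂ)) • clearPoles N c (p + r - i) :=
      finsum_eq_sum_range fun i hi => by rw [Nat.choose_eq_zero_of_lt (by omega)]; simp
    have h2 : ∑ᶠ i : ℕ, ((-1 : ℂ) ^ i * (r.choose i : ℂ)) • clearPoles N c (p + i) =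
        ∑ i ∈ Finset.range (r + 1), ((-1 : ℂ) ^ i * (r.choose i : ℂ)) • clearPoles N c (p + i) :=
      finsum_eq_sum_range fun i hi => by rw [Nat.choose_eq_zero_of_lt (by omega)]; simp
    have h3 : ∑ᶠ i : ℕ, ((Ring.choose p i : ℤ) : ℂ) • clearPolesOne N e (r + i) = 0 := by
      rw [← finsum_zero (α := ℕ)]
      exact finsum_congr fun i => by rw [h.clearOne_nonneg (by omega), smul_zero]
    -- The cleared coefficients at `∞` and `0` coincide, so the two products are one finite binomial
    -- sum read from opposite ends.
    rw [h1, h2, h3, ← Finset.sum_range_reflect, Finset.smul_sum, zero_sub, neg_eq_zero, sub_eq_zero]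
    refine Finset.sum_congr rfl fun i hi => ?_
    have hi' : i ≤ r := by simpa [Nat.lt_succ_iff] using hi
    rw [show r + 1 - 1 - i = r - i by omega, Nat.choose_symm hi', smul_smul, Nat.cast_sub hi',
      show p + r - ((r : ℤ) - i) = p + i by ring]
    congr 1
    rw [← mul_assoc]
    congr 1
    rw [zpow_natCast]
    obtain ⟨k, rfl⟩ := Nat.exists_eq_add_of_le hi'
    rw [Nat.add_sub_cancel_left, pow_add, mul_right_comm, ← pow_add]
    simp [Even.neg_one_pow (Even.add_self i)]
  · intro r
    rcases le_or_gt 0 r with hr | hr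
    · lift r to ℕ using hr
      rw [jacobiDefect, jacobiIterate, jacobiLeft, jacobiRight, ← h.comm]
      rw [finsum_eq_sum_range (B := 0), finsum_eq_sum_range (B := r + 1),
        finsum_eq_sum_range (B := 0)]
      · simp only [Finset.range_zero, Finset.sum_empty, smul_zero, sub_zero, zero_sub,
          neg_eq_zero]
        refine Finset.sum_eq_zero fun i hi => ?_
        rw [h.clear_nonneg, smul_zero]
        rw [Finset.mem_range] at hi
        omega
      · intro i hi
        rw [h.clear_nonneg (by omega), smul_zero]
      · intro i hi
        rw [Ring.choose_natCast, Nat.choose_eq_zero_of_lt (by omega)]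
        simp
      · intro i hi
        rw [h.clearOne_nonneg (by omega), smul_zero]
    · obtain ⟨m, rfl⟩ := Int.eq_negSucc_of_lt_zero hr
      rw [jacobiDefect, jacobiIterate, jacobiLeft, jacobiRight, ← h.comm]
      -- The truncated subtraction is harmless: for `m ≥ 3 * N` the product is empty, and so all the
      -- binomials `k.choose m` vanish on the other side.
      rw [finsum_eq_sum_range (B := 1), finsum_eq_sum_range (B := 3 * N - m),
        finsum_eq_sum_range (B := 0)]
      · simp only [Finset.range_one, Finset.sum_singleton, Ring.choose_zero_right, Int.cast_one,
          one_smul, Nat.cast_zero, add_zero, h.assoc, Finset.range_zero, Finset.sum_empty,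
          smul_zero, sub_zero, zero_add]
        rw [sub_eq_zero]
        -- Upper negation of the binomial turns the expansion of `(z - 1)^(-m-1)` at `∞` into the
        -- Taylor coefficients at `1`.
        have hterm : ∀ i : ℕ, ((-1 : ℂ) ^ i * ((Ring.choose (Int.negSucc m) i : ℤ) : ℂ)) =
            (((m + i).choose m : ℕ) : ℂ) := by
          intro i
          rw [Int.negSucc_eq, Ring.choose_neg]
          rw [show (m : ℤ) + 1 + i - 1 = ((m + i : ℕ) : ℤ) by push_cast; ring,
            Ring.choose_natCast, Nat.choose_symm_add]
          rcases Nat.even_or_odd i with hi | hi <;> simp [hi, Int.negOnePow_even, Int.negOnePow_odd]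
        simp only [hterm]
        rcases le_total (3 * N) m with hm | hm
        · rw [Nat.sub_eq_zero_of_le hm, Finset.range_zero, Finset.sum_empty]
          refine Finset.sum_eq_zero fun k hk => ?_
          rw [Nat.choose_eq_zero_of_lt (lt_of_lt_of_le (Finset.mem_range.1 hk) hm)]
          simp
        · obtain ⟨B, hB⟩ := Nat.exists_eq_add_of_le hm
          rw [hB, Nat.add_sub_cancel_left, Finset.sum_range_add]
          rw [Finset.sum_eq_zero, zero_add]
          · refine Finset.sum_congr rfl fun i _ => ?_
            rw [show Int.negSucc (m + i) = Int.negSucc m - i by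
              rw [Int.negSucc_eq, Int.negSucc_eq]; push_cast; ring]
          · intro k hk
            rw [Nat.choose_eq_zero_of_lt (Finset.mem_range.1 hk)]
            simp
      · intro i hi
        rw [h.clear_nonneg (by omega), smul_zero]
      · intro i hi
        rw [h.clear_left (by omega), smul_zero]
      · intro i hi
        rw [Ring.choose_zero_pos _ (by omega)]
        simp

end IsRationalTriple

end LaurentTriples

/-! ### Restriction of two-variable expansions to the diagonal -/

section Diagonals

variable {M : Type*} [AddCommGroup M] [Module ℂ M]

/-- The coefficients of `∑ C k l z⁻ᵏ⁻¹ w⁻ˡ⁻¹` at `w = z`. -/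
def diagSeq (C : ℤ → ℤ → M) (n : ℤ) : M := ∑ᶠ k : ℤ, C k (n - 1 - k)

/-- All the sums defining the diagonal are finite. -/
def DiagFinite (C : ℤ → ℤ → M) : Prop := ∀ n, (Function.support fun k : ℤ => C k (n - k)).Finite

theorem diagFinite_of_left {C : ℤ → ℤ → M} {B : ℤ} (h₁ : ∀ k l, k < B → C k l = 0)
    (h₂ : ∀ k l, l < B → C k l = 0) : DiagFinite C := fun n => by
  refine (Set.finite_Icc B (n - B)).subset fun k hk => ?_
  by_contra h
  rw [Set.mem_Icc, not_and_or, not_le, not_le] at h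
  exact hk (h.elim (fun h => h₁ _ _ h) (fun h => h₂ _ _ (by omega)))

theorem diagFinite_of_right {C : ℤ → ℤ → M} {B : ℤ} (h₁ : ∀ k l, k ≥ B → C k l = 0)
    (h₂ : ∀ k l, l ≥ B → C k l = 0) : DiagFinite C := fun n => by
  refine (Set.finite_Icc (n - B) B).subset fun k hk => ?_
  by_contra h
  rw [Set.mem_Icc, not_and_or, not_le, not_le] at h
  exact hk (h.elim (fun h => h₂ _ _ (by omega)) (fun h => h₁ _ _ h.le))

/-- An operator acting in the first index. -/
def onFirst (P : Module.End ℂ (ℤ → M)) (C : ℤ → ℤ → M) : ℤ → ℤ → M :=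
  fun k l => P (fun k' => C k' l) k

/-- An operator acting in the second index. -/
def onSecond (P : Module.End ℂ (ℤ → M)) (C : ℤ → ℤ → M) : ℤ → ℤ → M := fun k => P (C k)

/-- The operators `E² + ε E`. -/
def IsQuadShift (P : Module.End ℂ (ℤ → M)) (ε : ℂ) : Prop :=
  ∀ c n, P c n = c (n + 1 + 1) + ε • c (n + 1)

theorem isQuadShift_clearPole : IsQuadShift (M := M) clearPole (-1) := fun c n => by
  simp [sub_eq_add_neg]

theorem isQuadShift_clearPoleOne : IsQuadShift (M := M) clearPoleOne 1 := fun c n => by simp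

variable {P : Module.End ℂ (ℤ → M)} {ε : ℂ}

theorem IsQuadShift.onSecond_apply (hP : IsQuadShift P ε) (C : ℤ → ℤ → M) (k l : ℤ) :
    onSecond P C k l = C k (l + 1 + 1) + ε • C k (l + 1) := hP _ _

theorem IsQuadShift.onFirst_apply (hP : IsQuadShift P ε) (C : ℤ → ℤ → M) (k l : ℤ) :
    onFirst P C k l = C (k + 1 + 1) l + ε • C (k + 1) l := hP _ _

theorem DiagFinite.onSecond (hP : IsQuadShift P ε) {C : ℤ → ℤ → M} (hC : DiagFinite C) :
    DiagFinite (onSecond P C) := fun n => by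
  refine ((hC (n + 1 + 1)).union (hC (n + 1))).subset fun k hk => ?_
  by_contra h
  simp only [Set.mem_union, Function.mem_support, not_or, not_not] at h
  apply hk
  refine (hP.onSecond_apply _ _ _).trans ?_
  rw [show n - k + 1 + 1 = n + 1 + 1 - k by ring, show n - k + 1 = n + 1 - k by ring, h.1, h.2]
  simp

/-- Setting `w = z` is multiplicative, so a factor `q(w)` becomes `q(z)`; on coefficients this is a
regrouping of finite sums. -/
theorem diagSeq_onSecond (hP : IsQuadShift P ε) {C : ℤ → ℤ → M} (hC : DiagFinite C) :
    P (diagSeq C) = diagSeq (onSecond P C) := by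
  ext n
  have h1 : ∀ m, (Function.support fun k : ℤ => C k (m - 1 - k)).Finite := fun m => hC (m - 1)
  rw [hP, diagSeq, diagSeq, diagSeq, smul_finsum' _ (h1 _), ← finsum_add_distrib (h1 _)]
  · refine finsum_congr fun k => ?_
    rw [hP.onSecond_apply]
    congr 3 <;> ring
  · exact (h1 (n + 1)).subset fun k hk hk' => hk (by simp only [hk', smul_zero])

theorem DiagFinite.onFirst (hP : IsQuadShift P ε) {C : ℤ → ℤ → M} (hC : DiagFinite C) :
    DiagFinite (onFirst P C) := fun n => by
  refine (((hC (n + 1 + 1)).preimage (add_left_injective (1 + 1)).injOn).union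
    ((hC (n + 1)).preimage (add_left_injective 1).injOn)).subset fun k hk => ?_
  by_contra h
  simp only [Set.mem_union, Set.mem_preimage, Function.mem_support, not_or, not_not] at h
  apply hk
  refine (hP.onFirst_apply _ _ _).trans ?_
  have h1 := h.1
  have h2 := h.2
  rw [show n + 1 + 1 - (k + (1 + 1)) = n - k by ring, ← add_assoc] at h1
  rw [show n + 1 - (k + 1) = n - k by ring] at h2
  rw [h1, h2]
  simp

theorem diagSeq_onFirst (hP : IsQuadShift P ε) {C : ℤ → ℤ → M} (hC : DiagFinite C) :
    P (diagSeq C) = diagSeq (onFirst P C) := by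
  ext n
  have h1 : ∀ m, (Function.support fun k : ℤ => C k (m - 1 - k)).Finite := fun m => hC (m - 1)
  have h2 : ∀ j m : ℤ, (Function.support fun k : ℤ => C (k + j) (m - 1 - (k + j))).Finite :=
    fun j m => ((h1 m).preimage (add_left_injective j).injOn :)
  have h3 : ∀ j m : ℤ, ∑ᶠ k : ℤ, C k (m - 1 - k) = ∑ᶠ k : ℤ, C (k + j) (m - 1 - (k + j)) :=
    fun j m => (finsum_comp_equiv (Equiv.addRight j)).symm
  rw [hP, diagSeq, diagSeq, diagSeq, h3 (1 + 1), h3 1, smul_finsum' _ (h2 _ _),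
    ← finsum_add_distrib (h2 _ _)]
  · refine finsum_congr fun k => ?_
    rw [hP.onFirst_apply]
    rw [← add_assoc, show n + 1 + 1 - 1 - (k + 1 + 1) = n - 1 - k by ring,
      show n + 1 - 1 - (k + 1) = n - 1 - k by ring]
  · exact (h2 1 (n + 1)).subset fun k hk hk' => hk (by simp only [hk', smul_zero])

theorem onFirst_pow_succ (C : ℤ → ℤ → M) (N : ℕ) :
    onFirst (P ^ (N + 1)) C = onFirst P (onFirst (P ^ N) C) := by
  rw [pow_succ']; rfl

theorem onSecond_pow_succ (C : ℤ → ℤ → M) (N : ℕ) :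
    onSecond (P ^ (N + 1)) C = onSecond P (onSecond (P ^ N) C) := by
  rw [pow_succ']; rfl

theorem diagSeq_onFirst_pow (hP : IsQuadShift P ε) {C : ℤ → ℤ → M} (hC : DiagFinite C) (N : ℕ) :
    DiagFinite (onFirst (P ^ N) C) ∧ (P ^ N) (diagSeq C) = diagSeq (onFirst (P ^ N) C) := by
  induction N with
  | zero => exact ⟨hC, rfl⟩
  | succ N ih =>
    rw [onFirst_pow_succ]
    refine ⟨ih.1.onFirst hP, ?_⟩
    rw [pow_succ', Module.End.mul_apply, ih.2, diagSeq_onFirst hP ih.1]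

theorem diagSeq_onSecond_pow (hP : IsQuadShift P ε) {C : ℤ → ℤ → M} (hC : DiagFinite C) (N : ℕ) :
    DiagFinite (onSecond (P ^ N) C) ∧ (P ^ N) (diagSeq C) = diagSeq (onSecond (P ^ N) C) := by
  induction N with
  | zero => exact ⟨hC, rfl⟩
  | succ N ih =>
    rw [onSecond_pow_succ]
    refine ⟨ih.1.onSecond hP, ?_⟩
    rw [pow_succ', Module.End.mul_apply, ih.2, diagSeq_onSecond hP ih.1]

/-- The factors clearing the poles in the two variables merge on the diagonal, which doubles the
exponent. -/
theorem diagSeq_pow_two_mul (hP : IsQuadShift P ε) {C : ℤ → ℤ → M} (hC : DiagFinite C) (N : ℕ) :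
    (P ^ (2 * N)) (diagSeq C) = diagSeq (onFirst (P ^ N) (onSecond (P ^ N) C)) := by
  have h := diagSeq_onSecond_pow hP hC N
  rw [two_mul, pow_add, Module.End.mul_apply, h.2, (diagSeq_onFirst_pow hP h.1 N).2]

/-- Powers of `P` are combinations of shifts of the first index, and any linear operator in the
second index respects these. -/
theorem onFirst_onSecond (hP : IsQuadShift P ε) (Q : Module.End ℂ (ℤ → M)) (N : ℕ)
    (C : ℤ → ℤ → M) :
    onFirst (P ^ N) (onSecond Q C) = onSecond Q (onFirst (P ^ N) C) := by
  induction N with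
  | zero => rfl
  | succ N ih =>
    rw [onFirst_pow_succ, onFirst_pow_succ, ih]
    ext k l
    rw [hP.onFirst_apply]
    simp only [onSecond]
    rw [show onFirst P (onFirst (P ^ N) C) k = onFirst (P ^ N) C (k + 1 + 1) +
      ε • onFirst (P ^ N) C (k + 1) from funext fun l => hP.onFirst_apply _ _ _, map_add, map_smul]
    rfl

/-- The hypotheses leave only nonnegative powers of both variables, so the diagonal is a Cauchy
product. -/
theorem diagSeq_negSucc {C : ℤ → ℤ → M} (h₁ : ∀ k l, 0 ≤ k → C k l = 0)
    (h₂ : ∀ k l, 0 ≤ l → C k l = 0) (n : ℕ) :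
    diagSeq C (Int.negSucc n) =
      ∑ x ∈ Finset.HasAntidiagonal.antidiagonal n, C (Int.negSucc x.1) (Int.negSucc x.2) := by
  have hinj : Set.InjOn (fun x : ℕ × ℕ => Int.negSucc x.1) (Finset.HasAntidiagonal.antidiagonal n) := by
    rintro ⟨a, b⟩ h ⟨a', b'⟩ h' hh
    simp at h h' hh ⊢
    omega
  rw [diagSeq, finsum_eq_sum_of_support_subset
    (s := (Finset.HasAntidiagonal.antidiagonal n).image fun x => Int.negSucc x.1), Finset.sum_image hinj]
  · refine Finset.sum_congr rfl fun x hx => ?_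
    rw [Finset.HasAntidiagonal.mem_antidiagonal] at hx
    congr 1
    simp only [Int.negSucc_eq]
    omega
  · intro k hk
    rcases le_or_gt 0 k with h | h
    · exact absurd (h₁ _ _ h) hk
    rcases le_or_gt 0 (Int.negSucc n - 1 - k) with h' | h'
    · exact absurd (h₂ _ _ h') hk
    obtain ⟨m, rfl⟩ := Int.eq_negSucc_of_lt_zero h
    simp only [Finset.coe_image, Set.mem_image, SetLike.mem_coe, Finset.HasAntidiagonal.mem_antidiagonal]
    simp only [Int.negSucc_eq] at h'
    exact ⟨(m, n - m), by simp only; omega, rfl⟩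

/-- Vandermonde's identity: both sides are the coefficient of `(z - 1)ⁿ` in `p(z, z)`, on the left
after expanding each variable at `1` separately. -/
theorem sum_antidiagonal_choose_mul {p : ℕ → ℕ → M} {D : ℕ} (h₁ : ∀ k l, D ≤ k → p k l = 0)
    (h₂ : ∀ k l, D ≤ l → p k l = 0) (n : ℕ) :
    ∑ x ∈ Finset.HasAntidiagonal.antidiagonal n, ∑ l ∈ Finset.range D, ((l.choose x.2 : ℕ) : ℂ) •
      ∑ k ∈ Finset.range D, ((k.choose x.1 : ℕ) : ℂ) • p k l =
    ∑ j ∈ Finset.range (2 * D), ((j.choose n : ℕ) : ℂ) •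
      ∑ x ∈ Finset.HasAntidiagonal.antidiagonal j, p x.1 x.2 := by
  have hL : ∑ x ∈ Finset.HasAntidiagonal.antidiagonal n, ∑ l ∈ Finset.range D, ((l.choose x.2 : ℕ) : ℂ) •
      ∑ k ∈ Finset.range D, ((k.choose x.1 : ℕ) : ℂ) • p k l =
      ∑ y ∈ Finset.range D ×ˢ Finset.range D, (((y.1 + y.2).choose n : ℕ) : ℂ) • p y.1 y.2 := by
    simp only [Finset.smul_sum]
    rw [Finset.sum_comm, Finset.sum_product_right]
    refine Finset.sum_congr rfl fun l _ => ?_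
    rw [Finset.sum_comm]
    refine Finset.sum_congr rfl fun k _ => ?_
    rw [Nat.add_choose_eq, Nat.cast_sum, Finset.sum_smul]
    refine Finset.sum_congr rfl fun x _ => ?_
    rw [smul_smul, Nat.cast_mul, mul_comm]
  rw [hL, ← Finset.sum_fiberwise_of_maps_to (t := Finset.range (2 * D)) (g := fun y => y.1 + y.2)]
  · refine Finset.sum_congr rfl fun j _ => ?_
    rw [Finset.smul_sum]
    refine Eq.trans ?_ (Finset.sum_subset
      (s₁ := {y ∈ Finset.range D ×ˢ Finset.range D | y.1 + y.2 = j}) ?_ ?_)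
    · refine Finset.sum_congr rfl fun y hy => ?_
      rw [(Finset.mem_filter.1 hy).2]
    · intro y hy
      simp only [Finset.mem_filter] at hy
      simpa only [Finset.HasAntidiagonal.mem_antidiagonal] using hy.2
    · intro y hy hy'
      simp only [Finset.HasAntidiagonal.mem_antidiagonal] at hy
      simp only [Finset.mem_filter, Finset.mem_product, Finset.mem_range, hy, and_true,
        not_and_or, not_lt] at hy'
      rw [hy'.elim (h₁ _ _) (h₂ _ _), smul_zero]
  · intro y hy
    simp only [Finset.mem_product, Finset.mem_range] at hy ⊢
    omega

/-- Restriction to the diagonal of a rational function of two variables. -/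
theorem IsRationalTriple.diag {N : ℕ} {cc dc dd de ec ed ee : ℤ → ℤ → M}
    (h₁ : ∀ l, IsRationalTriple N (fun k => cc k l) (fun k => dc k l) (fun k => ec k l))
    (h₂ : ∀ k, IsRationalTriple N (dc k) (dd k) (de k))
    (h₃ : ∀ k, IsRationalTriple N (ec k) (ed k) (ee k))
    (hcc : ∀ k l, l < -(N : ℤ) → cc k l = 0) (hdd : ∀ k l, k ≥ (N : ℤ) → dd k l = 0)
    (hee : ∀ k l, k ≥ (N : ℤ) → ee k l = 0) :
    IsRationalTriple (2 * N) (diagSeq cc) (diagSeq dd) (diagSeq ee) := by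
  -- The first letter is the point of expansion in the first variable and the second letter that in
  -- the second variable, with `c`, `d`, `e` for `∞`, `0`, `1`. Three triples connect the pure
  -- expansions `cc`, `dd`, `ee` through the mixed `dc` and `ec`.
  have fcc : DiagFinite cc := diagFinite_of_left (fun k l hk => (h₁ l).left_trunc k hk) hcc
  have fdd : DiagFinite dd := diagFinite_of_right hdd (fun k l hl => (h₂ k).right_trunc l hl)
  have fee : DiagFinite ee := diagFinite_of_right hee (fun k l hl => (h₃ k).iter_trunc l hl)
  have q := isQuadShift_clearPole (M := M)
  have q1 := isQuadShift_clearPoleOne (M := M)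
  have e1 : onFirst (clearPoles N) cc = onFirst (clearPoles N) dc := by
    ext k l; exact congrFun (h₁ l).comm k
  have e2 : onSecond (clearPoles N) dc = onSecond (clearPoles N) dd := by
    ext k : 1; exact (h₂ k).comm
  have hcd : onFirst (clearPoles N) (onSecond (clearPoles N) cc) =
      onFirst (clearPoles N) (onSecond (clearPoles N) dd) := by
    rw [← e2, clearPoles, onFirst_onSecond q, onFirst_onSecond q]
    exact congrArg _ e1
  -- With the poles cleared in both variables, `cc` is a polynomial: `z1` and `z2` exclude negative
  -- powers, `z3` and `z4` bound the degrees by `3 * N`. Each vanishing is read off from the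
  -- expansion in which it is visible.
  have z1 : ∀ k l, 0 ≤ k → onFirst (clearPoles N) (onSecond (clearPoles N) cc) k l = 0 := by
    intro k l hk
    have : onFirst (clearPoles N) cc k = 0 := by
      ext l; exact (h₁ l).clear_nonneg hk
    rw [clearPoles, onFirst_onSecond q]
    change clearPoles N (onFirst (clearPoles N) cc k) l = 0
    rw [this, map_zero]; rfl
  have z2 : ∀ k l, 0 ≤ l → onFirst (clearPoles N) (onSecond (clearPoles N) cc) k l = 0 := by
    intro k l hl
    rw [hcd]
    have : (fun k' => onSecond (clearPoles N) dd k' l) = 0 := by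
      ext k'
      rw [← e2]
      exact (h₂ k').clear_nonneg hl
    rw [onFirst, this, map_zero]; rfl
  have z3 : ∀ k l : ℕ, 3 * N ≤ k → onFirst (clearPoles N) (onSecond (clearPoles N) cc)
      (Int.negSucc k) (Int.negSucc l) = 0 := by
    intro k l hk
    have : onFirst (clearPoles N) cc (Int.negSucc k) = 0 := by
      ext l; exact (h₁ l).clear_left (by omega)
    rw [clearPoles, onFirst_onSecond q]
    change clearPoles N (onFirst (clearPoles N) cc (Int.negSucc k)) _ = 0
    rw [this, map_zero]; rfl
  have z4 : ∀ k l : ℕ, 3 * N ≤ l → onFirst (clearPoles N) (onSecond (clearPoles N) cc)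
      (Int.negSucc k) (Int.negSucc l) = 0 := by
    intro k l hl
    have : (fun k' => onSecond (clearPoles N) cc k' (Int.negSucc l)) = 0 := by
      ext k'
      exact clearPoles_left_trunc (hcc k') N _ (by omega)
    rw [onFirst, this, map_zero]; rfl
  have z5 : ∀ k l, 0 ≤ k → onFirst (clearPolesOne N) (onSecond (clearPolesOne N) ee) k l = 0 := by
    intro k l hk
    have : onFirst (clearPolesOne N) ee k = 0 := by
      ext l; exact clearPolesOne_right_trunc (fun k hk => hee k l hk) N _ (by omega)
    rw [clearPolesOne, onFirst_onSecond q1]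
    change clearPolesOne N (onFirst (clearPolesOne N) ee k) l = 0
    rw [this, map_zero]; rfl
  have z6 : ∀ k l, 0 ≤ l → onFirst (clearPolesOne N) (onSecond (clearPolesOne N) ee) k l = 0 := by
    intro k l hl
    have : (fun k' => onSecond (clearPolesOne N) ee k' l) = 0 := by
      ext k'
      exact (h₃ k').clearOne_nonneg hl
    rw [onFirst, this, map_zero]; rfl
  -- The polynomial is re-expanded at `1` in the second variable through `h₃`, then in the first
  -- through `h₁`.
  have key : ∀ m m' : ℕ, onFirst (clearPolesOne N) (onSecond (clearPolesOne N) ee)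
      (Int.negSucc m) (Int.negSucc m') = ∑ l ∈ Finset.range (3 * N), ((l.choose m' : ℕ) : ℂ) •
        ∑ k ∈ Finset.range (3 * N), ((k.choose m : ℕ) : ℂ) •
          onFirst (clearPoles N) (onSecond (clearPoles N) cc) (Int.negSucc k) (Int.negSucc l) := by
    intro m m'
    have a1 : (fun k' => onSecond (clearPolesOne N) ee k' (Int.negSucc m')) =
        ∑ l ∈ Finset.range (3 * N), ((l.choose m' : ℕ) : ℂ) •
          (fun k' => onSecond (clearPoles N) ec k' (Int.negSucc l)) := by
      ext k'
      simp only [Finset.sum_apply, Pi.smul_apply]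
      exact (h₃ k').assoc m'
    have a2 : onFirst (clearPolesOne N) ec (Int.negSucc m) =
        ∑ k ∈ Finset.range (3 * N), ((k.choose m : ℕ) : ℂ) •
          onFirst (clearPoles N) cc (Int.negSucc k) := by
      ext l
      simp only [Finset.sum_apply, Pi.smul_apply]
      exact (h₁ l).assoc m
    rw [onFirst, a1, map_sum, Finset.sum_apply]
    refine Finset.sum_congr rfl fun l _ => ?_
    rw [map_smul, Pi.smul_apply]
    congr 1
    change onFirst (clearPolesOne N) (onSecond (clearPoles N) ec) _ _ = _
    rw [clearPolesOne, onFirst_onSecond q1]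
    change clearPoles N (onFirst (clearPolesOne N) ec (Int.negSucc m)) _ = _
    rw [a2, map_sum, Finset.sum_apply]
    refine Finset.sum_congr rfl fun k _ => ?_
    rw [map_smul, Pi.smul_apply]
    congr 1
    rw [clearPoles, onFirst_onSecond q]; rfl
  have hT : clearPoles (2 * N) (diagSeq cc) = diagSeq _ := diagSeq_pow_two_mul q fcc N
  have hT' : clearPoles (2 * N) (diagSeq dd) = diagSeq _ := diagSeq_pow_two_mul q fdd N
  have hS : clearPolesOne (2 * N) (diagSeq ee) = diagSeq _ := diagSeq_pow_two_mul q1 fee N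
  refine ⟨fun n hn => ?_, fun n hn => ?_, fun n hn => ?_, ?_, fun m => ?_⟩
  · rw [diagSeq, ← finsum_zero (α := ℤ)]
    refine finsum_congr fun k => ?_
    rcases lt_or_ge k (-(N : ℤ)) with h | h
    · exact (h₁ _).left_trunc k h
    · exact hcc _ _ (by push_cast at hn; omega)
  · rw [diagSeq, ← finsum_zero (α := ℤ)]
    refine finsum_congr fun k => ?_
    rcases lt_or_ge k (N : ℤ) with h | h
    · exact (h₂ _).right_trunc _ (by push_cast at hn; omega)
    · exact hdd _ _ h
  · rw [diagSeq, ← finsum_zero (α := ℤ)]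
    refine finsum_congr fun k => ?_
    rcases lt_or_ge k (N : ℤ) with h | h
    · exact (h₃ _).iter_trunc _ (by push_cast at hn; omega)
    · exact hee _ _ h
  · rw [hT, hT']
    exact congrArg diagSeq hcd
  · rw [hT, hS]
    have s1 := diagSeq_negSucc (C := onFirst (clearPolesOne N) (onSecond (clearPolesOne N) ee)) z5 z6 m
    have s2 : ∀ k, _ :=
      diagSeq_negSucc (C := onFirst (clearPoles N) (onSecond (clearPoles N) cc)) z1 z2
    refine s1.trans ?_
    have s3 := sum_antidiagonal_choose_mul (p := fun k l => onFirst (clearPoles N)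
      (onSecond (clearPoles N) cc) (Int.negSucc k) (Int.negSucc l)) z3 z4 m
    simp only [key]
    rw [s3, show 3 * (2 * N) = 2 * (3 * N) by ring]
    exact Finset.sum_congr rfl fun j _ => congrArg _ (s2 j).symm

end Diagonals

theorem HasSum.of_forall_eq {ι E : Type*} [AddCommMonoid E] [TopologicalSpace E] {f g : ι → E}
    {s : E} (h : HasSum f s) (hfg : ∀ i, g i = f i) : HasSum g s := (funext hfg : g = f) ▸ h

/-! ### Power series on the unit disc and removal of exceptional curves -/

section PowerSeries

open Filter Topology

/-- The sum of a power series. -/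
def powSum (a : ℕ → ℂ) (z : ℂ) : ℂ := ∑' n, a n * z ^ n

theorem hasFPowerSeriesOnBall_powSum {a : ℕ → ℂ}
    (h : ∀ z : ℂ, z ≠ 0 → ‖z‖ < 1 → Summable fun n => a n * z ^ n) :
    HasFPowerSeriesOnBall (powSum a) (FormalMultilinearSeries.ofScalars ℂ a) 0 1 := by
  have hs : ∀ z : ℂ, ‖z‖ < 1 → Summable fun n => a n * z ^ n := by
    intro z hz
    rcases eq_or_ne z 0 with rfl | h0
    · refine summable_of_ne_finset_zero (s := {0}) fun n hn => ?_
      rw [Finset.mem_singleton] at hn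
      simp [hn]
    · exact h z h0 hz
  refine ⟨?_, one_pos, ?_⟩
  · refine ENNReal.le_of_forall_nnreal_lt fun r hr => ?_
    refine FormalMultilinearSeries.le_radius_of_summable _ ?_
    have h1 : ‖((r : ℝ) : ℂ)‖ < 1 := by
      rw [Complex.norm_real]
      simpa using hr
    refine (hs _ h1).norm.congr fun n => ?_
    rw [FormalMultilinearSeries.ofScalars_norm, norm_mul, norm_pow, Complex.norm_real]
    simp
  · intro y hy
    have hy' : ‖y‖ < 1 := by
      simpa [← enorm_eq_nnnorm, ← ofReal_norm] using hy
    rw [FormalMultilinearSeries.ofScalars_apply_eq', zero_add]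
    exact (hs y hy').hasSum

theorem differentiableAt_powSum {a : ℕ → ℂ}
    (h : ∀ z : ℂ, z ≠ 0 → ‖z‖ < 1 → Summable fun n => a n * z ^ n) {z : ℂ} (hz : ‖z‖ < 1) :
    DifferentiableAt ℂ (powSum a) z := by
  refine (hasFPowerSeriesOnBall_powSum h).differentiableOn.differentiableAt ?_
  refine Metric.isOpen_eball.mem_nhds ?_
  simpa [← enorm_eq_nnnorm, ← ofReal_norm] using hz

theorem eq_zero_of_hasSum_zero {a : ℕ → ℂ}
    (h : ∀ z : ℂ, z ≠ 0 → ‖z‖ < 1 → HasSum (fun n => a n * z ^ n) 0) : a = 0 := by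
  have hs := hasFPowerSeriesOnBall_powSum fun z h0 h1 => (h z h0 h1).summable
  have h0 : ∀ᶠ z in 𝓝[≠] (0 : ℂ), powSum a z = 0 := by
    have : Metric.ball (0 : ℂ) 1 ∈ 𝓝[≠] (0 : ℂ) :=
      mem_nhdsWithin_of_mem_nhds (Metric.ball_mem_nhds _ one_pos)
    filter_upwards [this, self_mem_nhdsWithin] with z hz hz0
    exact (h z hz0 (by simpa using hz)).tsum_eq
  have hfe : powSum a =ᶠ[𝓝 0] 0 := hs.analyticAt.frequently_zero_iff_eventually_zero.1 h0.frequently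
  have := (hs.hasFPowerSeriesAt.congr hfe).eq_zero
  rwa [FormalMultilinearSeries.ofScalars_series_eq_zero] at this

theorem coeff_unique {a b : ℕ → ℂ} {F : ℂ → ℂ}
    (ha : ∀ z : ℂ, z ≠ 0 → ‖z‖ < 1 → HasSum (fun n => a n * z ^ n) (F z))
    (hb : ∀ z : ℂ, z ≠ 0 → ‖z‖ < 1 → HasSum (fun n => b n * z ^ n) (F z)) : a = b := by
  rw [← sub_eq_zero]
  refine eq_zero_of_hasSum_zero fun z h0 h1 => ?_
  have := (ha z h0 h1).sub (hb z h0 h1)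
  simp only [sub_self, ← sub_mul] at this
  exact this

/-- A `C¹` function on an open set which is holomorphic on a dense part of it is holomorphic. -/
theorem differentiableAt_of_dense {f : ℂ → ℂ} {U S : Set ℂ} (hU : IsOpen U)
    (hf : ContDiffOn ℝ 1 f U) (hS : Dense S) (hfS : ∀ z ∈ U ∩ S, DifferentiableAt ℂ f z) {z : ℂ}
    (hz : z ∈ U) : DifferentiableAt ℂ f z := by
  rw [differentiableAt_complex_iff_differentiableAt_real]
  refine ⟨(hf.differentiableOn one_ne_zero).differentiableAt (hU.mem_nhds hz), ?_⟩
  have hc : ContinuousOn (fderiv ℝ f) U := hf.continuousOn_fderiv_of_isOpen hU le_rfl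
  -- The Cauchy–Riemann defect is continuous on `U` and vanishes on a dense subset of it.
  have hc' : ContinuousOn (fun w => fderiv ℝ f w Complex.I - Complex.I • fderiv ℝ f w 1) U :=
    (hc.clm_apply continuousOn_const).sub
      (continuousOn_const.mul (hc.clm_apply continuousOn_const))
  rw [← sub_eq_zero]
  have hzc : z ∈ closure (U ∩ S) := hS.open_subset_closure_inter hU hz
  have : Set.MapsTo (fun w => fderiv ℝ f w Complex.I - Complex.I • fderiv ℝ f w 1) (U ∩ S) {0} := by
    intro w hw
    rw [Set.mem_singleton_iff, sub_eq_zero]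
    exact (differentiableAt_complex_iff_differentiableAt_real.1 (hfS w hw)).2
  have h2 := ((hc' z hz).mono Set.inter_subset_left).mem_closure hzc this
  simpa using h2

end PowerSeries

/-! ### Rationality from convergent expansions at three points -/

section Expansions

open Filter Topology

theorem hasSum_shiftSeq {c : ℤ → ℂ} {z s : ℂ} (hz : z ≠ 0)
    (h : HasSum (fun n : ℤ => c n * z ^ (-n - 1)) s) :
    HasSum (fun n : ℤ => c (n + 1) * z ^ (-n - 1)) (z * s) := by
  have := ((Equiv.addRight (1 : ℤ)).hasSum_iff.2 h).mul_left z
  refine this.of_forall_eq fun n => ?_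
  simp only [Function.comp_apply, Equiv.coe_addRight]
  rw [show -n - 1 = -(n + 1) - 1 + 1 by ring, zpow_add_one₀ hz]
  ring

theorem hasSum_clearPoles {c : ℤ → ℂ} {z s : ℂ} (hz : z ≠ 0)
    (h : HasSum (fun n : ℤ => c n * z ^ (-n - 1)) s) (N : ℕ) :
    HasSum (fun n : ℤ => clearPoles N c n * z ^ (-n - 1)) ((z * (z - 1)) ^ N * s) := by
  induction N with
  | zero => simpa [clearPoles] using h
  | succ N ih =>
    have h1 := hasSum_shiftSeq hz ih
    have h2 := (hasSum_shiftSeq (c := fun n => clearPoles N c (n + 1)) hz h1).sub h1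
    rw [show (z * (z - 1)) ^ (N + 1) * s =
      z * (z * ((z * (z - 1)) ^ N * s)) - z * ((z * (z - 1)) ^ N * s) by ring]
    refine h2.of_forall_eq fun n => ?_
    rw [clearPoles, pow_succ', Module.End.mul_apply, clearPole_apply, sub_mul]
    rfl

theorem hasSum_clearPolesOne {c : ℤ → ℂ} {z s : ℂ} (hz : z ≠ 1)
    (h : HasSum (fun n : ℤ => c n * (z - 1) ^ (-n - 1)) s) (N : ℕ) :
    HasSum (fun n : ℤ => clearPolesOne N c n * (z - 1) ^ (-n - 1)) ((z * (z - 1)) ^ N * s) := by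
  induction N with
  | zero => simpa [clearPolesOne] using h
  | succ N ih =>
    have h1 := hasSum_shiftSeq (sub_ne_zero.2 hz) ih
    have h2 := (hasSum_shiftSeq (c := fun n => clearPolesOne N c (n + 1))
      (sub_ne_zero.2 hz) h1).add h1
    rw [show (z * (z - 1)) ^ (N + 1) * s = (z - 1) * ((z - 1) * ((z * (z - 1)) ^ N * s)) +
      (z - 1) * ((z * (z - 1)) ^ N * s) by ring]
    refine h2.of_forall_eq fun n => ?_
    rw [clearPolesOne, pow_succ', Module.End.mul_apply, clearPoleOne_apply, add_mul]
    rfl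

theorem hasSum_negSucc {c : ℤ → ℂ} {z s : ℂ} (hc : ∀ n ≥ 0, c n = 0)
    (h : HasSum (fun n : ℤ => c n * z ^ (-n - 1)) s) :
    HasSum (fun k : ℕ => c (Int.negSucc k) * z ^ k) s := by
  have hinj : Function.Injective Int.negSucc := fun a b hab => by simpa using hab
  rw [← hinj.hasSum_iff] at h
  · refine h.of_forall_eq fun k => ?_
    simp only [Function.comp_apply]
    rw [Int.negSucc_eq, show -(-((k : ℤ) + 1)) - 1 = k by ring, zpow_natCast]
  · intro n hn
    rw [hc, zero_mul]
    by_contra hneg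
    obtain ⟨m, rfl⟩ := Int.eq_negSucc_of_lt_zero (not_le.1 hneg)
    exact hn ⟨m, rfl⟩

/-- Subtracting the polynomial part leaves a series in `z⁻¹` without constant term; the factor `z`
makes it a power series in `z⁻¹` starting at exponent zero. -/
theorem hasSum_at_infty {c : ℤ → ℂ} {z s : ℂ} {D : ℕ} (hz : z ≠ 0)
    (hc : ∀ n < -(D : ℤ), c n = 0)
    (h : HasSum (fun n : ℤ => c n * z ^ (-n - 1)) s) :
    HasSum (fun n : ℕ => c n * z⁻¹ ^ n)
      (z * (s - ∑ k ∈ Finset.range D, c (Int.negSucc k) * z ^ k)) := by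
  have hinj : Function.Injective Int.negSucc := fun a b hab => by simpa using hab
  have h1 : HasSum (fun n : ℤ => (if n < 0 then c n else 0) * z ^ (-n - 1))
      (∑ k ∈ Finset.range D, c (Int.negSucc k) * z ^ k) := by
    rw [← hinj.hasSum_iff]
    · have : HasSum (fun k : ℕ => c (Int.negSucc k) * z ^ k) _ :=
        hasSum_sum_of_ne_finset_zero (s := Finset.range D) fun k hk => by
          rw [hc, zero_mul]
          rw [Finset.mem_range] at hk
          omega
      refine this.of_forall_eq fun k => ?_
      simp only [Function.comp_apply, Int.negSucc_lt_zero, if_true]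
      rw [Int.negSucc_eq, show -(-((k : ℤ) + 1)) - 1 = k by ring, zpow_natCast]
    · intro n hn
      rw [if_neg, zero_mul]
      intro hneg
      obtain ⟨m, rfl⟩ := Int.eq_negSucc_of_lt_zero hneg
      exact hn ⟨m, rfl⟩
  have h2 := (h.sub h1).mul_left z
  rw [← Nat.cast_injective (R := ℤ) |>.hasSum_iff] at h2
  · refine h2.of_forall_eq fun n => ?_
    simp only [Function.comp_apply]
    rw [if_neg (by omega), zero_mul, sub_zero, show -(n : ℤ) - 1 = -(n : ℤ) + (-1) by ring,
      zpow_add₀ hz, zpow_neg, zpow_natCast, zpow_neg_one, inv_pow]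
    field_simp
  · intro n hn
    rw [if_pos, sub_self, mul_zero]
    by_contra hneg
    exact hn ⟨n.toNat, by simp; omega⟩

/-- The expansions at `∞`, `0` and `1` of a function on `ℂ ∖ {0, 1}` with at most poles there. -/
theorem isRationalTriple_of_hasSum {N : ℕ} {c d e : ℤ → ℂ} {f : ℂ → ℂ}
    (hf : ContDiffOn ℝ 1 f {z | z ≠ 0 ∧ z ≠ 1})
    (hc : ∀ n < -(N : ℤ), c n = 0) (hd : ∀ n ≥ (N : ℤ), d n = 0) (he : ∀ n ≥ (N : ℤ), e n = 0)
    (h₁ : ∀ z : ℂ, 1 < ‖z‖ → HasSum (fun n : ℤ => c n * z ^ (-n - 1)) (f z))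
    (h₂ : ∀ z : ℂ, z ≠ 0 → ‖z‖ < 1 → HasSum (fun n : ℤ => d n * z ^ (-n - 1)) (f z))
    (h₃ : ∀ z : ℂ, z ≠ 1 → ‖z - 1‖ < 1 → HasSum (fun n : ℤ => e n * (z - 1) ^ (-n - 1)) (f z)) :
    IsRationalTriple N c d e := by
  set c' := clearPoles N c with hc'
  set d' := clearPoles N d with hd'
  set e' := clearPolesOne N e with he'
  have tc : ∀ n < -((3 * N : ℕ) : ℤ), c' n = 0 := fun n hn =>
    clearPoles_left_trunc hc N n (by push_cast at hn; omega)
  have td : ∀ n ≥ 0, d' n = 0 := fun n hn => clearPoles_right_trunc hd N n (by omega)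
  have te : ∀ n ≥ 0, e' n = 0 := fun n hn => clearPolesOne_right_trunc he N n (by omega)
  set g : ℂ → ℂ := fun z => (z * (z - 1)) ^ N * f z with hg
  -- The polynomial part of `g` at `∞`, which turns out to be all of `g`.
  set Q : ℂ → ℂ := fun z => ∑ k ∈ Finset.range (3 * N), c' (Int.negSucc k) * z ^ k with hQ
  have hQd : Differentiable ℂ Q := by
    rw [hQ]
    fun_prop
  have g₁ : ∀ z : ℂ, 1 < ‖z‖ → HasSum (fun n : ℕ => c' n * z⁻¹ ^ n) (z * (g z - Q z)) :=
    fun z hz => by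
      have hz0 : z ≠ 0 := by rintro rfl; simp at hz; linarith
      exact hasSum_at_infty hz0 tc (hasSum_clearPoles hz0 (h₁ z hz) N)
  have g₂ : ∀ z : ℂ, z ≠ 0 → ‖z‖ < 1 → HasSum (fun k : ℕ => d' (Int.negSucc k) * z ^ k) (g z) :=
    fun z hz hz1 => hasSum_negSucc td (hasSum_clearPoles hz (h₂ z hz hz1) N)
  have g₃ : ∀ z : ℂ, z ≠ 1 → ‖z - 1‖ < 1 →
      HasSum (fun k : ℕ => e' (Int.negSucc k) * (z - 1) ^ k) (g z) :=
    fun z hz hz1 => hasSum_negSucc te (hasSum_clearPolesOne hz (h₃ z hz hz1) N)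
  have s₁ : ∀ w : ℂ, w ≠ 0 → ‖w‖ < 1 → HasSum (fun n : ℕ => c' n * w ^ n)
      (w⁻¹ * (g w⁻¹ - Q w⁻¹)) := fun w hw hw1 => by
    have := g₁ w⁻¹ (by rw [norm_inv]; exact (one_lt_inv₀ (norm_pos_iff.2 hw)).2 hw1)
    rwa [inv_inv] at this
  have s₃ : ∀ w : ℂ, w ≠ 0 → ‖w‖ < 1 → HasSum (fun k : ℕ => e' (Int.negSucc k) * w ^ k)
      (g (w + 1)) := fun w hw hw1 => by
    have := g₃ (w + 1) (by simpa using hw) (by simpa using hw1)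
    rwa [add_sub_cancel_right] at this
  have dc := fun {w : ℂ} (hw : ‖w‖ < 1) =>
    differentiableAt_powSum (fun w hw hw1 => (s₁ w hw hw1).summable) hw
  have dd := fun {w : ℂ} (hw : ‖w‖ < 1) =>
    differentiableAt_powSum (fun w hw hw1 => (g₂ w hw hw1).summable) hw
  have de := fun {w : ℂ} (hw : ‖w‖ < 1) =>
    differentiableAt_powSum (fun w hw hw1 => (s₃ w hw hw1).summable) hw
  have hUo : IsOpen {z : ℂ | z ≠ 0 ∧ z ≠ 1} := isOpen_ne.inter isOpen_ne
  have hgU : ContDiffOn ℝ 1 g {z | z ≠ 0 ∧ z ≠ 1} := by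
    refine ContDiffOn.mul ?_ hf
    exact ContDiff.contDiffOn (by fun_prop)
  have hgout : ∀ z : ℂ, 1 < ‖z‖ →
      g z = Q z + z⁻¹ * powSum (fun n : ℕ => c' n) z⁻¹ := fun z hz => by
    have hz0 : z ≠ 0 := by rintro rfl; simp at hz; linarith
    rw [powSum, (g₁ z hz).tsum_eq]
    field_simp
    ring
  -- The expansions at `0` and `∞` give holomorphy off the unit circle; the `C¹` hypothesis carries
  -- it across the circle.
  have hdiff : ∀ z : ℂ, z ≠ 0 → z ≠ 1 → DifferentiableAt ℂ g z := by
    intro z hz0 hz1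
    refine differentiableAt_of_dense hUo hgU (S := (Metric.sphere (0 : ℂ) 1)ᶜ)
      (interior_eq_empty_iff_dense_compl.1 (interior_sphere _ one_ne_zero)) ?_ ⟨hz0, hz1⟩
    rintro w ⟨⟨hw0, hw1⟩, hw⟩
    rw [Set.mem_compl_iff, mem_sphere_zero_iff_norm] at hw
    rcases lt_or_gt_of_ne hw with hlt | hgt
    · refine (dd hlt).congr_of_eventuallyEq ?_
      filter_upwards [isOpen_ne.mem_nhds hw0, (isOpen_lt continuous_norm continuous_const).mem_nhds hlt]
        with v hv0 hv1
      exact (g₂ v hv0 hv1).tsum_eq.symm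
    · have : DifferentiableAt ℂ (fun z => Q z + z⁻¹ * powSum (fun n : ℕ => c' n) z⁻¹) w := by
        refine (hQd w).add ((differentiableAt_inv hw0).mul
          (DifferentiableAt.comp w (dc ?_) (differentiableAt_inv hw0)))
        rw [norm_inv]
        exact inv_lt_one_of_one_lt₀ hgt
      refine this.congr_of_eventuallyEq ?_
      filter_upwards [(isOpen_lt continuous_const continuous_norm).mem_nhds hgt] with v hv
      exact hgout v hv
  -- The cleared expansions at `0` and `1` are power series, so these points are removable
  -- singularities and `G` is entire.
  set G : ℂ → ℂ := fun z => if z = 0 then powSum (fun k => d' (Int.negSucc k)) 0 else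
    if z = 1 then powSum (fun k => e' (Int.negSucc k)) 0 else g z with hG
  have Gg : ∀ z : ℂ, z ≠ 0 → z ≠ 1 → G z = g z := fun z h0 h1 => by simp [hG, h0, h1]
  have hGd : Differentiable ℂ G := by
    intro z
    rcases eq_or_ne z 0 with rfl | h0
    · refine (dd (w := 0) (by simp)).congr_of_eventuallyEq ?_
      filter_upwards [Metric.ball_mem_nhds (0 : ℂ) one_pos] with v hv
      rw [mem_ball_zero_iff] at hv
      rcases eq_or_ne v 0 with rfl | hv0
      · simp [hG]
      · rw [Gg v hv0 (by rintro rfl; simp at hv)]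
        exact (g₂ v hv0 hv).tsum_eq.symm
    rcases eq_or_ne z 1 with rfl | h1
    · have : DifferentiableAt ℂ (fun z => powSum (fun k => e' (Int.negSucc k)) (z - 1)) 1 :=
        DifferentiableAt.comp (1 : ℂ) (de (by simp)) (by fun_prop)
      refine this.congr_of_eventuallyEq ?_
      filter_upwards [Metric.ball_mem_nhds (1 : ℂ) one_pos] with v hv
      rw [mem_ball_iff_norm] at hv
      rcases eq_or_ne v 1 with rfl | hv1
      · simp [hG]
      · rw [Gg v (by rintro rfl; simp at hv) hv1]
        exact (g₃ v hv1 hv).tsum_eq.symm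
    · refine (hdiff z h0 h1).congr_of_eventuallyEq ?_
      filter_upwards [isOpen_ne.mem_nhds h0, isOpen_ne.mem_nhds h1] with v hv0 hv1
      exact Gg v hv0 hv1
  have hlim : Tendsto (fun z => G z - Q z) (cocompact ℂ) (𝓝 0) := by
    have hinv : Tendsto (fun z : ℂ => z⁻¹) (cocompact ℂ) (𝓝 0) :=
      tendsto_inv₀_cobounded.mono_left (by rw [Metric.cobounded_eq_cocompact])
    have hcont := (dc (w := 0) (by simp)).continuousAt.tendsto
    have h := hinv.mul (hcont.comp hinv)
    rw [zero_mul] at h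
    refine h.congr' ?_
    have : ∀ᶠ z : ℂ in cocompact ℂ, 1 < ‖z‖ :=
      (tendsto_norm_cocompact_atTop (E := ℂ)).eventually_gt_atTop 1
    filter_upwards [this] with z hz
    rw [Gg z (by rintro rfl; simp at hz; linarith) (by rintro rfl; simp at hz), hgout z hz]
    simp
  -- Liouville: the entire function `G - Q` tends to zero at infinity.
  have hGQ : ∀ z, G z = Q z := fun z =>
    sub_eq_zero.1 ((hGd.sub hQd).apply_eq_of_tendsto_cocompact z hlim)
  have hgQ : ∀ z : ℂ, z ≠ 0 → z ≠ 1 → g z = Q z := fun z h0 h1 => by rw [← Gg z h0 h1, hGQ]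
  have cz : (fun n : ℕ => c' n) = 0 := eq_zero_of_hasSum_zero fun w hw hw1 => by
    have h := s₁ w hw hw1
    rwa [hgQ w⁻¹ (inv_ne_zero hw) (by rw [ne_eq, inv_eq_one]; rintro rfl; simp at hw1), sub_self,
      mul_zero] at h
  have hcQ : ∀ z : ℂ, HasSum (fun k : ℕ => c' (Int.negSucc k) * z ^ k) (Q z) := fun z =>
    hasSum_sum_of_ne_finset_zero fun k hk => by
      rw [tc, zero_mul]
      rw [Finset.mem_range] at hk
      omega
  have cd : (fun k : ℕ => c' (Int.negSucc k)) = fun k : ℕ => d' (Int.negSucc k) :=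
    coeff_unique (F := g) (fun z h0 h1 => by
      rw [hgQ z h0 (by rintro rfl; simp at h1)]
      exact hcQ z) g₂
  refine ⟨hc, hd, he, ?_, ?_⟩
  · ext n
    rcases n with n | n
    · rw [← hc', ← hd', td _ (by simp)]
      exact congrFun cz n
    · exact congrFun cd n
  · have key : (fun m : ℕ => e' (Int.negSucc m)) = fun m : ℕ => ∑ k ∈ Finset.range (3 * N),
        ((k.choose m : ℕ) : ℂ) • c' (Int.negSucc k) := by
      refine coeff_unique s₃ fun w hw hw1 => ?_
      rw [hgQ (w + 1) (fun h => by
        rw [eq_neg_of_add_eq_zero_left h] at hw1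
        simp at hw1) (by simpa using hw)]
      simp only [Finset.sum_mul, hQ]
      refine hasSum_sum fun k _ => ?_
      have : HasSum (fun m : ℕ => (((k.choose m : ℕ) : ℂ) • c' (Int.negSucc k)) * w ^ m) _ :=
        hasSum_sum_of_ne_finset_zero (s := Finset.range (k + 1)) fun m hm => by
          rw [Finset.mem_range] at hm
          rw [Nat.choose_eq_zero_of_lt (by omega)]
          simp
      convert this using 1
      rw [add_pow, Finset.mul_sum]
      refine Finset.sum_congr rfl fun m _ => ?_
      rw [one_pow, smul_eq_mul]
      ring
    exact fun m => congrFun key m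

end Expansions

/-! ### Gradings, their projections and eigenvalues -/

section GradedLemmas

variable {ι F : Type*} [DecidableEq ι] [AddCommGroup F] [Module ℂ F]
  {G : ι → Submodule ℂ F} (hG : DirectSum.IsInternal G)

theorem gradedEquiv_lof (i : ι) (x : G i) :
    gradedEquiv G hG (DirectSum.lof ℂ ι (fun i => G i) i x) = x :=
  DirectSum.coeLinearMap_lof G i x

theorem gradedEquiv_symm_of_mem {i : ι} {x : F} (hx : x ∈ G i) :
    (gradedEquiv G hG).symm x = DirectSum.lof ℂ ι (fun i => G i) i ⟨x, hx⟩ := by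
  rw [LinearEquiv.symm_apply_eq, gradedEquiv_lof]

theorem gradedProj_mem (i : ι) (x : F) : gradedProj G hG i x ∈ G i := Subtype.prop _

theorem gradedProj_of_mem {i : ι} {x : F} (hx : x ∈ G i) : gradedProj G hG i x = x := by
  simp only [gradedProj, LinearMap.comp_apply, LinearEquiv.coe_coe, gradedEquiv_symm_of_mem hG hx,
    DirectSum.component.lof_self]
  rfl

theorem gradedProj_of_mem_ne {i j : ι} {x : F} (hx : x ∈ G j) (hij : i ≠ j) :
    gradedProj G hG i x = 0 := by
  simp only [gradedProj, LinearMap.comp_apply, LinearEquiv.coe_coe, gradedEquiv_symm_of_mem hG hx]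
  rw [DirectSum.component.of, dif_neg hij.symm]
  rfl

theorem gradedProj_finite (x : F) : (Function.support fun i => gradedProj G hG i x).Finite := by
  classical
  refine (DFinsupp.support (β := fun i => G i)
    ((gradedEquiv G hG).symm x)).finite_toSet.subset fun i hi => ?_
  rw [Finset.mem_coe, DFinsupp.mem_support_iff]
  intro h
  apply hi
  simp only [gradedProj, LinearMap.comp_apply, LinearEquiv.coe_coe]
  exact congrArg (G i).subtype h

theorem finsum_gradedProj (x : F) : ∑ᶠ i, gradedProj G hG i x = x := by
  classical
  obtain ⟨y, rfl⟩ := (gradedEquiv G hG).surjective x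
  induction y using DirectSum.induction_on with
  | zero => simp
  | of i x =>
    have h : gradedEquiv G hG (DirectSum.of (fun i => G i) i x) = x := gradedEquiv_lof hG i x
    rw [h, finsum_eq_single _ i fun j hj => gradedProj_of_mem_ne hG x.2 hj,
      gradedProj_of_mem hG x.2]
  | add x y hx hy =>
    simp only [map_add]
    rw [finsum_add_distrib (gradedProj_finite hG _) (gradedProj_finite hG _), hx, hy]

theorem gradedProj_ext {x y : F} (h : ∀ i, gradedProj G hG i x = gradedProj G hG i y) : x = y := by
  rw [← finsum_gradedProj hG x, ← finsum_gradedProj hG y]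
  exact finsum_congr h

theorem diagOp_of_mem (c : ι → ℂ) {i : ι} {x : F} (hx : x ∈ G i) :
    diagOp G hG c x = c i • x := by
  simp only [diagOp, LinearMap.comp_apply, LinearEquiv.coe_coe, gradedEquiv_symm_of_mem hG hx,
    DirectSum.toModule_lof]
  rfl

/-- Induction on homogeneous vectors. -/
theorem graded_induction (hG : DirectSum.IsInternal G) {p : F → Prop} (h : ∀ i, ∀ x ∈ G i, p x)
    (hadd : ∀ x y, p x → p y → p (x + y)) (h0 : p 0) (x : F) : p x := by
  rw [← finsum_gradedProj hG x]
  exact finsum_induction p h0 hadd fun i => h i _ (gradedProj_mem hG i x)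

theorem gradedProj_diagOp (c : ι → ℂ) (i : ι) (x : F) :
    gradedProj G hG i (diagOp G hG c x) = c i • gradedProj G hG i x := by
  induction x using graded_induction hG with
  | h j x hx =>
    rw [diagOp_of_mem hG c hx, map_smul]
    rcases eq_or_ne i j with rfl | hij
    · rfl
    · rw [gradedProj_of_mem_ne hG hx hij, smul_zero, smul_zero]
  | hadd x y hx hy => simp only [map_add, hx, hy, smul_add]
  | h0 => simp

theorem mem_of_gradedProj {i : ι} {x : F}
    (hx : ∀ j, gradedProj G hG j x ≠ 0 → j = i) : x ∈ G i := by
  rw [← finsum_gradedProj hG x, finsum_eq_single _ i fun j hj => by_contra fun h => hj (hx j h)]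
  exact gradedProj_mem hG i x

end GradedLemmas

namespace BigradedFieldData

variable {F : Type*} [AddCommGroup F] [Module ℂ F] (X : BigradedFieldData F)

theorem P_mem (p : ℝ × ℝ) (x : F) : X.P p x ∈ X.bigr p := gradedProj_mem _ _ _

theorem P_of_mem {p : ℝ × ℝ} {x : F} (hx : x ∈ X.bigr p) : X.P p x = x := gradedProj_of_mem _ hx

theorem P_of_mem_ne {p q : ℝ × ℝ} {x : F} (hx : x ∈ X.bigr q) (hpq : p ≠ q) : X.P p x = 0 :=
  gradedProj_of_mem_ne _ hx hpq

theorem P_finite (x : F) : (Function.support fun p => X.P p x).Finite := gradedProj_finite _ x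

theorem finsum_P (x : F) : ∑ᶠ p, X.P p x = x := finsum_gradedProj _ x

theorem P_ext {x y : F} (h : ∀ p, X.P p x = X.P p y) : x = y := gradedProj_ext _ h

theorem bigr_induction {p : F → Prop} (h : ∀ i, ∀ x ∈ X.bigr i, p x)
    (hadd : ∀ x y, p x → p y → p (x + y)) (h0 : p 0) (x : F) : p x :=
  graded_induction X.bi_internal h hadd h0 x

theorem dL_of_mem {p : ℝ × ℝ} {x : F} (hx : x ∈ X.bigr p) : X.dL x = (p.1 : ℂ) • x :=
  diagOp_of_mem _ _ hx

theorem dR_of_mem {p : ℝ × ℝ} {x : F} (hx : x ∈ X.bigr p) : X.dR x = (p.2 : ℂ) • x :=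
  diagOp_of_mem _ _ hx

theorem mem_bigr_of_eigen {p : ℝ × ℝ} {x : F} (h₁ : X.dL x = (p.1 : ℂ) • x)
    (h₂ : X.dR x = (p.2 : ℂ) • x) : x ∈ X.bigr p := by
  refine mem_of_gradedProj X.bi_internal fun q hq => ?_
  have e1 : (q.1 : ℂ) • X.P q x = (p.1 : ℂ) • X.P q x := by
    rw [← map_smul (X.P q) (p.1 : ℂ) x, ← h₁]
    exact (gradedProj_diagOp X.bi_internal (fun p => (p.1 : ℂ)) q x).symm
  have e2 : (q.2 : ℂ) • X.P q x = (p.2 : ℂ) • X.P q x := by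
    rw [← map_smul (X.P q) (p.2 : ℂ) x, ← h₂]
    exact (gradedProj_diagOp X.bi_internal (fun p => (p.2 : ℂ)) q x).symm
  have hq' : X.P q x ≠ 0 := hq
  exact Prod.ext (by exact_mod_cast smul_left_injective ℂ hq' e1)
    (by exact_mod_cast smul_left_injective ℂ hq' e2)

/-- Both gradings are eigenspace decompositions, and `compat` says that the total weight is the sum
of the two eigenvalues. -/
theorem bigr_le_gr (p : ℝ × ℝ) : X.bigr p ≤ X.gr (p.1 + p.2) := by
  intro x hx
  refine mem_of_gradedProj X.internal fun r hr => ?_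
  have e : (r : ℂ) • gradedProj X.gr X.internal r x =
      ((p.1 : ℂ) + p.2) • gradedProj X.gr X.internal r x := by
    rw [← gradedProj_diagOp X.internal (fun r => (r : ℂ)) r x, X.compat, LinearMap.add_apply,
      diagOp_of_mem _ _ hx, diagOp_of_mem _ _ hx, ← add_smul, map_smul]
  exact_mod_cast smul_left_injective ℂ hr e

theorem P_of_mem_gr_ne {p : ℝ × ℝ} {r : ℝ} {x : F} (hx : x ∈ X.gr r) (hp : p.1 + p.2 ≠ r) :
    X.P p x = 0 := by
  by_contra h
  have e : ((p.1 : ℂ) + p.2) • X.P p x = (r : ℂ) • X.P p x := by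
    rw [← map_smul (X.P p) (r : ℂ) x, ← diagOp_of_mem X.internal (fun r => (r : ℂ)) hx, X.compat,
      LinearMap.add_apply, map_add, add_smul]
    exact congrArg₂ _ (gradedProj_diagOp X.bi_internal (fun p => (p.1 : ℂ)) p x).symm
      (gradedProj_diagOp X.bi_internal (fun p => (p.2 : ℂ)) p x).symm
  apply hp
  exact_mod_cast smul_left_injective ℂ h e

theorem mem_gr_of_P {r : ℝ} {x : F} (h : ∀ p, X.P p x ≠ 0 → p.1 + p.2 = r) : x ∈ X.gr r := by
  rw [← X.finsum_P x]
  refine finsum_induction (· ∈ X.gr r) (Submodule.zero_mem _) (fun _ _ => Submodule.add_mem _)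
    fun p => ?_
  by_cases hp : X.P p x = 0
  · rw [hp]; exact Submodule.zero_mem _
  · rw [← h p hp]
    exact X.bigr_le_gr p (X.P_mem p x)

theorem pair_mem_configSpace {z w : ℂ} (h : z ≠ w) : (![z, w] : Fin 2 → ℂ) ∈ configSpace 2 := by
  intro i j hij
  fin_cases i <;> fin_cases j <;> simp_all [eq_comm]

theorem vertexOp_add_left {z : ℂ} (hz : z ≠ 0) (u u' v : F) :
    X.vertexOp (u + u') z v = X.vertexOp u z v + X.vertexOp u' z v := by
  have h := X.map_update_add 2 (by norm_num) _ (pair_mem_configSpace hz) ![u, v] 0 u u'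
  have e : ∀ a, Function.update ![u, v] 0 a = ![a, v] := fun a => by
    ext i; fin_cases i <;> rfl
  simp only [e] at h
  exact h

theorem vertexOp_add_right {z : ℂ} (hz : z ≠ 0) (u v v' : F) :
    X.vertexOp u z (v + v') = X.vertexOp u z v + X.vertexOp u z v' := by
  have h := X.map_update_add 2 (by norm_num) _ (pair_mem_configSpace hz) ![u, v] 1 v v'
  have e : ∀ a, Function.update ![u, v] 1 a = ![u, a] := fun a => by
    ext i; fin_cases i <;> rfl
  simp only [e] at h
  exact h

theorem vertexOp_smul_left {z : ℂ} (hz : z ≠ 0) (c : ℂ) (u v : F) :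
    X.vertexOp (c • u) z v = c • X.vertexOp u z v := by
  have h := X.map_update_smul 2 (by norm_num) _ (pair_mem_configSpace hz) ![u, v] 0 c u
  have e : ∀ a, Function.update ![u, v] 0 a = ![a, v] := fun a => by
    ext i; fin_cases i <;> rfl
  simp only [e] at h
  exact h

theorem vertexOp_smul_right {z : ℂ} (hz : z ≠ 0) (c : ℂ) (u v : F) :
    X.vertexOp u z (c • v) = c • X.vertexOp u z v := by
  have h := X.map_update_smul 2 (by norm_num) _ (pair_mem_configSpace hz) ![u, v] 1 c v
  have e : ∀ a, Function.update ![u, v] 1 a = ![u, a] := fun a => by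
    ext i; fin_cases i <;> rfl
  simp only [e] at h
  exact h

/-- `P_s 𝕐(u; z, z̄) v` as a bilinear map. -/
def compVertexOp (s : ℝ × ℝ) {z : ℂ} (hz : z ≠ 0) : F →ₗ[ℂ] F →ₗ[ℂ] F :=
  LinearMap.mk₂ ℂ (fun u v => X.comp s (X.vertexOp u z v))
    (fun u u' v => by simp [comp, X.vertexOp_add_left hz])
    (fun c u v => by simp [comp, X.vertexOp_smul_left hz])
    (fun u v v' => by simp [comp, X.vertexOp_add_right hz])
    (fun c u v => by simp [comp, X.vertexOp_smul_right hz])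

theorem compVertexOp_apply (s : ℝ × ℝ) {z : ℂ} (hz : z ≠ 0) (u v : F) :
    X.compVertexOp s hz u v = X.comp s (X.vertexOp u z v) := rfl

/-- `P_s 𝕐(u; 1, 1) v` as a bilinear map. -/
def atOne (s : ℝ × ℝ) : F →ₗ[ℂ] F →ₗ[ℂ] F := X.compVertexOp s one_ne_zero

theorem atOne_apply (s : ℝ × ℝ) (u v : F) : X.atOne s u v = X.comp s (X.vertexOp u 1 v) := rfl

theorem atOne_mem (s : ℝ × ℝ) (u v : F) : X.atOne s u v ∈ X.bigr s := X.P_mem _ _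

theorem mode_eq_finsum (l r : ℝ) (u v : F) :
    X.mode l r u v = ∑ᶠ ab : (ℝ × ℝ) × (ℝ × ℝ),
      X.atOne (ab.1 + ab.2 - (l + 1, r + 1)) (X.P ab.1 u) (X.P ab.2 v) := rfl

theorem mode_finite (l r : ℝ) (u v : F) : (Function.support fun ab : (ℝ × ℝ) × (ℝ × ℝ) =>
    X.atOne (ab.1 + ab.2 - (l + 1, r + 1)) (X.P ab.1 u) (X.P ab.2 v)).Finite := by
  refine ((X.P_finite u).prod (X.P_finite v)).subset fun ab hab => ?_
  rw [Function.mem_support] at hab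
  refine ⟨fun h => hab ?_, fun h => hab ?_⟩
  · simp only at h; rw [h]; simp
  · simp only at h; rw [h]; simp

/-- `𝕐_{l,r}(u) v` as a bilinear map. -/
def bimode (l r : ℝ) : F →ₗ[ℂ] F →ₗ[ℂ] F :=
  LinearMap.mk₂ ℂ (X.mode l r)
    (fun u u' v => by
      simp only [mode_eq_finsum]
      rw [← finsum_add_distrib (X.mode_finite l r u v) (X.mode_finite l r u' v)]
      simp)
    (fun c u v => by
      simp only [mode_eq_finsum]
      rw [smul_finsum' c (X.mode_finite l r u v)]
      simp)
    (fun u v v' => by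
      simp only [mode_eq_finsum]
      rw [← finsum_add_distrib (X.mode_finite l r u v) (X.mode_finite l r u v')]
      simp)
    (fun c u v => by
      simp only [mode_eq_finsum]
      rw [smul_finsum' c (X.mode_finite l r u v)]
      simp)

theorem bimode_apply (l r : ℝ) (u v : F) : X.bimode l r u v = X.mode l r u v := rfl

theorem mode_of_mem {a b : ℝ × ℝ} {u v : F} (hu : u ∈ X.bigr a) (hv : v ∈ X.bigr b) (l r : ℝ) :
    X.mode l r u v = X.atOne (a + b - (l + 1, r + 1)) u v := by
  rw [mode_eq_finsum, finsum_eq_single _ (a, b), X.P_of_mem hu, X.P_of_mem hv]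
  rintro ⟨a', b'⟩ h
  rcases eq_or_ne a' a with rfl | ha
  · rw [X.P_of_mem_ne hv (p := b') (fun hb => h (by rw [hb])), map_zero]
  · rw [X.P_of_mem_ne hu ha]; simp

theorem bimode_of_mem {a b : ℝ × ℝ} {u v : F} (hu : u ∈ X.bigr a) (hv : v ∈ X.bigr b) (l r : ℝ) :
    X.bimode l r u v = X.atOne (a + b - (l + 1, r + 1)) u v := X.mode_of_mem hu hv l r

theorem atOne_eq_bimode {a b : ℝ × ℝ} {u v : F} (hu : u ∈ X.bigr a) (hv : v ∈ X.bigr b)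
    (s : ℝ × ℝ) : X.atOne s u v = X.bimode (a.1 + b.1 - s.1 - 1) (a.2 + b.2 - s.2 - 1) u v := by
  rw [X.bimode_of_mem hu hv, show a + b - (a.1 + b.1 - s.1 - 1 + 1, a.2 + b.2 - s.2 - 1 + 1) = s by
    ext <;> simp]

end BigradedFieldData

/-! ### The shape of full vertex operators and finiteness of weights -/

namespace BigradedFullFieldAlgebra

variable {F : Type*} [AddCommGroup F] [Module ℂ F] (X : BigradedFullFieldAlgebra F)

/-- From `e^{2πi(m-n)} = 1`. This is the source of the integrality of all exponents in the fields of
`VL ⊗ VR`. -/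
theorem exists_int_of_mem {p : ℝ × ℝ} {x : F} (hx : x ∈ X.bigr p) (h0 : x ≠ 0) :
    ∃ n : ℤ, p.1 - p.2 = n := by
  have h := LinearMap.congr_fun X.single_valued x
  rw [diagOp_of_mem _ _ hx, LinearMap.id_apply] at h
  have h1 : Complex.exp (2 * Real.pi * Complex.I * ((p.1 : ℂ) - p.2)) = 1 := by
    apply smul_left_injective ℂ h0
    simpa using h
  obtain ⟨n, hn⟩ := Complex.exp_eq_one_iff.1 h1
  refine ⟨n, ?_⟩
  have hpi : (2 * Real.pi * Complex.I : ℂ) ≠ 0 := Complex.two_pi_I_ne_zero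
  have h2 : ((p.1 : ℂ) - p.2) = n := by
    apply mul_left_cancel₀ hpi
    rw [hn]; ring
  exact_mod_cast h2

theorem contDiffOn_compVertexOp (s : ℝ × ℝ) (u v : F) (φ : Module.Dual ℂ F) :
    ContDiffOn ℝ ∞ (fun z => φ (X.comp s (X.vertexOp u z v))) {z | z ≠ 0} := by
  have h := X.smooth 2 (by norm_num) ![u, v] (s.1 + s.2) (φ ∘ₗ X.P s)
  have hg : ContDiff ℝ ∞ (fun z : ℂ => (![z, 0] : Fin 2 → ℂ)) := by
    rw [contDiff_pi]
    intro i
    fin_cases i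
    · exact contDiff_id
    · exact contDiff_const
  exact h.comp hg.contDiffOn fun z hz => BigradedFieldData.pair_mem_configSpace hz

theorem fderiv_eq_wirtinger (f : ℂ → ℂ) (z w : ℂ) :
    fderiv ℝ f z w = wirtinger f z * w + wirtingerBar f z * conj w := by
  have h : fderiv ℝ f z w = w.re * fderiv ℝ f z 1 + w.im * fderiv ℝ f z Complex.I := by
    conv_lhs => rw [← Complex.re_add_im w]
    rw [map_add, show (w.re : ℂ) = w.re • (1 : ℂ) by simp,
      show (w.im : ℂ) * Complex.I = w.im • Complex.I by simp, map_smul, map_smul]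
    simp
  rw [h, wirtinger, wirtingerBar]
  have hc : conj w = w.re - w.im * Complex.I := by
    apply Complex.ext <;> simp
  rw [hc]
  linear_combination (-(fderiv ℝ f z 1 - Complex.I * fderiv ℝ f z Complex.I) / 2) *
    (Complex.re_add_im w).symm + ((w.im : ℂ) * fderiv ℝ f z Complex.I) * Complex.I_sq

/-- The shape of `P_s 𝕐(u; z, z̄) v` for homogeneous `u` and `v`. -/
theorem comp_vertexOp_exp {a b : ℝ × ℝ} {u v : F} (hu : u ∈ X.bigr a) (hv : v ∈ X.bigr b)
    (s : ℝ × ℝ) (ζ : ℂ) :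
    X.comp s (X.vertexOp u (Complex.exp ζ) v) =
      Complex.exp ((s.1 - a.1 - b.1 : ℝ) * ζ + (s.2 - a.2 - b.2 : ℝ) * conj ζ) •
        X.atOne s u v := by
  rw [← sub_eq_zero, ← Module.forall_dual_apply_eq_zero_iff ℂ]
  intro φ
  rw [map_sub, map_smul, sub_eq_zero]
  set f : ℂ → ℂ := fun z => φ (X.comp s (X.vertexOp u z v)) with hf
  have hw : ∀ z : ℂ, z ≠ 0 → z * wirtinger f z = (s.1 - a.1 - b.1 : ℝ) * f z := by
    intro z hz
    have h := X.dL_bracket u v z hz s φ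
    rw [X.dL_of_mem hu, X.dL_of_mem hv, X.vertexOp_smul_left hz, X.vertexOp_smul_right hz] at h
    simp only [BigradedFieldData.comp, Pi.smul_apply, Submodule.coe_smul, map_smul,
      smul_eq_mul] at h
    simp only [hf, BigradedFieldData.comp]
    push_cast
    linear_combination -h
  have hw' : ∀ z : ℂ, z ≠ 0 → conj z * wirtingerBar f z = (s.2 - a.2 - b.2 : ℝ) * f z := by
    intro z hz
    have h := X.dR_bracket u v z hz s φ
    rw [X.dR_of_mem hu, X.dR_of_mem hv, X.vertexOp_smul_left hz, X.vertexOp_smul_right hz] at h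
    simp only [BigradedFieldData.comp, Pi.smul_apply, Submodule.coe_smul, map_smul,
      smul_eq_mul] at h
    simp only [hf, BigradedFieldData.comp]
    push_cast
    linear_combination -h
  set x : ℝ := s.1 - a.1 - b.1
  set y : ℝ := s.2 - a.2 - b.2
  have hdiff : ∀ z : ℂ, z ≠ 0 → DifferentiableAt ℝ f z := fun z hz =>
    ((X.contDiffOn_compVertexOp s u v φ).differentiableOn (by simp)).differentiableAt
      (isOpen_ne.mem_nhds hz)
  -- Along `t ↦ e^{tζ}` the two brackets combine into a linear first-order equation for `f`; `k` is
  -- `f` divided by the expected solution, hence constant. Comparing `t = 1` with `t = 0` avoids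
  -- every choice of logarithm.
  set k : ℝ → ℂ := fun t =>
    f (Complex.exp (t * ζ)) * Complex.exp (-((x * ζ + y * conj ζ) * t)) with hk
  have hkd : ∀ t, HasDerivAt k 0 t := by
    intro t
    have e1 : HasDerivAt (fun t : ℝ => Complex.exp (t * ζ)) (Complex.exp (t * ζ) * ζ) t := by
      have := ((Complex.ofRealCLM.hasDerivAt (x := t)).mul_const ζ).cexp
      simpa using this
    have e2 : HasDerivAt (fun t : ℝ => Complex.exp (-((x * ζ + y * conj ζ) * t)))
        (Complex.exp (-((x * ζ + y * conj ζ) * t)) * (-(x * ζ + y * conj ζ))) t := by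
      have := ((Complex.ofRealCLM.hasDerivAt (x := t)).const_mul (x * ζ + y * conj ζ)).neg.cexp
      simpa using this
    have e3 := ((hdiff _ (Complex.exp_ne_zero (t * ζ))).hasFDerivAt.comp_hasDerivAt t e1).mul e2
    refine e3.congr_deriv ?_
    rw [fderiv_eq_wirtinger, map_mul]
    have h1 := hw _ (Complex.exp_ne_zero (t * ζ))
    have h2 := hw' _ (Complex.exp_ne_zero (t * ζ))
    simp only [Function.comp_apply]
    linear_combination (Complex.exp (-((x * ζ + y * conj ζ) * t))) * (ζ * h1 + conj ζ * h2)
  have hconst : k 1 = k 0 := is_const_of_deriv_eq_zero (fun t => (hkd t).differentiableAt)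
    (fun t => (hkd t).deriv) 1 0
  simp only [hk, Complex.ofReal_one, one_mul, mul_one, Complex.ofReal_zero, zero_mul,
    Complex.exp_zero, mul_zero, neg_zero] at hconst
  rw [show φ (X.atOne s u v) = f 1 from rfl, ← hconst, smul_eq_mul, mul_left_comm,
    ← Complex.exp_add, add_neg_cancel, Complex.exp_zero, mul_one]

theorem bigr_eq_bot {M : ℝ} (hM : ∀ m n : ℝ, (n < M ∨ m < M) → X.bigr (m, n) = ⊥) {p : ℝ × ℝ}
    (hp : p.1 < M ∨ p.2 < M) : X.bigr p = ⊥ := hM p.1 p.2 hp.symm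

/-- At fixed total weight `r` the difference of the weights is an integer, and the lower bound `M`
on both weights confines it to `[2M - r, r - 2M]`. -/
theorem finite_weights (hX : X.IsGradingRestricted) (r : ℝ) :
    {p : ℝ × ℝ | p.1 + p.2 = r ∧ X.bigr p ≠ ⊥}.Finite := by
  obtain ⟨M, hM⟩ := hX.lower_truncated
  refine ((Set.finite_Icc ⌊2 * M - r⌋ ⌈r - 2 * M⌉).image
    fun n : ℤ => ((r + n) / 2, (r - n) / 2)).subset ?_
  rintro p ⟨hp, hne⟩
  obtain ⟨x, hx, hx0⟩ := Submodule.exists_mem_ne_zero_of_ne_bot hne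
  obtain ⟨n, hn⟩ := X.exists_int_of_mem hx hx0
  have h1 : M ≤ p.1 := not_lt.1 fun h => hne (X.bigr_eq_bot hM (.inl h))
  have h2 : M ≤ p.2 := not_lt.1 fun h => hne (X.bigr_eq_bot hM (.inr h))
  refine ⟨n, ⟨?_, ?_⟩, ?_⟩
  · have : (⌊2 * M - r⌋ : ℝ) ≤ n := (Int.floor_le _).trans (by linarith)
    exact_mod_cast this
  · have : (n : ℝ) ≤ ⌈r - 2 * M⌉ := le_trans (by linarith) (Int.le_ceil _)
    exact_mod_cast this
  · ext <;> simp only <;> linarith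

theorem finiteDimensional_gr (hX : X.IsGradingRestricted) (r : ℝ) :
    FiniteDimensional ℂ (X.gr r) := by
  have := (X.finite_weights hX r).to_subtype
  have hfd : ∀ p : {p : ℝ × ℝ | p.1 + p.2 = r ∧ X.bigr p ≠ ⊥}, FiniteDimensional ℂ (X.bigr p) :=
    fun p => hX.finite_dim _ _
  have hle : X.gr r ≤ ⨆ p : {p : ℝ × ℝ | p.1 + p.2 = r ∧ X.bigr p ≠ ⊥}, X.bigr p := by
    intro x hx
    rw [← X.finsum_P x]
    refine finsum_induction (· ∈ ⨆ p : {p : ℝ × ℝ | p.1 + p.2 = r ∧ X.bigr p ≠ ⊥}, X.bigr p)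
      (Submodule.zero_mem _) (fun _ _ => Submodule.add_mem _) fun p => ?_
    by_cases hp : X.P p x = 0
    · rw [hp]; exact Submodule.zero_mem _
    · refine Submodule.mem_iSup_of_mem ⟨p, ?_, ?_⟩ (X.P_mem p x)
      · exact by_contra fun h => hp (X.P_of_mem_gr_ne hx h)
      · intro h
        have := X.P_mem p x
        rw [h] at this
        exact hp this
  exact Submodule.finiteDimensional_of_le hle

end BigradedFullFieldAlgebra

/-! ### Division by `z - w` and two-point rational functions -/

section DifferenceSeries

variable {M : Type*} [AddCommGroup M] [Module ℂ M]

/-- The difference operator `(D c) n = c (n + 1) - c n`. -/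
def diffSeq : Module.End ℂ (ℤ → M) := shiftSeq - 1

@[simp] theorem diffSeq_apply (c : ℤ → M) (n : ℤ) : diffSeq c n = c (n + 1) - c n := rfl

/-- Along a line `k + l = K` of exponents, the difference operator is multiplication by `z - w`; the
Jacobi product with `r = N` is multiplication by its `N`-th power. -/
theorem jacobiLeft_natCast {c : ℤ → M} (hc : ∃ B : ℤ, ∀ n < B, c n = 0) (N : ℕ) (p : ℤ) :
    jacobiLeft c p N = (diffSeq ^ N) c p := by
  induction N generalizing p with
  | zero =>
    rw [jacobiLeft, finsum_eq_single _ 0]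
    · simp
    · intro i hi
      rw [Nat.cast_zero, Ring.choose_zero_pos _ (by omega)]
      simp
  | succ N ih =>
    rw [Nat.cast_succ, jacobiLeft_succ hc, ih, ih, pow_succ']
    rfl

theorem diffSeq_pow_left_trunc {c : ℤ → M} {B : ℤ} (h : ∀ n < B, c n = 0) (N : ℕ) :
    ∀ n < B - N, (diffSeq ^ N) c n = 0 := by
  induction N with
  | zero => simpa using h
  | succ N ih =>
    intro n hn
    rw [pow_succ', Module.End.mul_apply, diffSeq_apply, ih _ (by push_cast at hn; omega),
      ih _ (by push_cast at hn; omega), sub_zero]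

theorem diffSeq_pow_first {c : ℤ → M} {B : ℤ} (h : ∀ n < B, c n = 0) (N : ℕ) :
    (diffSeq ^ N) c (B - N) = c B := by
  induction N with
  | zero => simp
  | succ N ih =>
    rw [pow_succ', Module.End.mul_apply, diffSeq_apply,
      show B - ((N + 1 : ℕ) : ℤ) + 1 = B - N by push_cast; ring, ih,
      diffSeq_pow_left_trunc h N _ (by push_cast; omega), sub_zero]

theorem map_diffSeq_pow {M' : Type*} [AddCommGroup M'] [Module ℂ M'] (φ : M →ₗ[ℂ] M') (c : ℤ → M)
    (N : ℕ) (n : ℤ) : φ ((diffSeq ^ N) c n) = (diffSeq ^ N) (fun k => φ (c k)) n := by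
  induction N generalizing n with
  | zero => rfl
  | succ N ih =>
    simp only [pow_succ', Module.End.mul_apply, diffSeq_apply, map_sub, ih]

/-- The `y n` are the partial sums of `diffSeq y`, so the series is a Cauchy product with the
geometric series. -/
theorem summable_of_diffSeq {y : ℤ → ℂ} {B : ℤ} (hy : ∀ n < B, y n = 0) {t : ℂ} (ht0 : t ≠ 0)
    (ht : ‖t‖ < 1) (h : Summable fun n : ℤ => diffSeq y n * t ^ n) :
    Summable fun n : ℤ => y n * t ^ n := by
  have hinj : Function.Injective fun m : ℕ => B + (m : ℤ) := fun a b hab => by simpa using hab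
  have hinj' : Function.Injective fun m : ℕ => B + (m : ℤ) - 1 := fun a b hab => by simpa using hab
  have h1 : Summable fun m : ℕ => diffSeq y (B + m - 1) * t ^ m := by
    have := (h.comp_injective hinj').mul_left (t ^ (1 - B))
    refine this.congr fun m => ?_
    simp only [Function.comp_apply]
    rw [mul_left_comm, ← zpow_add₀ ht0, show 1 - B + (B + m - 1) = m by ring, zpow_natCast]
  have h2 : Summable fun m : ℕ => ‖t ^ m‖ := by
    simpa using summable_geometric_of_lt_one (norm_nonneg t) ht
  have h3 := (summable_norm_sum_mul_antidiagonal_of_summable_norm h1.norm h2).of_norm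
  have h4 : ∀ m : ℕ, ∑ kl ∈ Finset.HasAntidiagonal.antidiagonal m,
      diffSeq y (B + kl.1 - 1) * t ^ kl.1 * t ^ kl.2 = y (B + m) * t ^ m := by
    intro m
    have : ∀ m : ℕ, ∑ k ∈ Finset.range m.succ, diffSeq y (B + k - 1) = y (B + m) := by
      intro m
      induction m with
      | zero => simp [hy (B - 1) (by omega)]
      | succ m ih =>
        rw [Finset.sum_range_succ, ih, diffSeq_apply]
        rw [show B + ((m + 1 : ℕ) : ℤ) - 1 = B + m by push_cast; ring]
        push_cast
        rw [← add_assoc]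
        ring
    rw [← this, ← Finset.Nat.sum_antidiagonal_eq_sum_range_succ_mk (f := fun kl : ℕ × ℕ =>
      diffSeq y (B + kl.1 - 1)), Finset.sum_mul]
    refine Finset.sum_congr rfl fun kl hkl => ?_
    rw [Finset.HasAntidiagonal.mem_antidiagonal] at hkl
    rw [mul_assoc, ← pow_add, hkl]
  simp only [h4] at h3
  rw [← hinj.summable_iff]
  · refine (h3.mul_left (t ^ B)).congr fun m => ?_
    simp only [Function.comp_apply]
    rw [zpow_add₀ ht0, zpow_natCast]
    ring
  · intro n hn
    rw [hy, zero_mul]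
    by_contra hlt
    exact hn ⟨(n - B).toNat, by simp only; omega⟩

/-- Once the series is known to converge to some `s`, multiplication by `z - w` gives `(z - w) s =
S`. -/
theorem hasSum_of_diffSeq {y : ℤ → ℂ} {B K : ℤ} (hy : ∀ n < B, y n = 0) {z w S : ℂ} (hw : w ≠ 0)
    (hzw : ‖w‖ < ‖z‖)
    (h : HasSum (fun n : ℤ => diffSeq y n * (z ^ (-n - 1) * w ^ (-(K - 1 - n) - 1))) S) :
    HasSum (fun n : ℤ => y n * (z ^ (-n - 1) * w ^ (-(K - n) - 1))) (S / (z - w)) := by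
  have hz : z ≠ 0 := norm_pos_iff.1 ((norm_nonneg w).trans_lt hzw)
  have hzw' : z - w ≠ 0 := sub_ne_zero.2 fun h => by simp [h] at hzw
  have hmon : ∀ n K : ℤ, z ^ (-n - 1) * w ^ (-(K - n) - 1) =
      z ^ (-1 : ℤ) * w ^ (-K - 1) * (w / z) ^ n := by
    intro n K
    rw [div_zpow, show -n - 1 = -1 - n by ring, show -(K - n) - 1 = -K - 1 + n by ring,
      zpow_sub₀ hz, zpow_add₀ hw]
    ring
  have hs : Summable fun n : ℤ => y n * (z ^ (-n - 1) * w ^ (-(K - n) - 1)) := by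
    have hc : z ^ (-1 : ℤ) * w ^ (-(K - 1) - 1) ≠ 0 :=
      mul_ne_zero (zpow_ne_zero _ hz) (zpow_ne_zero _ hw)
    have h1 : Summable fun n : ℤ => diffSeq y n * (w / z) ^ n := by
      refine (h.summable.mul_left (z ^ (-1 : ℤ) * w ^ (-(K - 1) - 1))⁻¹).congr fun n => ?_
      rw [hmon]
      field_simp
    have h2 := summable_of_diffSeq hy (div_ne_zero hw hz)
      (by rw [norm_div]; exact (div_lt_one (norm_pos_iff.2 hz)).2 hzw) h1
    refine (h2.mul_left (z ^ (-1 : ℤ) * w ^ (-K - 1))).congr fun n => ?_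
    rw [hmon]
    ring
  obtain ⟨s, hs⟩ := hs
  have e1 : HasSum (fun n : ℤ => y (n + 1) * (z ^ (-n - 1) * w ^ (-(K - 1 - n) - 1))) (z * s) := by
    refine (((Equiv.addRight (1 : ℤ)).hasSum_iff.2 hs).mul_left z).of_forall_eq fun n => ?_
    simp only [Function.comp_apply, Equiv.coe_addRight]
    rw [show -n - 1 = -(n + 1) - 1 + 1 by ring, zpow_add_one₀ hz,
      show -(K - 1 - n) - 1 = -(K - (n + 1)) - 1 by ring]
    ring
  have e2 : HasSum (fun n : ℤ => y n * (z ^ (-n - 1) * w ^ (-(K - 1 - n) - 1))) (w * s) := by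
    refine (hs.mul_left w).of_forall_eq fun n => ?_
    rw [show -(K - 1 - n) - 1 = -(K - n) - 1 + 1 by ring, zpow_add_one₀ hw]
    ring
  have e3 := (e1.sub e2).unique (h.of_forall_eq fun n => by rw [diffSeq_apply, sub_mul])
  rwa [← e3, ← sub_mul, mul_div_cancel_left₀ _ hzw']

theorem hasSum_of_diffSeq_pow {N : ℕ} {c : ℤ → ℂ} {B K : ℤ} (hc : ∀ n < B, c n = 0) {z w S : ℂ}
    (hw : w ≠ 0) (hzw : ‖w‖ < ‖z‖)
    (h : HasSum (fun n : ℤ => (diffSeq ^ N) c n * (z ^ (-n - 1) * w ^ (-(K - N - n) - 1))) S) :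
    HasSum (fun n : ℤ => c n * (z ^ (-n - 1) * w ^ (-(K - n) - 1))) (S / (z - w) ^ N) := by
  induction N generalizing S with
  | zero => simpa using h
  | succ N ih =>
    rw [pow_succ', ← div_div]
    refine ih (hasSum_of_diffSeq (diffSeq_pow_left_trunc hc N) hw hzw ?_)
    refine h.of_forall_eq fun n => ?_
    rw [pow_succ', Module.End.mul_apply,
      show K - ((N + 1 : ℕ) : ℤ) - n = K - N - 1 - n by push_cast; ring]

end DifferenceSeries

section TwoPoint

variable {M : Type*} [AddCommGroup M] [Module ℂ M]

/-- The rational function `∑ c n z⁻ⁿ⁻¹ w^{-(K-n)-1}`, where `(z - w)ᴺ` clears the poles at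
`z = w`. -/
def twoPoint (N : ℕ) (K : ℤ) (c : ℤ → M) (z w : ℂ) : M :=
  -- On this range both exponents are nonnegative, so `toNat` loses nothing and the formula makes
  -- sense at `w = 0`.
  ((z - w) ^ N)⁻¹ • ∑ p ∈ Finset.Icc (K - N + 1) (-1),
    (z ^ (-p - 1).toNat * w ^ (N + p - K - 1).toNat) • (diffSeq ^ N) c p

theorem map_twoPoint {M' : Type*} [AddCommGroup M'] [Module ℂ M'] (φ : M →ₗ[ℂ] M') (N : ℕ) (K : ℤ)
    (c : ℤ → M) (z w : ℂ) :
    φ (twoPoint N K c z w) = twoPoint N K (fun k => φ (c k)) z w := by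
  simp only [twoPoint, map_smul, map_sum, map_diffSeq_pow]

theorem hasSum_twoPoint {N : ℕ} {K : ℤ} {c : ℤ → ℂ} (hc : ∀ n ≤ K, c n = 0)
    (hN : ∀ n ≥ 0, (diffSeq ^ N) c n = 0) {z w : ℂ} (hw : w ≠ 0) (hzw : ‖w‖ < ‖z‖) :
    HasSum (fun n : ℤ => c n * (z ^ (-n - 1) * w ^ (-(K - n) - 1))) (twoPoint N K c z w) := by
  have hc' : ∀ n < K + 1, c n = 0 := fun n hn => hc n (by omega)
  rw [twoPoint, smul_eq_mul, mul_comm, ← div_eq_mul_inv]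
  refine hasSum_of_diffSeq_pow hc' hw hzw ?_
  have : HasSum (fun n : ℤ => (diffSeq ^ N) c n * (z ^ (-n - 1) * w ^ (-(K - N - n) - 1))) _ :=
    hasSum_sum_of_ne_finset_zero (s := Finset.Icc (K - N + 1) (-1)) fun p hp => by
      rw [Finset.mem_Icc, not_and_or, not_le, not_le] at hp
      rcases hp with hp | hp
      · rw [diffSeq_pow_left_trunc hc' N p (by omega), zero_mul]
      · rw [hN p (by omega), zero_mul]
  convert this using 1
  refine Finset.sum_congr rfl fun p hp => ?_
  rw [Finset.mem_Icc] at hp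
  rw [smul_eq_mul, mul_comm, ← zpow_natCast, ← zpow_natCast, Int.toNat_of_nonneg (by omega),
    Int.toNat_of_nonneg (by omega), show (N : ℤ) + p - K - 1 = -(K - N - p) - 1 by ring]

/-- At `w = 0` only the lowest index `p = K + 1 - N` survives. If `N ≤ K + 1` the range is empty,
and `hN` makes the right side vanish as well. -/
theorem twoPoint_zero_right {N : ℕ} {K : ℤ} {c : ℤ → M} (hc : ∀ n ≤ K, c n = 0)
    (hN : (N : ℤ) ≤ K + 1 → c (K + 1) = 0) {z : ℂ} (hz : z ≠ 0) :
    twoPoint N K c z 0 = z ^ (-(K + 1) - 1) • c (K + 1) := by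
  have hc' : ∀ n < K + 1, c n = 0 := fun n hn => hc n (by omega)
  rcases le_or_gt (N : ℤ) (K + 1) with h | h
  · rw [twoPoint, Finset.Icc_eq_empty (by omega), Finset.sum_empty, smul_zero, hN h, smul_zero]
  · rw [twoPoint, Finset.sum_eq_single (K + 1 - N)]
    · rw [diffSeq_pow_first hc', smul_smul, sub_zero,
        show (N : ℤ) + (K + 1 - N) - K - 1 = 0 by ring, Int.toNat_zero, pow_zero, mul_one,
        ← zpow_natCast z (Int.toNat _), Int.toNat_of_nonneg (by omega), ← zpow_natCast z N,
        ← zpow_neg, ← zpow_add₀ hz]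
      congr 2
      ring
    · intro p hp hne
      rw [Finset.mem_Icc] at hp
      rw [zero_pow (by omega), mul_zero, zero_smul]
    · intro hp
      rw [Finset.mem_Icc, not_and_or] at hp
      omega

theorem analyticAt_twoPoint {E : Type*} [NormedAddCommGroup E] [NormedSpace ℝ E] (N : ℕ) (K : ℤ)
    (c : ℤ → ℂ) {f g : E → ℂ} {x : E} (hf : AnalyticAt ℝ f x) (hg : AnalyticAt ℝ g x)
    (hfg : f x ≠ g x) : AnalyticAt ℝ (fun y => twoPoint N K c (f y) (g y)) x := by
  simp only [twoPoint, smul_eq_mul]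
  refine AnalyticAt.mul (AnalyticAt.inv ((hf.sub hg).pow N) (pow_ne_zero _ (sub_ne_zero.2 hfg))) ?_
  refine Finset.analyticAt_fun_sum _ fun p _ => ?_
  exact ((hf.pow _).mul (hg.pow _)).mul analyticAt_const

end TwoPoint

/-! ### Weights of modes and weak commutativity in a vertex operator algebra -/

namespace VertexOperatorAlgebra

variable {A : Type*} [AddCommGroup A] [Module ℂ A] (V : VertexOperatorAlgebra A)

theorem mem_gr_of_eigen {n : ℤ} {v : A} (h : V.mode 1 V.conf v = (n : ℂ) • v) : v ∈ V.gr n := by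
  have hd : V.mode 1 V.conf = diagOp V.gr V.internal (fun n => (n : ℂ)) := by
    ext x
    induction x using graded_induction V.internal with
    | h i x hx => rw [V.grading i x hx, diagOp_of_mem _ _ hx]
    | hadd x y hx hy => simp only [map_add, hx, hy]
    | h0 => simp
  refine mem_of_gradedProj V.internal fun j hj => ?_
  have := gradedProj_diagOp V.internal (fun n => (n : ℂ)) j v
  rw [← hd, h, map_smul] at this
  exact_mod_cast (smul_left_injective ℂ hj this).symm

theorem mode_mem {h k : ℤ} {u v : A} (hu : u ∈ V.gr h) (hv : v ∈ V.gr k) (n : ℤ) :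
    V.mode n u v ∈ V.gr (h + k - n - 1) := by
  apply V.mem_gr_of_eigen
  -- With `p = 1` and `r = 0` this is the formula for `[L(0), u_n]`.
  have hJ := V.jacobi V.conf u v 1 0 n
  rw [finsum_eq_sum_range (B := 2), finsum_eq_sum_range (B := 1)] at hJ
  · simp only [Finset.sum_range_succ, Finset.range_zero, Finset.sum_empty, zero_add,
      Ring.choose_zero_right, Ring.choose_one_right, Int.cast_one, one_smul, pow_zero, mul_one,
      zpow_zero, Nat.cast_zero, Nat.cast_one, add_zero, sub_zero, V.derivative,
      V.grading h u hu, V.grading k v hv, map_smul, LinearMap.smul_apply, Int.cast_id] at hJ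
    rw [show (1 : ℤ) + n - 1 = n by ring, eq_sub_iff_add_eq] at hJ
    rw [← hJ]
    push_cast
    module
  · intro i hi
    rw [Ring.choose_zero_pos _ (by omega)]
    simp
  · intro i hi
    rw [show (1 : ℤ) = ((1 : ℕ) : ℤ) by rfl, Ring.choose_natCast,
      Nat.choose_eq_zero_of_lt (by omega)]
    simp

theorem mode_vac_right {n : ℤ} (hn : 0 ≤ n) (u : A) : V.mode n u V.vac = 0 := (V.creation u).2 n hn

/-- Weak commutativity on the vacuum. -/
theorem diffSeq_pow_products {a a' : A} {N : ℕ} (hN : ∀ n ≥ (N : ℤ), V.mode n a a' = 0) (K : ℤ) :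
    ∀ p ≥ 0, (diffSeq ^ N) (fun k => V.mode k a (V.mode (K - k) a' V.vac)) p = 0 := by
  intro p hp
  have htr : ∃ B : ℤ, ∀ n < B, (fun k => V.mode k a (V.mode (K - k) a' V.vac)) n = 0 :=
    ⟨K, fun n hn => by simp only; rw [V.mode_vac_right (by omega), map_zero]⟩
  rw [← jacobiLeft_natCast htr]
  -- Taking `r = N` kills the iterate by `hN`, and `p ≥ 0` kills the second product by the creation
  -- property.
  have hJ := V.jacobi a a' V.vac p N (K - N - p)
  have h0 : ∑ᶠ i : ℕ, ((Ring.choose p i : ℤ) : ℂ) • V.mode ((p : ℤ) + (K - N - p) - (i : ℤ))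
      (V.mode (N + i) a a') V.vac = 0 := by
    rw [← finsum_zero (α := ℕ)]
    exact finsum_congr fun i => by rw [hN _ (by omega)]; simp
  simp only [Int.cast_id] at hJ
  rw [h0] at hJ
  rw [jacobiLeft, hJ]
  refine finsum_congr fun i => ?_
  rw [V.mode_vac_right (n := p + i) (by omega), map_zero, smul_zero, sub_zero,
    show K - (p + N - (i : ℤ)) = K - N - p + i by ring]

end VertexOperatorAlgebra

/-! ### Weight projections and functionals on the tensor product -/

section TensorGrading

variable {A B : Type*} [AddCommGroup A] [Module ℂ A] [AddCommGroup B] [Module ℂ B]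
  (VL : VertexOperatorAlgebra A) (VR : VertexOperatorAlgebra B)

/-- The projection of `VL ⊗ VR` onto the sum of the `VL_i ⊗ VR_{n-i}`, `lo ≤ i ≤ hi`. -/
def tensorProj (lo hi n : ℤ) : A ⊗[ℂ] B →ₗ[ℂ] A ⊗[ℂ] B :=
  ∑ i ∈ Finset.Icc lo hi, TensorProduct.map (gradedProj VL.gr VL.internal i)
    (gradedProj VR.gr VR.internal (n - i))

variable {VL VR}

theorem tensorProj_of_mem_ne {lo hi n m : ℤ} (hmn : m ≠ n) {x : A ⊗[ℂ] B}
    (hx : x ∈ tensorGr VL VR m) : tensorProj VL VR lo hi n x = 0 := by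
  suffices h : tensorGr VL VR m ≤ LinearMap.ker (tensorProj VL VR lo hi n) from h hx
  refine iSup_le fun j => Submodule.map₂_le.2 fun a ha b hb => ?_
  rw [LinearMap.mem_ker, TensorProduct.mk_apply, tensorProj, LinearMap.sum_apply]
  refine Finset.sum_eq_zero fun i _ => ?_
  rw [TensorProduct.map_tmul]
  rcases eq_or_ne i j with rfl | hij
  · rw [gradedProj_of_mem_ne VR.internal hb (by omega), TensorProduct.tmul_zero]
  · rw [gradedProj_of_mem_ne VL.internal ha hij, TensorProduct.zero_tmul]

theorem tensorProj_of_mem {lo hi n : ℤ} (hlo : ∀ i < lo, VL.gr i = ⊥)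
    (hhi : ∀ i > hi, VR.gr (n - i) = ⊥) {x : A ⊗[ℂ] B}
    (hx : x ∈ tensorGr VL VR n) : tensorProj VL VR lo hi n x = x := by
  suffices h : tensorGr VL VR n ≤ LinearMap.ker (tensorProj VL VR lo hi n - LinearMap.id) from
    sub_eq_zero.1 (h hx)
  refine iSup_le fun j => Submodule.map₂_le.2 fun a ha b hb => ?_
  rw [LinearMap.mem_ker, TensorProduct.mk_apply, LinearMap.sub_apply, LinearMap.id_apply,
    sub_eq_zero, tensorProj, LinearMap.sum_apply]
  rw [Finset.sum_eq_single j]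
  · rw [TensorProduct.map_tmul, gradedProj_of_mem _ ha, gradedProj_of_mem _ hb]
  · intro i _ hij
    rw [TensorProduct.map_tmul, gradedProj_of_mem_ne VL.internal ha hij, TensorProduct.zero_tmul]
  · intro hj
    rw [Finset.mem_Icc, not_and_or, not_le, not_le] at hj
    rw [TensorProduct.map_tmul, gradedProj_of_mem _ ha, gradedProj_of_mem _ hb]
    rcases hj with hj | hj
    · rw [hlo j hj, Submodule.mem_bot] at ha
      rw [ha, TensorProduct.zero_tmul]
    · rw [hhi j hj, Submodule.mem_bot] at hb
      rw [hb, TensorProduct.tmul_zero]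

theorem tmul_mem_tensorGr {i j n : ℤ} (hn : i + j = n) {a : A} {b : B} (ha : a ∈ VL.gr i)
    (hb : b ∈ VR.gr j) : a ⊗ₜ[ℂ] b ∈ tensorGr VL VR n := by
  refine Submodule.mem_iSup_of_mem i (Submodule.apply_mem_map₂ _ ha ?_)
  rwa [show n - i = j by omega]

theorem tensorGrReal_intCast (n : ℤ) : tensorGrReal VL VR (n : ℝ) = tensorGr VL VR n := by
  refine le_antisymm (iSup₂_le fun m hm => ?_) (le_iSup₂_of_le n rfl le_rfl)
  rw [Int.cast_injective hm]

theorem tensorGrReal_of_ne {r : ℝ} (hr : ∀ n : ℤ, (n : ℝ) ≠ r) : tensorGrReal VL VR r = ⊥ := by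
  rw [eq_bot_iff]
  exact iSup₂_le fun m hm => absurd hm (hr m)

/-- Composition with `tensorProj` turns any functional into one supported in weight `r` without
changing it there; the bounds on the weights keep that projection a finite sum. -/
theorem eq_zero_of_forall_dual {r : ℝ} {x : A ⊗[ℂ] B} (hx : x ∈ tensorGrReal VL VR r)
    (h : ∀ φ : Module.Dual ℂ (A ⊗[ℂ] B), (∀ s, s ≠ r → ∀ y ∈ tensorGrReal VL VR s, φ y = 0) →
      φ x = 0) : x = 0 := by
  by_cases hr : ∀ n : ℤ, (n : ℝ) ≠ r
  · rwa [tensorGrReal_of_ne hr, Submodule.mem_bot] at hx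
  push Not at hr
  obtain ⟨n, rfl⟩ := hr
  rw [tensorGrReal_intCast] at hx
  obtain ⟨lo, hlo⟩ := VL.bounded
  obtain ⟨lo', hlo'⟩ := VR.bounded
  rw [← Module.forall_dual_apply_eq_zero_iff ℂ]
  intro φ
  have := h (φ ∘ₗ tensorProj VL VR lo (n - lo') n) fun s hs y hy => ?_
  · rwa [LinearMap.comp_apply, tensorProj_of_mem hlo (fun i hi => hlo' _ (by omega)) hx] at this
  · by_cases hs' : ∀ m : ℤ, (m : ℝ) ≠ s
    · rw [tensorGrReal_of_ne hs', Submodule.mem_bot] at hy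
      rw [hy, map_zero]
    push Not at hs'
    obtain ⟨m, rfl⟩ := hs'
    rw [tensorGrReal_intCast] at hy
    rw [LinearMap.comp_apply, tensorProj_of_mem_ne (fun h => hs (by rw [h])) hy, map_zero]

end TensorGrading

/-! ### Two-point correlators of the tensor product -/

section ConfigSpace

/-- The map `(p, q) ↦ (p + q, q)` carries `(ℂ ∖ {0}) × ℂ` onto it. -/
theorem isPreconnected_configSpace_two : IsPreconnected (configSpace 2) := by
  have h1 : IsPreconnected ({0}ᶜ : Set ℂ) :=
    (isConnected_compl_singleton_of_one_lt_rank (by rw [Complex.rank_real_complex]; norm_num) 0).isPreconnected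
  have h2 := (h1.prod (isPreconnected_univ (α := ℂ))).image
    (fun p : ℂ × ℂ => (![p.1 + p.2, p.2] : Fin 2 → ℂ)) (by
      refine Continuous.continuousOn (continuous_pi fun i => ?_)
      fin_cases i
      · exact continuous_fst.add continuous_snd
      · exact continuous_snd)
  convert h2 using 1
  ext z
  constructor
  · intro hz
    refine ⟨(z 0 - z 1, z 1), ⟨?_, trivial⟩, ?_⟩
    · exact sub_ne_zero.2 fun h => absurd (hz h) (by decide)
    · ext i; fin_cases i <;> simp
  · rintro ⟨⟨p, q⟩, ⟨hp, -⟩, rfl⟩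
    refine BigradedFieldData.pair_mem_configSpace ?_
    simpa using hp

end ConfigSpace

section Correlator

variable {A B : Type*} [AddCommGroup A] [Module ℂ A] [AddCommGroup B] [Module ℂ B]
  {VL : VertexOperatorAlgebra A} {VR : VertexOperatorAlgebra B}

/-- Two-point correlators are unique. -/
theorem IsTensorCorrelator.unique {u : Fin 2 → A ⊗[ℂ] B} {r : ℝ}
    {g g' : (Fin 2 → ℂ) → tensorGrReal VL VR r} (hg : IsTensorCorrelator VL VR 2 u r g)
    (hg' : IsTensorCorrelator VL VR 2 u r g') {z : Fin 2 → ℂ} (hz : z ∈ configSpace 2) :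
    g z = g' z := by
  rw [← sub_eq_zero, ← Submodule.coe_eq_zero]
  refine eq_zero_of_forall_dual (Subtype.prop _) fun φ hφ => ?_
  rw [Submodule.coe_sub, map_sub, sub_eq_zero]
  have h := hg φ hφ
  have h' := hg' φ hφ
  have hmem : (![2, 1] : Fin 2 → ℂ) ∈ configSpace 2 :=
    BigradedFieldData.pair_mem_configSpace (by norm_num)
  -- Identity theorem for real-analytic functions: near `(2, 1)` both are the sum of the same
  -- series.
  refine h.1.eqOn_of_preconnected_of_eventuallyEq h'.1 isPreconnected_configSpace_two hmem ?_ hz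
  have ho : IsOpen {z : Fin 2 → ℂ | ‖z 1‖ < ‖z 0‖ ∧ z 1 ≠ 0} :=
    (isOpen_lt (continuous_apply 1).norm (continuous_apply 0).norm).inter
      (isOpen_ne_fun (continuous_apply 1) continuous_const)
  filter_upwards [ho.mem_nhds ⟨by simp, by simp⟩] with w hw
  have hanti : StrictAnti fun i => ‖w i‖ := by
    intro i j hij
    fin_cases i <;> fin_cases j <;> first | exact hw.1 | exact absurd hij (by decide)
  have hne : ∀ i, w i ≠ 0 := by
    intro i
    fin_cases i
    · intro h0
      have := hw.1
      simp only [Fin.zero_eta] at h0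
      rw [h0, norm_zero] at this
      exact absurd this (not_lt.2 (norm_nonneg _))
    · exact hw.2
  exact (h.2 w hanti hne).unique (h'.2 w hanti hne)

theorem exists_coordinates {V : Type*} [AddCommGroup V] [Module ℂ V] (W : Submodule ℂ V)
    [FiniteDimensional ℂ W] : ∃ (n : ℕ) (ξ : Fin n → Module.Dual ℂ V) (e : Fin n → V),
      ∀ x ∈ W, x = ∑ j, ξ j x • e j := by
  have b := Module.finBasis ℂ W
  choose ξ hξ using fun j => LinearMap.exists_extend (b.coord j)
  refine ⟨_, ξ, fun j => W.subtype (b j), fun x hx => ?_⟩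
  have h : ∀ j, b.repr ⟨x, hx⟩ j = ξ j x := fun j => LinearMap.congr_fun (hξ j).symm ⟨x, hx⟩
  have h2 : W.subtype (∑ j, b.repr ⟨x, hx⟩ j • b j) = x := by rw [b.sum_repr]; rfl
  exact h2.symm.trans (by rw [map_sum]; simp only [map_smul, h])

/-- Coordinates on the finite-dimensional `W` split a functional into products of functionals, so
that convergence and analyticity can be treated in each tensor factor separately. -/
theorem exists_tmul_decomposition (W : Submodule ℂ A) [FiniteDimensional ℂ W]
    (φ : Module.Dual ℂ (A ⊗[ℂ] B)) : ∃ (n : ℕ) (ξ : Fin n → Module.Dual ℂ A)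
      (η : Fin n → Module.Dual ℂ B), ∀ a ∈ W, ∀ b, φ (a ⊗ₜ[ℂ] b) = ∑ j, ξ j a * η j b := by
  obtain ⟨n, ξ, e, he⟩ := exists_coordinates W
  refine ⟨n, ξ, fun j => φ ∘ₗ TensorProduct.mk ℂ A B (e j), fun a ha b => ?_⟩
  conv_lhs => rw [he a ha]
  rw [TensorProduct.sum_tmul, map_sum]
  refine Finset.sum_congr rfl fun j _ => ?_
  rw [← TensorProduct.smul_tmul', map_smul]
  rfl

theorem hasSum_sum_mul {ι ι' : Type*} {n : ℕ} {a : Fin n → ι → ℂ} {b : Fin n → ι' → ℂ}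
    {s t : Fin n → ℂ} (ha : ∀ j, HasSum (a j) (s j)) (hb : ∀ j, HasSum (b j) (t j)) :
    HasSum (fun p : ι × ι' => ∑ j, a j p.1 * b j p.2) (∑ j, s j * t j) :=
  hasSum_sum fun j _ => (ha j).mul (hb j)
    (summable_mul_of_summable_norm (ha j).summable.norm (hb j).summable.norm)

theorem hasSum_tmul {ι ι' : Type*} (W : Submodule ℂ A) [FiniteDimensional ℂ W]
    (φ : Module.Dual ℂ (A ⊗[ℂ] B)) {x : ι → A} {y : ι' → B} {α : ι → ℂ} {β : ι' → ℂ}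
    {gA : A} {gB : B} (hx : ∀ i, x i ∈ W) (hgA : gA ∈ W)
    (hA : ∀ ξ : Module.Dual ℂ A, HasSum (fun i => ξ (x i) * α i) (ξ gA))
    (hB : ∀ ξ : Module.Dual ℂ B, HasSum (fun i => ξ (y i) * β i) (ξ gB)) :
    HasSum (fun p : ι × ι' => φ (x p.1 ⊗ₜ[ℂ] y p.2) * (α p.1 * β p.2)) (φ (gA ⊗ₜ[ℂ] gB)) := by
  obtain ⟨n, ξ, η, hφ⟩ := exists_tmul_decomposition W φ
  rw [hφ gA hgA]
  have h := hasSum_sum_mul (fun j => hA (ξ j)) (fun j => hB (η j))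
  refine h.of_forall_eq fun p => ?_
  rw [hφ _ (hx _), Finset.sum_mul]
  exact Finset.sum_congr rfl fun j _ => mul_mul_mul_comm _ _ _ _

end Correlator

section

variable {M : Type*} [AddCommGroup M] [Module ℂ M]

theorem diffSeq_pow_mem {W : Submodule ℂ M} {c : ℤ → M} (hc : ∀ n, c n ∈ W) (N : ℕ) (n : ℤ) :
    (diffSeq ^ N) c n ∈ W := by
  induction N generalizing n with
  | zero => exact hc n
  | succ N ih =>
    rw [pow_succ', Module.End.mul_apply, diffSeq_apply]
    exact W.sub_mem (ih _) (ih _)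

theorem twoPoint_mem {W : Submodule ℂ M} {c : ℤ → M} (hc : ∀ n, c n ∈ W) (N : ℕ) (K : ℤ)
    (z w : ℂ) : twoPoint N K c z w ∈ W :=
  W.smul_mem _ (W.sum_mem fun _ _ => W.smul_mem _ (diffSeq_pow_mem hc N _))

end

namespace VertexOperatorAlgebra

variable {A : Type*} [AddCommGroup A] [Module ℂ A] (V : VertexOperatorAlgebra A)

theorem vac_mem : V.vac ∈ V.gr 0 := by
  apply V.mem_gr_of_eigen
  rw [V.mode_vac_right (by norm_num)]
  simp

/-- The products `a_k a'_{K-k} 𝟏`. -/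
def prodSeq (a a' : A) (K k : ℤ) : A := V.mode k a (V.mode (K - k) a' V.vac)

theorem prodSeq_of_le {a a' : A} {K k : ℤ} (hk : k ≤ K) : V.prodSeq a a' K k = 0 := by
  rw [prodSeq, V.mode_vac_right (by omega), map_zero]

theorem prodSeq_succ (a a' : A) (K : ℤ) : V.prodSeq a a' K (K + 1) = V.mode (K + 1) a a' := by
  rw [prodSeq, show K - (K + 1) = -1 by ring, (V.creation a').1]

theorem prodSeq_mem {a a' : A} {h h' : ℤ} (ha : a ∈ V.gr h) (ha' : a' ∈ V.gr h') (K k : ℤ) :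
    V.prodSeq a a' K k ∈ V.gr (h + h' - 2 - K) := by
  have := V.mode_mem ha (V.mode_mem ha' V.vac_mem (K - k)) k
  rwa [show h + (h' + 0 - (K - k) - 1) - k - 1 = h + h' - 2 - K by ring] at this

/-- The component `∑ₖ a_k a'_{K-k} 𝟏 z⁻ᵏ⁻¹ w^{-(K-k)-1}` of `Y(a, z) Y(a', w) 𝟏`. -/
def productAt (a a' : A) (N : ℕ) (K : ℤ) (z w : ℂ) : A := twoPoint N K (V.prodSeq a a' K) z w

theorem hasSum_productAt {a a' : A} {N : ℕ} (hN : ∀ n ≥ (N : ℤ), V.mode n a a' = 0) (K : ℤ)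
    (ξ : Module.Dual ℂ A) {z w : ℂ} (hw : w ≠ 0) (hzw : ‖w‖ < ‖z‖) :
    HasSum (fun k : ℤ => ξ (V.prodSeq a a' K k) * (z ^ (-k - 1) * w ^ (-(K - k) - 1)))
      (ξ (V.productAt a a' N K z w)) := by
  rw [productAt, map_twoPoint]
  refine hasSum_twoPoint (fun n hn => by rw [V.prodSeq_of_le hn, map_zero]) (fun n hn => ?_) hw hzw
  rw [← map_diffSeq_pow]
  exact (congrArg ξ (V.diffSeq_pow_products hN K n hn)).trans (map_zero ξ)

theorem productAt_zero {a a' : A} {N : ℕ} (hN : ∀ n ≥ (N : ℤ), V.mode n a a' = 0) (K : ℤ)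
    {z : ℂ} (hz : z ≠ 0) :
    V.productAt a a' N K z 0 = z ^ (-(K + 1) - 1) • V.mode (K + 1) a a' := by
  rw [productAt, twoPoint_zero_right (fun n hn => V.prodSeq_of_le hn) (fun h => ?_) hz,
    prodSeq_succ]
  rw [prodSeq_succ, hN _ h]

theorem productAt_mem {a a' : A} {h h' : ℤ} (ha : a ∈ V.gr h) (ha' : a' ∈ V.gr h') (N : ℕ) (K : ℤ)
    (z w : ℂ) : V.productAt a a' N K z w ∈ V.gr (h + h' - 2 - K) :=
  twoPoint_mem (V.prodSeq_mem ha ha' K) N K z w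

end VertexOperatorAlgebra

section Correlator

variable {A B : Type*} [AddCommGroup A] [Module ℂ A] [AddCommGroup B] [Module ℂ B]
  {VL : VertexOperatorAlgebra A} {VR : VertexOperatorAlgebra B}

theorem iterBimode_two (a a' : A) (b b' : B) (κ : Fin 2 → ℤ × ℤ) :
    iterBimode VL VR 2 ![a ⊗ₜ b, a' ⊗ₜ b'] κ =
      VL.mode (κ 0).1 a (VL.mode (κ 1).1 a' VL.vac) ⊗ₜ
        VR.mode (κ 0).2 b (VR.mode (κ 1).2 b' VR.vac) := by
  simp [iterBimode, tensorBimode, TensorProduct.map₂_apply_tmul]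

theorem analyticOnNhd_productAt {E : Type*} [NormedAddCommGroup E] [NormedSpace ℝ E] {U : Set E}
    {V : Type*} [AddCommGroup V] [Module ℂ V] (X : VertexOperatorAlgebra V)
    {a a' : V} (N : ℕ) (K : ℤ)
    (ξ : Module.Dual ℂ V) {f g : E → ℂ} (hf : AnalyticOnNhd ℝ f U) (hg : AnalyticOnNhd ℝ g U)
    (hfg : ∀ x ∈ U, f x ≠ g x) : AnalyticOnNhd ℝ (fun x => ξ (X.productAt a a' N K (f x) (g x))) U :=
  fun x hx => by
    simp only [VertexOperatorAlgebra.productAt, map_twoPoint]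
    exact analyticAt_twoPoint N K _ (hf x hx) (hg x hx) (hfg x hx)

theorem analyticOnNhd_coord (i : Fin 2) (U : Set (Fin 2 → ℂ)) :
    AnalyticOnNhd ℝ (fun z : Fin 2 → ℂ => z i) U := fun x _ =>
  (ContinuousLinearMap.proj (R := ℝ) (φ := fun _ : Fin 2 => ℂ) i).analyticAt x

theorem analyticOnNhd_conj_coord (i : Fin 2) (U : Set (Fin 2 → ℂ)) :
    AnalyticOnNhd ℝ (fun z : Fin 2 → ℂ => conj (z i)) U := fun x _ =>
  (Complex.conjCLE.toContinuousLinearMap ∘L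
    ContinuousLinearMap.proj (R := ℝ) (φ := fun _ : Fin 2 => ℂ) i).analyticAt x

/-- The components of the two-point correlator, as tensors. -/
def tensorTwoPoint (VL : VertexOperatorAlgebra A) (VR : VertexOperatorAlgebra B) (a a' : A)
    (b b' : B) (N N' : ℕ) (s : Finset ℤ) (S : ℤ) (z : Fin 2 → ℂ) : A ⊗[ℂ] B :=
  ∑ K ∈ s, VL.productAt a a' N K (z 0) (z 1) ⊗ₜ[ℂ]
    VR.productAt b b' N' (S - K) (conj (z 0)) (conj (z 1))

theorem hasSum_line {a a' : A} {b b' : B} {h₁ h₂ : ℤ} (ha : a ∈ VL.gr h₁) (ha' : a' ∈ VL.gr h₂)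
    {N N' : ℕ}
    (hN : ∀ n ≥ (N : ℤ), VL.mode n a a' = 0) (hN' : ∀ n ≥ (N' : ℤ), VR.mode n b b' = 0)
    (K K' : ℤ) (φ : Module.Dual ℂ (A ⊗[ℂ] B)) {z w : ℂ} (hw : w ≠ 0) (hzw : ‖w‖ < ‖z‖) :
    HasSum (fun p : ℤ × ℤ => φ (VL.prodSeq a a' K p.1 ⊗ₜ[ℂ] VR.prodSeq b b' K' p.2) *
      ((z ^ (-p.1 - 1) * w ^ (-(K - p.1) - 1)) *
        (conj z ^ (-p.2 - 1) * conj w ^ (-(K' - p.2) - 1))))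
      (φ (VL.productAt a a' N K z w ⊗ₜ[ℂ] VR.productAt b b' N' K' (conj z) (conj w))) := by
  have := VL.finite_dim (h₁ + h₂ - 2 - K)
  have hA := fun ξ => VL.hasSum_productAt hN K ξ hw hzw
  have hB := fun ξ => VR.hasSum_productAt hN' K' ξ (z := conj z) (w := conj w)
    (by simpa using hw) (by simpa using hzw)
  have h := hasSum_tmul (VL.gr (h₁ + h₂ - 2 - K)) φ (VL.prodSeq_mem ha ha' K)
    (VL.productAt_mem ha ha' N K z w) hA hB
  exact h

/-- Fixing the total weight leaves the pairs of lines `(κ 0).1 + (κ 1).1 = K`, `(κ 0).2 + (κ 1).2 =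
S - K`, and boundedness leaves finitely many `K`. On each pair the series is a product of two series
with rational sums. -/
theorem isTensorCorrelator_tensorTwoPoint {a a' : A} {b b' : B} {h₁ h₂ k₁ k₂ : ℤ}
    (ha : a ∈ VL.gr h₁) (ha' : a' ∈ VL.gr h₂) (hb : b ∈ VR.gr k₁) (hb' : b' ∈ VR.gr k₂) {N N' : ℕ}
    (hN : ∀ n ≥ (N : ℤ), VL.mode n a a' = 0) (hN' : ∀ n ≥ (N' : ℤ), VR.mode n b b' = 0)
    {s : Finset ℤ} {R : ℤ}
    (hs : ∀ K ∉ s, ∀ x ∈ VL.gr (h₁ + h₂ - 2 - K), ∀ y ∈ VR.gr (R - (h₁ + h₂ - 2 - K)),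
      x ⊗ₜ[ℂ] y = 0)
    (g : (Fin 2 → ℂ) → tensorGrReal VL VR (R : ℝ))
    (hg : ∀ z, (g z : A ⊗[ℂ] B) =
      tensorTwoPoint VL VR a a' b b' N N' s (h₁ + h₂ + k₁ + k₂ - 4 - R) z) :
    IsTensorCorrelator VL VR 2 ![a ⊗ₜ b, a' ⊗ₜ b'] R g := by
  intro φ hφ
  set S := h₁ + h₂ + k₁ + k₂ - 4 - R with hS
  refine ⟨?_, ?_⟩
  · simp only [hg, tensorTwoPoint, map_sum]
    refine Finset.analyticOnNhd_fun_sum _ fun K _ => ?_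
    have hfd := VL.finite_dim (h₁ + h₂ - 2 - K)
    obtain ⟨n, ξ, η, hξη⟩ := exists_tmul_decomposition (VL.gr (h₁ + h₂ - 2 - K)) φ
    have : (fun z : Fin 2 → ℂ => φ (VL.productAt a a' N K (z 0) (z 1) ⊗ₜ[ℂ]
        VR.productAt b b' N' (S - K) (conj (z 0)) (conj (z 1)))) = fun z =>
        ∑ j, ξ j (VL.productAt a a' N K (z 0) (z 1)) *
          η j (VR.productAt b b' N' (S - K) (conj (z 0)) (conj (z 1))) := by
      ext z
      exact hξη _ (VL.productAt_mem ha ha' N K _ _) _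
    rw [this]
    refine Finset.analyticOnNhd_fun_sum _ fun j _ => AnalyticOnNhd.mul ?_ ?_
    · exact analyticOnNhd_productAt VL N K (ξ j) (analyticOnNhd_coord 0 _)
        (analyticOnNhd_coord 1 _) fun z hz h => absurd (hz h) (by decide)
    · exact analyticOnNhd_productAt VR N' (S - K) (η j) (analyticOnNhd_conj_coord 0 _)
        (analyticOnNhd_conj_coord 1 _) fun z hz h =>
          absurd (hz (star_injective h)) (by decide)
  · intro z hz hz0
    have hw : z 1 ≠ 0 := hz0 1
    have hzw : ‖z 1‖ < ‖z 0‖ := hz (by decide)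
    set f : (Fin 2 → ℤ × ℤ) → ℂ := fun κ =>
      (∏ i, z i ^ (-(κ i).1 - 1) * conj (z i) ^ (-(κ i).2 - 1)) *
        φ (iterBimode VL VR 2 ![a ⊗ₜ b, a' ⊗ₜ b'] κ) with hf
    have hval : ∀ κ, f κ = φ (VL.prodSeq a a' ((κ 0).1 + (κ 1).1) (κ 0).1 ⊗ₜ[ℂ]
        VR.prodSeq b b' ((κ 0).2 + (κ 1).2) (κ 0).2) *
      ((z 0 ^ (-(κ 0).1 - 1) * z 1 ^ (-(κ 1).1 - 1)) *
        (conj (z 0) ^ (-(κ 0).2 - 1) * conj (z 1) ^ (-(κ 1).2 - 1))) := by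
      intro κ
      simp only [hf, iterBimode_two, Fin.prod_univ_two, VertexOperatorAlgebra.prodSeq,
        add_sub_cancel_left]
      ring
    -- The term has weights `h₁ + h₂ - 2 - K` and `k₁ + k₂ - 2 - K'`; for `φ` to see it they must
    -- add up to `R`, that is, `K + K' = S`.
    have hzero : ∀ κ, f κ ≠ 0 → (κ 0).1 + (κ 1).1 ∈ s ∧
        (κ 0).2 + (κ 1).2 = S - ((κ 0).1 + (κ 1).1) := by
      intro κ hκ
      rw [hval] at hκ
      have h1 := VL.prodSeq_mem ha ha' ((κ 0).1 + (κ 1).1) (κ 0).1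
      have h2 := VR.prodSeq_mem hb hb' ((κ 0).2 + (κ 1).2) (κ 0).2
      have hne : φ (VL.prodSeq a a' ((κ 0).1 + (κ 1).1) (κ 0).1 ⊗ₜ[ℂ]
        VR.prodSeq b b' ((κ 0).2 + (κ 1).2) (κ 0).2) ≠ 0 := left_ne_zero_of_mul hκ
      have h3 : (κ 0).2 + (κ 1).2 = S - ((κ 0).1 + (κ 1).1) := by
        by_contra hne'
        apply hne
        refine hφ _ (fun h => hne' ?_) _
          (by rw [tensorGrReal_intCast]; exact tmul_mem_tensorGr rfl h1 h2)
        have := Int.cast_injective (α := ℝ) h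
        omega
      refine ⟨by_contra fun hK => hne ?_, h3⟩
      rw [hs _ hK _ h1 _ (by
        rw [show R - (h₁ + h₂ - 2 - ((κ 0).1 + (κ 1).1)) = k₁ + k₂ - 2 - ((κ 0).2 + (κ 1).2) by
          rw [h3, hS]; ring]
        exact h2), map_zero]
    have hline : ∀ K ∈ s, HasSum (fun κ : Fin 2 → ℤ × ℤ =>
        if (κ 0).1 + (κ 1).1 = K ∧ (κ 0).2 + (κ 1).2 = S - K then f κ else 0)
        (φ (VL.productAt a a' N K (z 0) (z 1) ⊗ₜ[ℂ]
          VR.productAt b b' N' (S - K) (conj (z 0)) (conj (z 1)))) := by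
      intro K _
      set ι : ℤ × ℤ → (Fin 2 → ℤ × ℤ) := fun p => ![p, (K - p.1, S - K - p.2)] with hι
      have hinj : Function.Injective ι := fun p q h => congrFun h 0
      rw [← hinj.hasSum_iff]
      · refine (hasSum_line ha ha' hN hN' K (S - K) φ hw hzw).of_forall_eq fun p => ?_
        rw [Function.comp_apply, if_pos (by simp [hι]), hval]
        simp [hι]
      · intro κ hκ
        rw [if_neg]
        rintro ⟨h1, h2⟩
        refine hκ ⟨κ 0, ?_⟩
        ext i : 1
        fin_cases i
        · rfl
        · exact Prod.ext (by simp [hι, ← h1]) (by simp [hι, ← h2])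
    rw [hg, tensorTwoPoint, map_sum]
    refine (hasSum_sum hline).of_forall_eq fun κ => ?_
    by_cases hκ : f κ = 0
    · simp [hκ]
    · obtain ⟨h1, h2⟩ := hzero κ hκ
      rw [Finset.sum_eq_single ((κ 0).1 + (κ 1).1)]
      · rw [if_pos ⟨rfl, h2⟩]
      · intro K _ hK
        rw [if_neg fun h => hK h.1.symm]
      · intro h
        exact absurd h1 h

/-- The vertex operators of the full field algebra `VL ⊗ VR`. -/
theorem tensorField_vertexOp {a a' : A} {b b' : B} {h₁ h₂ k₁ k₂ : ℤ}
    (ha : a ∈ VL.gr h₁) (ha' : a' ∈ VL.gr h₂) (hb : b ∈ VR.gr k₁) (hb' : b' ∈ VR.gr k₂) (R : ℤ) :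
    ∃ s : Finset ℤ, (∀ k ∉ s, VL.mode k a a' ⊗ₜ[ℂ]
        VR.mode (h₁ + h₂ + k₁ + k₂ - 2 - R - k) b b' = 0) ∧
      ∀ z : ℂ, z ≠ 0 → ((tensorField VL VR).vertexOp (a ⊗ₜ b) z (a' ⊗ₜ b') (R : ℝ) : A ⊗[ℂ] B) =
        ∑ k ∈ s, (z ^ (-k - 1) * conj z ^ (-(h₁ + h₂ + k₁ + k₂ - 2 - R - k) - 1)) •
          (VL.mode k a a' ⊗ₜ[ℂ] VR.mode (h₁ + h₂ + k₁ + k₂ - 2 - R - k) b b') := by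
  obtain ⟨N, hN⟩ := VL.truncation a a'
  obtain ⟨N', hN'⟩ := VR.truncation b b'
  obtain ⟨lo, hlo⟩ := VL.bounded
  obtain ⟨lo', hlo'⟩ := VR.bounded
  have hN₁ : ∀ n ≥ (N.toNat : ℤ), VL.mode n a a' = 0 := fun n hn => hN n (by omega)
  have hN₁' : ∀ n ≥ (N'.toNat : ℤ), VR.mode n b b' = 0 := fun n hn => hN' n (by omega)
  set S := h₁ + h₂ + k₁ + k₂ - 4 - R with hS
  -- Outside this interval one of the two weights lies below the bound `lo` or `lo'`.
  set s := Finset.Icc (h₁ + h₂ - 2 + lo' - R) (h₁ + h₂ - 2 - lo) with hs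
  have hsz : ∀ K ∉ s, ∀ x ∈ VL.gr (h₁ + h₂ - 2 - K), ∀ y ∈ VR.gr (R - (h₁ + h₂ - 2 - K)),
      x ⊗ₜ[ℂ] y = 0 := by
    intro K hK x hx y hy
    rw [hs, Finset.mem_Icc, not_and_or, not_le, not_le] at hK
    rcases hK with hK | hK
    · rw [hlo' _ (by omega), Submodule.mem_bot] at hy
      rw [hy, TensorProduct.tmul_zero]
    · rw [hlo _ (by omega), Submodule.mem_bot] at hx
      rw [hx, TensorProduct.zero_tmul]
  have hmem : ∀ z, tensorTwoPoint VL VR a a' b b' N.toNat N'.toNat s S z ∈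
      tensorGrReal VL VR (R : ℝ) := by
    intro z
    rw [tensorGrReal_intCast]
    refine Submodule.sum_mem _ fun K _ => tmul_mem_tensorGr ?_
      (VL.productAt_mem ha ha' _ K _ _) (VR.productAt_mem hb hb' _ (S - K) _ _)
    omega
  have hcorr := isTensorCorrelator_tensorTwoPoint ha ha' hb hb' hN₁ hN₁' hsz
    (fun z => ⟨_, hmem z⟩) fun z => rfl
  have hex : ∃ g, IsTensorCorrelator VL VR 2 ![a ⊗ₜ b, a' ⊗ₜ b'] (R : ℝ) g := ⟨_, hcorr⟩
  -- The line with index sum `K` contributes the mode `K + 1` at `w = 0`, because only `a'_{-1} 𝟏 =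
  -- a'` survives; hence the shift of `s`.
  refine ⟨s.map (addRightEmbedding 1), fun k hk => ?_, fun z hz => ?_⟩
  · refine hsz (k - 1) (fun h => hk (Finset.mem_map.2 ⟨k - 1, h, by simp⟩)) _ ?_ _ ?_
    · rw [show h₁ + h₂ - 2 - (k - 1) = h₁ + h₂ - k - 1 by ring]
      exact VL.mode_mem ha ha' k
    · rw [show R - (h₁ + h₂ - 2 - (k - 1)) =
        k₁ + k₂ - (h₁ + h₂ + k₁ + k₂ - 2 - R - k) - 1 by ring]
      exact VR.mode_mem hb hb' _
  · have hz2 : (![z, 0] : Fin 2 → ℂ) ∈ configSpace 2 := BigradedFieldData.pair_mem_configSpace hz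
    -- The correlator is defined by a choice; uniqueness identifies it with the explicit one.
    have h1 : (tensorField VL VR).vertexOp (a ⊗ₜ b) z (a' ⊗ₜ b') (R : ℝ) =
        hex.choose ![z, 0] := congrFun (f := fun z => (tensorField VL VR).corr 2
          ![a ⊗ₜ b, a' ⊗ₜ b'] z (R : ℝ)) (funext fun z => dif_pos hex) ![z, 0]
    rw [h1, hex.choose_spec.unique hcorr hz2]
    simp only [tensorTwoPoint, Finset.sum_map, addRightEmbedding_apply]
    refine Finset.sum_congr rfl fun K _ => ?_
    have hz' : conj z ≠ 0 := by simpa using hz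
    simp only [Matrix.cons_val_zero, Matrix.cons_val_one, map_zero]
    rw [VL.productAt_zero hN₁ K hz, VR.productAt_zero hN₁' (S - K) hz',
      TensorProduct.smul_tmul_smul,
      show S - K + 1 = h₁ + h₂ + k₁ + k₂ - 2 - R - (K + 1) by rw [hS]; ring]

end Correlator

/-! ### Independence of exponentials on the plane -/

section Characters

/-- The character `ζ ↦ e^{e₁ ζ + e₂ ζ̄}` of the additive group `ℂ`. -/
def expChar (e : ℝ × ℝ) : Multiplicative ℂ →* ℂ where
  toFun ζ := Complex.exp (e.1 * ζ.toAdd + e.2 * conj ζ.toAdd)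
  map_one' := by simp
  map_mul' ζ ξ := by
    rw [← Complex.exp_add, toAdd_mul, map_add]
    congr 1
    ring

theorem expChar_apply (e : ℝ × ℝ) (ζ : ℂ) :
    expChar e (Multiplicative.ofAdd ζ) = Complex.exp (e.1 * ζ + e.2 * conj ζ) := rfl

/-- Real `ζ` detects `e.1 + e.2`, imaginary `ζ` detects `e.1 - e.2`. -/
theorem expChar_injective : Function.Injective expChar := by
  intro e e' h
  have h1 := DFunLike.congr_fun h (Multiplicative.ofAdd (1 : ℂ))
  rw [expChar_apply, expChar_apply, map_one, mul_one, mul_one, mul_one, mul_one,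
    ← Complex.ofReal_add, ← Complex.ofReal_add, ← Complex.ofReal_exp, ← Complex.ofReal_exp] at h1
  have h2 : e.1 + e.2 = e'.1 + e'.2 := Real.exp_injective (Complex.ofReal_injective h1)
  have h3 : (e.1 - e.2) - (e'.1 - e'.2) = 0 := by
    by_contra hne
    set δ := (e.1 - e.2) - (e'.1 - e'.2) with hδ
    -- At this point the quotient of the two characters is `e^{πi} = -1`, whereas equality would
    -- make it `1`.
    have h4 := DFunLike.congr_fun h (Multiplicative.ofAdd ((Real.pi / δ : ℝ) * Complex.I))
    rw [expChar_apply, expChar_apply, map_mul, Complex.conj_I, Complex.conj_ofReal] at h4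
    have h5 : Complex.exp (Real.pi * Complex.I) = 1 := by
      rw [Complex.exp_eq_exp_iff_exp_sub_eq_one] at h4
      rw [← h4]
      congr 1
      have : (δ : ℂ) ≠ 0 := by exact_mod_cast hne
      have e1 : (Real.pi : ℂ) = (Real.pi / δ : ℝ) * δ := by
        push_cast; field_simp
      conv_lhs => rw [e1]
      rw [hδ]
      push_cast
      ring
    rw [Complex.exp_pi_mul_I] at h5
    norm_num at h5
  exact Prod.ext (by linarith) (by linarith)

theorem linearIndependent_expChar :
    LinearIndependent ℂ (fun e : ℝ × ℝ => (expChar e : Multiplicative ℂ → ℂ)) :=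
  (linearIndependent_monoidHom (Multiplicative ℂ) ℂ).comp expChar expChar_injective

/-- Comparison of coefficients in finite sums of exponentials. -/
theorem sum_filter_eq_of_exp_sum_eq {ι κ : Type*} {s : Finset ι} {t : Finset κ} {a : ι → ℂ}
    {b : κ → ℂ} {e : ι → ℝ × ℝ} {e' : κ → ℝ × ℝ}
    (h : ∀ ζ : ℂ, ∑ i ∈ s, a i * Complex.exp ((e i).1 * ζ + (e i).2 * conj ζ) =
      ∑ j ∈ t, b j * Complex.exp ((e' j).1 * ζ + (e' j).2 * conj ζ)) (e₀ : ℝ × ℝ) :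
    ∑ i ∈ s, (if e i = e₀ then a i else 0) = ∑ j ∈ t, if e' j = e₀ then b j else 0 := by
  have hf : ∑ i ∈ s, Finsupp.single (e i) (a i) = ∑ j ∈ t, Finsupp.single (e' j) (b j) := by
    apply linearIndependent_expChar
    ext ζ
    simp only [map_sum, Finsupp.linearCombination_single, Finset.sum_apply, Pi.smul_apply,
      smul_eq_mul]
    exact h ζ.toAdd
  have := DFunLike.congr_fun hf e₀
  simpa only [Finsupp.coe_finsetSum, Finset.sum_apply, Finsupp.single_apply] using this

end Characters

/-! ### The image of `ρ`: chiral and antichiral fields -/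

namespace FullFieldAlgebraOver

variable {A B F : Type*} [AddCommGroup A] [Module ℂ A] [AddCommGroup B] [Module ℂ B]
  [AddCommGroup F] [Module ℂ F] {VL : VertexOperatorAlgebra A} {VR : VertexOperatorAlgebra B}
  (X : FullFieldAlgebraOver VL VR F)

theorem rho_mem_gr {a : A} {b : B} {h k : ℤ} (ha : a ∈ VL.gr h) (hb : b ∈ VR.gr k) :
    X.ρ (a ⊗ₜ b) ∈ X.gr ((h + k : ℤ) : ℝ) :=
  X.ρ_hom.map_gr _ _ (by
    change _ ∈ tensorGrReal VL VR _
    rw [tensorGrReal_intCast]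
    exact tmul_mem_tensorGr rfl ha hb)

theorem vertexOp_rho (u v : A ⊗[ℂ] B) {z : ℂ} (hz : z ≠ 0) (r : ℝ) :
    X.ρ ((tensorField VL VR).vertexOp u z v r) = X.vertexOp (X.ρ u) z (X.ρ v) r := by
  have h := X.ρ_hom.map_corr 2 (by norm_num) ![u, v] ![z, 0]
    (BigradedFieldData.pair_mem_configSpace hz) r
  have e : (fun i => X.ρ (![u, v] i)) = ![X.ρ u, X.ρ v] := by
    ext i; fin_cases i <;> rfl
  rw [e] at h
  exact h

theorem vertexOp_eq_sum (s : ℝ × ℝ) (u v : F) {z : ℂ} (hz : z ≠ 0) :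
    X.comp s (X.vertexOp u z v) = ∑ ab ∈ (X.P_finite u).toFinset ×ˢ (X.P_finite v).toFinset,
      X.comp s (X.vertexOp (X.P ab.1 u) z (X.P ab.2 v)) := by
  simp only [← X.compVertexOp_apply s hz]
  have h : ∀ w : F, ∑ a ∈ (X.P_finite w).toFinset, X.P a w = w := fun w => by
    conv_rhs => rw [← X.finsum_P w]
    exact (finsum_eq_sum _ _).symm
  conv_lhs => rw [← h u, ← h v]
  simp only [map_sum, LinearMap.sum_apply]
  rw [Finset.sum_product, Finset.sum_comm]

theorem bimode_mem_gr {u v : F} {p q : ℝ} (hu : u ∈ X.gr p) (hv : v ∈ X.gr q) (k l : ℝ) :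
    X.bimode k l u v ∈ X.gr (p + q - k - l - 2) := by
  rw [X.bimode_apply, X.mode_eq_finsum]
  refine finsum_induction (· ∈ X.gr (p + q - k - l - 2)) (Submodule.zero_mem _)
    (fun _ _ => Submodule.add_mem _) fun ab => ?_
  by_cases h1 : ab.1.1 + ab.1.2 = p
  · by_cases h2 : ab.2.1 + ab.2.2 = q
    · have := X.bigr_le_gr _ (X.atOne_mem (ab.1 + ab.2 - (k + 1, l + 1)) (X.P ab.1 u) (X.P ab.2 v))
      convert this using 2
      simp only [Prod.fst_sub, Prod.snd_sub, Prod.fst_add, Prod.snd_add]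
      linarith
    · rw [X.P_of_mem_gr_ne hv h2, map_zero]
      exact Submodule.zero_mem _
  · rw [X.P_of_mem_gr_ne hu h1, map_zero]
    exact Submodule.zero_mem _

/-- At this stage only the total weight of `ρ (a ⊗ b)` is known, so its bigraded components are kept
apart. At `z = e^ζ` both sides of the homomorphism property are finite exponential sums in `ζ`, and
the modes are coefficients of the same exponential. -/
theorem bimode_rho_homogeneous {a a' : A} {b b' : B} {h₁ h₂ k₁ k₂ : ℤ}
    (ha : a ∈ VL.gr h₁) (ha' : a' ∈ VL.gr h₂) (hb : b ∈ VR.gr k₁) (hb' : b' ∈ VR.gr k₂) (k l : ℤ) :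
    X.bimode k l (X.ρ (a ⊗ₜ b)) (X.ρ (a' ⊗ₜ b')) =
      X.ρ (VL.mode k a a' ⊗ₜ VR.mode l b b') := by
  set u := X.ρ (a ⊗ₜ b) with hu
  set v := X.ρ (a' ⊗ₜ b') with hv
  refine X.P_ext fun γ => ?_
  have hLmem : X.bimode k l u v ∈ X.gr ((h₁ + h₂ + k₁ + k₂ - 2 - k - l : ℤ) : ℝ) := by
    have := X.bimode_mem_gr (X.rho_mem_gr ha hb) (X.rho_mem_gr ha' hb') k l
    convert this using 2
    push_cast
    ring
  have hRmem : X.ρ (VL.mode k a a' ⊗ₜ VR.mode l b b') ∈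
      X.gr ((h₁ + h₂ + k₁ + k₂ - 2 - k - l : ℤ) : ℝ) := by
    have := X.rho_mem_gr (VL.mode_mem ha ha' k) (VR.mode_mem hb hb' l)
    rwa [show h₁ + h₂ - k - 1 + (k₁ + k₂ - l - 1) = h₁ + h₂ + k₁ + k₂ - 2 - k - l by ring] at this
  by_cases hγ : γ.1 + γ.2 = ((h₁ + h₂ + k₁ + k₂ - 2 - k - l : ℤ) : ℝ)
  swap
  · rw [X.P_of_mem_gr_ne hLmem hγ, X.P_of_mem_gr_ne hRmem hγ]
  rw [← sub_eq_zero, ← Module.forall_dual_apply_eq_zero_iff ℂ]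
  intro φ
  rw [map_sub, sub_eq_zero]
  obtain ⟨s, hs, hsum⟩ := tensorField_vertexOp ha ha' hb hb' (h₁ + h₂ + k₁ + k₂ - 2 - k - l)
  have hl : ∀ j, h₁ + h₂ + k₁ + k₂ - 2 - (h₁ + h₂ + k₁ + k₂ - 2 - k - l) - j = k + l - j :=
    fun j => by ring
  simp only [hl] at hs hsum
  -- The exponent selected at the end is that of `x^{-k-1} x̄^{-l-1}`.
  have key := sum_filter_eq_of_exp_sum_eq
    (s := (X.P_finite u).toFinset ×ˢ (X.P_finite v).toFinset) (t := s)
    (a := fun ab => φ (X.atOne γ (X.P ab.1 u) (X.P ab.2 v)))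
    (b := fun j => φ (X.P γ (X.ρ (VL.mode j a a' ⊗ₜ VR.mode (k + l - j) b b'))))
    (e := fun ab => γ - ab.1 - ab.2) (e' := fun j : ℤ => (-(j : ℝ) - 1, -((k + l - j : ℤ) : ℝ) - 1))
    (fun ζ => ?_) (-(k : ℝ) - 1, -(l : ℝ) - 1)
  · have hL : φ (X.P γ (X.bimode k l u v)) =
        ∑ ab ∈ (X.P_finite u).toFinset ×ˢ (X.P_finite v).toFinset,
          if γ - ab.1 - ab.2 = (-(k : ℝ) - 1, -(l : ℝ) - 1) then
            φ (X.atOne γ (X.P ab.1 u) (X.P ab.2 v)) else 0 := by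
      rw [X.bimode_apply, X.mode_eq_finsum, finsum_eq_sum_of_support_subset
        (s := (X.P_finite u).toFinset ×ˢ (X.P_finite v).toFinset), map_sum, map_sum]
      · refine Finset.sum_congr rfl fun ab _ => ?_
        by_cases hab : γ = ab.1 + ab.2 - ((k : ℝ) + 1, (l : ℝ) + 1)
        · rw [← hab, if_pos, X.P_of_mem (X.atOne_mem _ _ _)]
          rw [hab]
          ext <;> simp <;> ring
        · rw [if_neg, X.P_of_mem_ne (X.atOne_mem _ _ _) hab, map_zero]
          intro h
          apply hab
          have h1 := congrArg Prod.fst h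
          have h2 := congrArg Prod.snd h
          simp only [Prod.fst_sub, Prod.snd_sub] at h1 h2
          ext <;> simp <;> linarith
      · intro ab hab
        rw [Finset.mem_coe, Finset.mem_product, Set.Finite.mem_toFinset, Set.Finite.mem_toFinset]
        refine ⟨fun h => hab ?_, fun h => hab ?_⟩
        · simp only at h ⊢; rw [h]; simp
        · simp only at h ⊢; rw [h]; simp
    rw [hL, key]
    have hiff : ∀ j : ℤ, ((-(j : ℝ) - 1, -((k + l - j : ℤ) : ℝ) - 1) = (-(k : ℝ) - 1, -(l : ℝ) - 1)) ↔
        j = k := by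
      intro j
      constructor
      · intro h
        have h1 := congrArg Prod.fst h
        simp only [sub_left_inj, neg_inj] at h1
        exact_mod_cast h1
      · rintro rfl
        simp
    simp only [hiff]
    rw [Finset.sum_ite_eq']
    split_ifs with hk
    · rw [add_sub_cancel_left]
    · have := hs k hk
      rw [add_sub_cancel_left] at this
      rw [this]
      simp
  · have hz := Complex.exp_ne_zero ζ
    have h1 := X.vertexOp_eq_sum γ u v hz
    have h2 : X.comp γ (X.vertexOp u (Complex.exp ζ) v) =
        X.P γ (X.ρ (∑ j ∈ s, (Complex.exp ζ ^ (-j - 1) * conj (Complex.exp ζ) ^ (-(k + l - j) - 1)) •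
          (VL.mode j a a' ⊗ₜ[ℂ] VR.mode (k + l - j) b b'))) := by
      rw [BigradedFieldData.comp, hγ, hu, hv, ← X.vertexOp_rho _ _ hz, hsum _ hz]
    rw [h2] at h1
    have h3 := congrArg φ h1
    simp only [map_sum, map_smul, smul_eq_mul] at h3
    have h4 : ∀ ab : (ℝ × ℝ) × (ℝ × ℝ), φ (X.comp γ
        (X.vertexOp (X.P ab.1 u) (Complex.exp ζ) (X.P ab.2 v))) =
        φ (X.atOne γ (X.P ab.1 u) (X.P ab.2 v)) *
          Complex.exp ((γ - ab.1 - ab.2).1 * ζ + (γ - ab.1 - ab.2).2 * conj ζ) := by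
      intro ab
      rw [X.comp_vertexOp_exp (X.P_mem _ _) (X.P_mem _ _), map_smul, smul_eq_mul, mul_comm]
      rfl
    simp only [h4] at h3
    rw [← h3]
    refine Finset.sum_congr rfl fun j _ => ?_
    rw [mul_comm]
    congr 1
    rw [← Complex.exp_conj, ← Complex.exp_int_mul, ← Complex.exp_int_mul, ← Complex.exp_add]
    congr 1
    push_cast
    ring

theorem bimode_rho (k l : ℤ) (u v : A ⊗[ℂ] B) :
    X.bimode k l (X.ρ u) (X.ρ v) = X.ρ (tensorBimode VL VR k l u v) := by
  induction u using TensorProduct.induction_on with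
  | zero => simp
  | add x y hx hy => simp only [map_add, LinearMap.add_apply, hx, hy]
  | tmul a b =>
    induction v using TensorProduct.induction_on with
    | zero => simp
    | add x y hx hy => simp only [map_add, hx, hy]
    | tmul a' b' =>
      rw [tensorBimode, TensorProduct.map₂_apply_tmul, TensorProduct.map_tmul]
      induction a using graded_induction VL.internal with
      | h0 => simp
      | hadd x y hx hy => simp only [map_add, TensorProduct.add_tmul, LinearMap.add_apply, hx, hy]
      | h h₁ a ha =>
      induction a' using graded_induction VL.internal with
      | h0 => simp
      | hadd x y hx hy => simp only [map_add, TensorProduct.add_tmul, hx, hy]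
      | h h₂ a' ha' =>
      induction b using graded_induction VR.internal with
      | h0 => simp
      | hadd x y hx hy => simp only [map_add, TensorProduct.tmul_add, LinearMap.add_apply, hx, hy]
      | h k₁ b hb =>
      induction b' using graded_induction VR.internal with
      | h0 => simp
      | hadd x y hx hy => simp only [map_add, TensorProduct.tmul_add, hx, hy]
      | h k₂ b' hb' => exact X.bimode_rho_homogeneous ha ha' hb hb' k l

theorem bimode_rho_tmul (k l : ℤ) (a a' : A) (b b' : B) :
    X.bimode k l (X.ρ (a ⊗ₜ b)) (X.ρ (a' ⊗ₜ b')) = X.ρ (VL.mode k a a' ⊗ₜ VR.mode l b b') := by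
  rw [bimode_rho, tensorBimode, TensorProduct.map₂_apply_tmul, TensorProduct.map_tmul]

theorem dL_rho {a : A} {h : ℤ} (ha : a ∈ VL.gr h) (b : B) :
    X.dL (X.ρ (a ⊗ₜ b)) = (h : ℂ) • X.ρ (a ⊗ₜ b) := by
  have := X.bimode_rho_tmul 1 (-1) VL.conf a VR.vac b
  rw [VL.grading h a ha, VR.vacuum, if_pos rfl, ← TensorProduct.smul_tmul', map_smul] at this
  rw [X.dL_eq, ← this]
  simp [X.bimode_apply]

theorem dR_rho (a : A) {b : B} {k : ℤ} (hb : b ∈ VR.gr k) :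
    X.dR (X.ρ (a ⊗ₜ b)) = (k : ℂ) • X.ρ (a ⊗ₜ b) := by
  have := X.bimode_rho_tmul (-1) 1 VL.vac a VR.conf b
  rw [VR.grading k b hb, VL.vacuum, if_pos rfl, TensorProduct.tmul_smul, map_smul] at this
  rw [X.dR_eq, ← this]
  simp [X.bimode_apply]

/-- Through `dL_eq` and `dR_eq` the grading operators act on the image of `ρ` as `L(0) ⊗ 1` and `1 ⊗
L(0)`. -/
theorem rho_mem {a : A} {b : B} {h k : ℤ} (ha : a ∈ VL.gr h) (hb : b ∈ VR.gr k) :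
    X.ρ (a ⊗ₜ b) ∈ X.bigr ((h : ℝ), (k : ℝ)) :=
  X.mem_bigr_of_eigen (by simpa using X.dL_rho ha b) (by simpa using X.dR_rho a hb)

theorem DL_rho_vac (b : B) : X.DL (X.ρ (VL.vac ⊗ₜ b)) = 0 := by
  have := X.bimode_rho_tmul 0 (-1) VL.conf VL.vac VR.vac b
  rw [VL.mode_vac_right le_rfl, TensorProduct.zero_tmul, map_zero] at this
  rw [X.DL_eq, ← this]
  simp [X.bimode_apply]

theorem DR_rho_vac (a : A) : X.DR (X.ρ (a ⊗ₜ VR.vac)) = 0 := by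
  have := X.bimode_rho_tmul (-1) 0 VL.vac a VR.conf VR.vac
  rw [VR.mode_vac_right le_rfl, TensorProduct.tmul_zero, map_zero] at this
  rw [X.DR_eq, ← this]
  simp [X.bimode_apply]

/-- As `DR` kills `a ⊗ 𝟏`, the derivative of its field in `z̄` vanishes, and the `𝐝ᴿ` bracket
reduces to `s.2 - p.2` annihilating the component. -/
theorem atOne_left_eq_zero (a : A) {v : F} {p s : ℝ × ℝ} (hv : v ∈ X.bigr p) (hs : s.2 ≠ p.2) :
    X.atOne s (X.ρ (a ⊗ₜ VR.vac)) v = 0 := by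
  rw [← Module.forall_dual_apply_eq_zero_iff ℂ]
  intro φ
  have h1 := X.DR_derivative (X.ρ (a ⊗ₜ VR.vac)) v 1 one_ne_zero s φ
  have h2 := X.dR_bracket (X.ρ (a ⊗ₜ VR.vac)) v 1 one_ne_zero s φ
  rw [← h1, X.DR_rho_vac, X.dR_rho a VR.vac_mem, X.dR_of_mem hv] at h2
  simp only [← X.atOne_apply, map_zero, LinearMap.zero_apply, map_smul,
    smul_eq_mul, Int.cast_zero, mul_zero, add_zero, zero_smul, ← sub_mul] at h2
  refine (mul_eq_zero.1 h2).resolve_left (sub_ne_zero.2 ?_)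
  exact_mod_cast hs

theorem atOne_right_eq_zero (b : B) {v : F} {p s : ℝ × ℝ} (hv : v ∈ X.bigr p) (hs : s.1 ≠ p.1) :
    X.atOne s (X.ρ (VL.vac ⊗ₜ b)) v = 0 := by
  rw [← Module.forall_dual_apply_eq_zero_iff ℂ]
  intro φ
  have h1 := X.DL_derivative (X.ρ (VL.vac ⊗ₜ b)) v 1 one_ne_zero s φ
  have h2 := X.dL_bracket (X.ρ (VL.vac ⊗ₜ b)) v 1 one_ne_zero s φ
  rw [← h1, X.DL_rho_vac, X.dL_rho VL.vac_mem b, X.dL_of_mem hv] at h2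
  simp only [← X.atOne_apply, map_zero, LinearMap.zero_apply, map_smul,
    smul_eq_mul, Int.cast_zero, mul_zero, add_zero, zero_smul, ← sub_mul] at h2
  refine (mul_eq_zero.1 h2).resolve_left (sub_ne_zero.2 ?_)
  exact_mod_cast hs

/-- The modes of the chiral field of `a ⊗ 𝟏`. -/
def leftMode (n : ℤ) (a : A) : F →ₗ[ℂ] F := X.bimode n (-1) (X.ρ (a ⊗ₜ VR.vac))

/-- The modes of the antichiral field of `𝟏 ⊗ b`. -/
def rightMode (n : ℤ) (b : B) : F →ₗ[ℂ] F := X.bimode (-1) n (X.ρ (VL.vac ⊗ₜ b))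

theorem leftMode_rho (n : ℤ) (a a' : A) (b : B) :
    X.leftMode n a (X.ρ (a' ⊗ₜ b)) = X.ρ (VL.mode n a a' ⊗ₜ b) := by
  have := X.bimode_rho_tmul n (-1) a a' VR.vac b
  rw [VR.vacuum, if_pos rfl] at this
  rw [leftMode, ← this]
  simp

theorem rightMode_rho (n : ℤ) (b b' : B) (a : A) :
    X.rightMode n b (X.ρ (a ⊗ₜ b')) = X.ρ (a ⊗ₜ VR.mode n b b') := by
  have := X.bimode_rho_tmul (-1) n VL.vac a b b'
  rw [VL.vacuum, if_pos rfl] at this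
  rw [rightMode, ← this]
  simp

variable {a : A} {b : B} {h : ℤ} {v : F} {p : ℝ × ℝ}

theorem atOne_left (ha : a ∈ VL.gr h) (hv : v ∈ X.bigr p) (n : ℤ) :
    X.atOne (p.1 + h - n - 1, p.2) (X.ρ (a ⊗ₜ VR.vac)) v = X.leftMode n a v := by
  rw [X.atOne_eq_bimode (X.rho_mem ha VR.vac_mem) hv, leftMode]
  congr 3 <;> (simp only [Int.cast_zero]; ring)

theorem atOne_right (hb : b ∈ VR.gr h) (hv : v ∈ X.bigr p) (n : ℤ) :
    X.atOne (p.1, p.2 + h - n - 1) (X.ρ (VL.vac ⊗ₜ b)) v = X.rightMode n b v := by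
  rw [X.atOne_eq_bimode (X.rho_mem VL.vac_mem hb) hv, rightMode]
  congr 3 <;> (simp only [Int.cast_zero]; ring)

theorem leftMode_mem (ha : a ∈ VL.gr h) (hv : v ∈ X.bigr p) (n : ℤ) :
    X.leftMode n a v ∈ X.bigr (p.1 + h - n - 1, p.2) := by
  rw [← X.atOne_left ha hv]
  exact X.atOne_mem _ _ _

theorem rightMode_mem (hb : b ∈ VR.gr h) (hv : v ∈ X.bigr p) (n : ℤ) :
    X.rightMode n b v ∈ X.bigr (p.1, p.2 + h - n - 1) := by
  rw [← X.atOne_right hb hv]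
  exact X.atOne_mem _ _ _

/-- The right weight is unchanged, and the difference of weights is an integer both before and
after, so the left weight moves by an integer. -/
theorem atOne_left_ne (hv : v ∈ X.bigr p) {s : ℝ × ℝ}
    (hs : ∀ n : ℤ, s ≠ (p.1 + h - n - 1, p.2)) : X.atOne s (X.ρ (a ⊗ₜ VR.vac)) v = 0 := by
  by_contra hne
  have h2 : s.2 = p.2 := by_contra fun h2 => hne (X.atOne_left_eq_zero a hv h2)
  have hv0 : v ≠ 0 := by
    rintro rfl
    exact hne (map_zero _)
  obtain ⟨i, hi⟩ := X.exists_int_of_mem (X.atOne_mem _ _ _) hne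
  obtain ⟨j, hj⟩ := X.exists_int_of_mem hv hv0
  refine hs (h + j - i - 1) (Prod.ext ?_ h2)
  push_cast
  linarith

theorem atOne_right_ne (hv : v ∈ X.bigr p) {s : ℝ × ℝ}
    (hs : ∀ n : ℤ, s ≠ (p.1, p.2 + h - n - 1)) : X.atOne s (X.ρ (VL.vac ⊗ₜ b)) v = 0 := by
  by_contra hne
  have h2 : s.1 = p.1 := by_contra fun h2 => hne (X.atOne_right_eq_zero b hv h2)
  have hv0 : v ≠ 0 := by
    rintro rfl
    exact hne (map_zero _)
  obtain ⟨i, hi⟩ := X.exists_int_of_mem (X.atOne_mem _ _ _) hne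
  obtain ⟨j, hj⟩ := X.exists_int_of_mem hv hv0
  refine hs (h - j + i - 1) (Prod.ext h2 ?_)
  push_cast
  linarith

theorem comp_vertexOp_left (ha : a ∈ VL.gr h) (hv : v ∈ X.bigr p) {s : ℝ × ℝ} {n : ℤ}
    (hs : s = (p.1 + h - n - 1, p.2)) {z : ℂ} (hz : z ≠ 0) :
    X.comp s (X.vertexOp (X.ρ (a ⊗ₜ VR.vac)) z v) = z ^ (-n - 1) • X.leftMode n a v := by
  subst hs
  rw [← Complex.exp_log hz, X.comp_vertexOp_exp (X.rho_mem ha VR.vac_mem) hv, X.atOne_left ha hv,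
    ← Complex.exp_int_mul]
  congr 2
  push_cast
  ring

theorem comp_vertexOp_left_ne (ha : a ∈ VL.gr h) (hv : v ∈ X.bigr p) {s : ℝ × ℝ}
    (hs : ∀ n : ℤ, s ≠ (p.1 + h - n - 1, p.2)) {z : ℂ} (hz : z ≠ 0) :
    X.comp s (X.vertexOp (X.ρ (a ⊗ₜ VR.vac)) z v) = 0 := by
  rw [← Complex.exp_log hz, X.comp_vertexOp_exp (X.rho_mem ha VR.vac_mem) hv,
    X.atOne_left_ne hv hs, smul_zero]

theorem comp_vertexOp_right (hb : b ∈ VR.gr h) (hv : v ∈ X.bigr p) {s : ℝ × ℝ} {n : ℤ}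
    (hs : s = (p.1, p.2 + h - n - 1)) {z : ℂ} (hz : z ≠ 0) :
    X.comp s (X.vertexOp (X.ρ (VL.vac ⊗ₜ b)) z v) = conj z ^ (-n - 1) • X.rightMode n b v := by
  subst hs
  rw [← Complex.exp_log hz, X.comp_vertexOp_exp (X.rho_mem VL.vac_mem hb) hv, X.atOne_right hb hv,
    ← Complex.exp_conj, ← Complex.exp_int_mul]
  congr 2
  push_cast
  ring

theorem comp_vertexOp_right_ne (hb : b ∈ VR.gr h) (hv : v ∈ X.bigr p) {s : ℝ × ℝ}
    (hs : ∀ n : ℤ, s ≠ (p.1, p.2 + h - n - 1)) {z : ℂ} (hz : z ≠ 0) :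
    X.comp s (X.vertexOp (X.ρ (VL.vac ⊗ₜ b)) z v) = 0 := by
  rw [← Complex.exp_log hz, X.comp_vertexOp_exp (X.rho_mem VL.vac_mem hb) hv,
    X.atOne_right_ne hv hs, smul_zero]

end FullFieldAlgebraOver

/-! ## Expansions of the three point functions -/

section Blocks

variable {T : Type*}

/-- Three entries, in blocks of lengths one and two. -/
def blocksOneTwo (x y z : T) : (i : Fin 2) → Fin ((![1, 2] : Fin 2 → ℕ) i) → T
  | 0 => ![x]
  | 1 => ![y, z]

/-- Three entries, in blocks of lengths two and one. -/
def blocksTwoOne (x y z : T) : (i : Fin 2) → Fin ((![2, 1] : Fin 2 → ℕ) i) → T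
  | 0 => ![x, y]
  | 1 => ![z]

theorem sum_oneTwo : ∑ i, (![1, 2] : Fin 2 → ℕ) i = 3 := rfl

theorem sum_twoOne : ∑ i, (![2, 1] : Fin 2 → ℕ) i = 3 := rfl

theorem forall_sigma_oneTwo {p : (i : Fin 2) × Fin ((![1, 2] : Fin 2 → ℕ) i) → Prop}
    (h₀ : p ⟨0, (0 : Fin 1)⟩) (h₁ : p ⟨1, (0 : Fin 2)⟩) (h₂ : p ⟨1, (1 : Fin 2)⟩) : ∀ a, p a := by
  rintro ⟨i, j⟩
  fin_cases i
  · change Fin 1 at j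
    fin_cases j
    exact h₀
  · change Fin 2 at j
    fin_cases j
    · exact h₁
    · exact h₂

theorem forall_sigma_twoOne {p : (i : Fin 2) × Fin ((![2, 1] : Fin 2 → ℕ) i) → Prop}
    (h₀ : p ⟨0, (0 : Fin 2)⟩) (h₁ : p ⟨0, (1 : Fin 2)⟩) (h₂ : p ⟨1, (0 : Fin 1)⟩) : ∀ a, p a := by
  rintro ⟨i, j⟩
  fin_cases i
  · change Fin 2 at j
    fin_cases j
    · exact h₀
    · exact h₁
  · change Fin 1 at j
    fin_cases j
    exact h₂

/-- `finSigmaFinEquiv` lists the blocks one after the other; the cast reconciles the sum of the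
block lengths with `3`. -/
theorem blocksOneTwo_join (f : ((i : Fin 2) × Fin ((![1, 2] : Fin 2 → ℕ) i)) → T) :
    (fun a => f (finSigmaFinEquiv.symm a)) = fun a => (![f ⟨0, (0 : Fin 1)⟩, f ⟨1, (0 : Fin 2)⟩,
      f ⟨1, (1 : Fin 2)⟩] : Fin 3 → T) (Fin.cast sum_oneTwo a) := by
  funext a
  obtain ⟨b, rfl⟩ := finSigmaFinEquiv.surjective a
  rw [Equiv.symm_apply_apply]
  revert b
  refine forall_sigma_oneTwo ?_ ?_ ?_ <;> rfl

theorem blocksTwoOne_join (f : ((i : Fin 2) × Fin ((![2, 1] : Fin 2 → ℕ) i)) → T) :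
    (fun a => f (finSigmaFinEquiv.symm a)) = fun a => (![f ⟨0, (0 : Fin 2)⟩, f ⟨0, (1 : Fin 2)⟩,
      f ⟨1, (0 : Fin 1)⟩] : Fin 3 → T) (Fin.cast sum_twoOne a) := by
  funext a
  obtain ⟨b, rfl⟩ := finSigmaFinEquiv.surjective a
  rw [Equiv.symm_apply_apply]
  revert b
  refine forall_sigma_twoOne ?_ ?_ ?_ <;> rfl

end Blocks

theorem triple_mem_configSpace {x y z : ℂ} (hxy : x ≠ y) (hxz : x ≠ z) (hyz : y ≠ z) :
    (![x, y, z] : Fin 3 → ℂ) ∈ configSpace 3 := by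
  intro i j hij
  fin_cases i <;> fin_cases j <;> simp_all [eq_comm]

theorem singleton_mem_configSpace (x : ℂ) : (![x] : Fin 1 → ℂ) ∈ configSpace 1 :=
  Function.injective_of_subsingleton _

theorem FieldData.corr_cast {F : Type*} [AddCommGroup F] [Module ℂ F] (X : FieldData F) {m n : ℕ}
    (h : m = n) (u : Fin n → F) (z : Fin n → ℂ) :
    X.corr m (fun a => u (Fin.cast h a)) (fun a => z (Fin.cast h a)) = X.corr n u z := by
  subst h
  rfl

namespace BigradedFullFieldAlgebra

variable {F : Type*} [AddCommGroup F] [Module ℂ F] (X : BigradedFullFieldAlgebra F)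

theorem comp_corr_one (p : ℝ × ℝ) (u : F) : X.comp p (X.corr 1 ![u] ![0]) = X.P p u := by
  rw [BigradedFieldData.comp, X.corr_one]
  refine graded_induction X.internal (p := fun u => X.P p (gradedProj X.gr X.internal _ u) = X.P p u)
    (fun r u hu => ?_) (fun x y hx hy => ?_) ?_ u
  · by_cases hr : p.1 + p.2 = r
    · rw [hr, gradedProj_of_mem _ hu]
    · rw [gradedProj_of_mem_ne _ hu hr, map_zero, X.P_of_mem_gr_ne hu hr]
  · simp only [map_add, hx, hy]
  · simp only [map_zero]

theorem comp_vertexOp_zero_left (s : ℝ × ℝ) {z : ℂ} (hz : z ≠ 0) (v : F) :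
    X.comp s (X.vertexOp 0 z v) = 0 := by
  rw [← X.compVertexOp_apply s hz, map_zero, LinearMap.zero_apply]

theorem comp_vertexOp_zero_right (s : ℝ × ℝ) {z : ℂ} (hz : z ≠ 0) (u : F) :
    X.comp s (X.vertexOp u z 0) = 0 := by
  rw [← X.compVertexOp_apply s hz, map_zero]

/-- Composability of vertex operators. -/
theorem hasSum_comp_vertexOp {p : ℝ × ℝ} {u : F} (hu : u ∈ X.bigr p) (v w : F) {z y : ℂ}
    (hy : y ≠ 0) (hzy : ‖y‖ < ‖z‖) (s : ℝ × ℝ) (φ : Module.Dual ℂ F) :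
    HasSum (fun t : ℝ × ℝ => φ (X.comp s (X.vertexOp u z (X.comp t (X.vertexOp v y w)))))
      (φ (X.comp s (X.corr 3 ![u, v, w] ![z, y, 0]))) := by
  have hz : z ≠ 0 := norm_pos_iff.1 (lt_of_le_of_lt (norm_nonneg _) hzy)
  -- The blocks `{0}` and `{y, 0}` are placed around `z` and `0`, so the domain of convergence is
  -- `‖y‖ < ‖z‖`.
  have h := X.bi_convergence 2 (by norm_num) ![1, 2] (by intro i; fin_cases i <;> simp)
    (blocksOneTwo u v w) (blocksOneTwo 0 y 0) ![z, 0]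
    (by
      intro i
      fin_cases i
      · exact singleton_mem_configSpace 0
      · exact BigradedFieldData.pair_mem_configSpace hy)
    (BigradedFieldData.pair_mem_configSpace hz)
    (by
      intro i j hij a b
      fin_cases i <;> fin_cases j
      · exact absurd rfl hij
      · change Fin 1 at a
        change Fin 2 at b
        fin_cases a
        fin_cases b <;> simpa [blocksOneTwo] using by assumption
      · change Fin 2 at a
        change Fin 1 at b
        fin_cases b
        fin_cases a <;> simpa [blocksOneTwo] using by assumption
      · exact absurd rfl hij) s φ
  rw [blocksOneTwo_join (fun a => blocksOneTwo u v w a.1 a.2),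
    blocksOneTwo_join (fun a => blocksOneTwo 0 y 0 a.1 a.2 + (![z, 0] : Fin 2 → ℂ) a.1),
    FieldData.corr_cast] at h
  have e : (![blocksOneTwo 0 y 0 0 (0 : Fin 1) + (![z, 0] : Fin 2 → ℂ) 0,
      blocksOneTwo 0 y 0 1 (0 : Fin 2) + (![z, 0] : Fin 2 → ℂ) 1,
      blocksOneTwo 0 y 0 1 (1 : Fin 2) + (![z, 0] : Fin 2 → ℂ) 1] : Fin 3 → ℂ) = ![z, y, 0] := by
    ext i
    fin_cases i <;> simp [blocksOneTwo]
  have h' : HasSum (fun r : Fin 2 → ℝ × ℝ => φ (X.comp s (X.vertexOp (X.P (r 0) u) z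
      (X.comp (r 1) (X.vertexOp v y w))))) (φ (X.comp s (X.corr 3 ![u, v, w] ![z, y, 0]))) := by
    rw [← e]
    refine h.of_forall_eq fun r => ?_
    rw [FieldData.vertexOp, ← X.comp_corr_one]
    congr 4
    ext i
    fin_cases i <;> rfl
  -- The one-point block contributes the projections of `u`, of which only that of weight `p` is
  -- nonzero; the double sum becomes a single one.
  have hinj : Function.Injective fun t : ℝ × ℝ => (![p, t] : Fin 2 → ℝ × ℝ) := fun t t' ht =>
    congrFun ht 1
  refine ((hinj.hasSum_iff ?_).2 h').of_forall_eq fun t => ?_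
  · intro r hr
    rw [X.P_of_mem_ne hu, X.comp_vertexOp_zero_left s hz, map_zero]
    intro h0
    refine hr ⟨r 1, ?_⟩
    ext i : 1
    fin_cases i
    · exact h0.symm
    · rfl
  · simp [X.P_of_mem hu]

/-- Associativity of vertex operators. -/
theorem hasSum_vertexOp_comp {p : ℝ × ℝ} (u v : F) {w : F} (hw : w ∈ X.bigr p) {z : ℂ}
    (hz1 : z ≠ 1) (hz : ‖z - 1‖ < 1) (s : ℝ × ℝ) (φ : Module.Dual ℂ F) :
    HasSum (fun t : ℝ × ℝ => φ (X.comp s (X.vertexOp (X.comp t (X.vertexOp u (z - 1) v)) 1 w)))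
      (φ (X.comp s (X.corr 3 ![u, v, w] ![z, 1, 0]))) := by
  -- The blocks `{z - 1, 0}` and `{0}` are placed around `1` and `0`, so the domain of convergence
  -- is `‖z - 1‖ < 1`.
  have h := X.bi_convergence 2 (by norm_num) ![2, 1] (by intro i; fin_cases i <;> simp)
    (blocksTwoOne u v w) (blocksTwoOne (z - 1) 0 0) ![1, 0]
    (by
      intro i
      fin_cases i
      · exact BigradedFieldData.pair_mem_configSpace (sub_ne_zero.2 hz1)
      · exact singleton_mem_configSpace 0)
    (BigradedFieldData.pair_mem_configSpace one_ne_zero)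
    (by
      intro i j hij a b
      fin_cases i <;> fin_cases j
      · exact absurd rfl hij
      · change Fin 2 at a
        change Fin 1 at b
        fin_cases b
        fin_cases a <;> simp [blocksTwoOne, hz]
      · change Fin 1 at a
        change Fin 2 at b
        fin_cases a
        fin_cases b <;> simp [blocksTwoOne, hz]
      · exact absurd rfl hij) s φ
  rw [blocksTwoOne_join (fun a => blocksTwoOne u v w a.1 a.2),
    blocksTwoOne_join (fun a => blocksTwoOne (z - 1) 0 0 a.1 a.2 + (![1, 0] : Fin 2 → ℂ) a.1),
    FieldData.corr_cast] at h
  have e : (![blocksTwoOne (z - 1) 0 0 0 (0 : Fin 2) + (![1, 0] : Fin 2 → ℂ) 0,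
      blocksTwoOne (z - 1) 0 0 0 (1 : Fin 2) + (![1, 0] : Fin 2 → ℂ) 0,
      blocksTwoOne (z - 1) 0 0 1 (0 : Fin 1) + (![1, 0] : Fin 2 → ℂ) 1] : Fin 3 → ℂ) =
      ![z, 1, 0] := by
    ext i
    fin_cases i <;> simp [blocksTwoOne]
  have h' : HasSum (fun r : Fin 2 → ℝ × ℝ => φ (X.comp s (X.vertexOp
      (X.comp (r 0) (X.vertexOp u (z - 1) v)) 1 (X.P (r 1) w))))
      (φ (X.comp s (X.corr 3 ![u, v, w] ![z, 1, 0]))) := by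
    rw [← e]
    refine h.of_forall_eq fun r => ?_
    rw [FieldData.vertexOp, ← X.comp_corr_one]
    congr 4
    ext i
    fin_cases i <;> rfl
  have hinj : Function.Injective fun t : ℝ × ℝ => (![t, p] : Fin 2 → ℝ × ℝ) := fun t t' ht =>
    congrFun ht 0
  refine ((hinj.hasSum_iff ?_).2 h').of_forall_eq fun t => ?_
  · intro r hr
    rw [X.P_of_mem_ne hw, X.comp_vertexOp_zero_right s one_ne_zero, map_zero]
    intro h0
    refine hr ⟨r 0, ?_⟩
    ext i : 1
    fin_cases i
    · rfl
    · exact h0.symm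
  · simp [X.P_of_mem hw]

theorem corr_three_swap (u v w : F) {x y : ℂ} (hxy : x ≠ y) (hx : x ≠ 0) (hy : y ≠ 0) :
    X.corr 3 ![u, v, w] ![x, y, 0] = X.corr 3 ![v, u, w] ![y, x, 0] := by
  rw [X.permutation 3 (by norm_num) (Equiv.swap 0 1) _ _ (triple_mem_configSpace hxy hx hy)]
  congr 1
  · ext i; fin_cases i <;> rfl
  · ext i; fin_cases i <;> rfl

theorem contDiffOn_corr_three (s : ℝ × ℝ) (u v w : F) (φ : Module.Dual ℂ F) :
    ContDiffOn ℝ 1 (fun z => φ (X.comp s (X.corr 3 ![u, v, w] ![z, 1, 0]))) {z | z ≠ 0 ∧ z ≠ 1} := by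
  have h := X.smooth 3 (by norm_num) ![u, v, w] (s.1 + s.2) (φ ∘ₗ X.P s)
  have hg : ContDiff ℝ ∞ (fun z : ℂ => (![z, 1, 0] : Fin 3 → ℂ)) := by
    rw [contDiff_pi]
    intro i
    fin_cases i
    · exact contDiff_id
    · exact contDiff_const
    · exact contDiff_const
  exact (h.comp hg.contDiffOn fun z hz => triple_mem_configSpace hz.2 hz.1 one_ne_zero).of_le
    (mod_cast le_top)

end BigradedFullFieldAlgebra

section Dual

variable {M M' : Type*} [AddCommGroup M] [Module ℂ M] [AddCommGroup M'] [Module ℂ M']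

theorem clearPoles_comp_linearMap (φ : M →ₗ[ℂ] M') (N : ℕ) (c : ℤ → M) (n : ℤ) :
    clearPoles N (fun n => φ (c n)) n = φ (clearPoles N c n) := by
  induction N generalizing n with
  | zero => rfl
  | succ N ih =>
    simp only [clearPoles, pow_succ', Module.End.mul_apply, clearPole_apply] at ih ⊢
    rw [ih, ih, map_sub]

theorem clearPolesOne_comp_linearMap (φ : M →ₗ[ℂ] M') (N : ℕ) (c : ℤ → M) (n : ℤ) :
    clearPolesOne N (fun n => φ (c n)) n = φ (clearPolesOne N c n) := by
  induction N generalizing n with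
  | zero => rfl
  | succ N ih =>
    simp only [clearPolesOne, pow_succ', Module.End.mul_apply, clearPoleOne_apply] at ih ⊢
    rw [ih, ih, map_add]

theorem IsRationalTriple.of_dual {N : ℕ} {c d e : ℤ → M}
    (h : ∀ φ : Module.Dual ℂ M, IsRationalTriple N (fun n => φ (c n)) (fun n => φ (d n))
      (fun n => φ (e n))) : IsRationalTriple N c d e where
  left_trunc n hn := (Module.forall_dual_apply_eq_zero_iff ℂ _).1 fun φ => (h φ).left_trunc n hn
  right_trunc n hn := (Module.forall_dual_apply_eq_zero_iff ℂ _).1 fun φ => (h φ).right_trunc n hn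
  iter_trunc n hn := (Module.forall_dual_apply_eq_zero_iff ℂ _).1 fun φ => (h φ).iter_trunc n hn
  comm := by
    funext n
    rw [← sub_eq_zero, ← Module.forall_dual_apply_eq_zero_iff ℂ]
    intro φ
    rw [map_sub, ← clearPoles_comp_linearMap, ← clearPoles_comp_linearMap, (h φ).comm, sub_self]
  assoc m := by
    rw [← sub_eq_zero, ← Module.forall_dual_apply_eq_zero_iff ℂ]
    intro φ
    rw [map_sub, ← clearPolesOne_comp_linearMap, (h φ).assoc m, map_sum, sub_eq_zero]
    refine Finset.sum_congr rfl fun k _ => ?_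
    rw [map_smul, clearPoles_comp_linearMap]

end Dual

/-! ### Rationality of chiral and antichiral three-point functions -/

namespace BigradedFullFieldAlgebra

variable {F : Type*} [AddCommGroup F] [Module ℂ F] (X : BigradedFullFieldAlgebra F)

/-- The field of `u` is the series of the `χ(z)⁻ⁿ⁻¹ op n`, where `op n` shifts the weights by
`ι n`. -/
structure HasModes (u : F) (op : ℤ → F →ₗ[ℂ] F) (ι : ℤ → ℝ × ℝ) (χ : ℂ →+* ℂ) : Prop where
  homogeneous : ∃ p, u ∈ X.bigr p
  injective : Function.Injective ι
  comp_eq : ∀ p, ∀ v ∈ X.bigr p, ∀ z : ℂ, z ≠ 0 → ∀ n,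
    X.comp (p + ι n) (X.vertexOp u z v) = χ z ^ (-n - 1) • op n v
  comp_eq_zero : ∀ p, ∀ v ∈ X.bigr p, ∀ s : ℝ × ℝ, (∀ n, s ≠ p + ι n) → ∀ z : ℂ, z ≠ 0 →
    X.comp s (X.vertexOp u z v) = 0

variable {X}

theorem HasModes.mem {u : F} {op : ℤ → F →ₗ[ℂ] F} {ι : ℤ → ℝ × ℝ} {χ : ℂ →+* ℂ}
    (hu : X.HasModes u op ι χ) {p : ℝ × ℝ} {v : F} (hv : v ∈ X.bigr p) (n : ℤ) :
    op n v ∈ X.bigr (p + ι n) := by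
  have h := hu.comp_eq p v hv 1 one_ne_zero n
  rw [map_one, one_zpow, one_smul] at h
  rw [← h]
  exact X.P_mem _ _

/-- The function is the three-point function with `u` at `χ z`, `w₁` at `1` and `w₂` at `0`. As `χ`
is the identity or conjugation, the expansions are in powers of `z` for both chiralities, and a
single argument covers them. -/
theorem HasModes.isRationalTriple {u : F} {op : ℤ → F →ₗ[ℂ] F} {ι : ℤ → ℝ × ℝ} {χ : ℂ →+* ℂ}
    (hu : X.HasModes u op ι χ) (hχ : ∀ z, χ (χ z) = z) (hχn : ∀ z, ‖χ z‖ = ‖z‖)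
    (hχd : ContDiff ℝ 1 χ) {α β s : ℝ × ℝ} {w₁ w₂ : F} (hw₁ : w₁ ∈ X.bigr α) (hw₂ : w₂ ∈ X.bigr β)
    {N : ℕ} (hs : ∀ n < -(N : ℤ), X.bigr (s - ι n) = ⊥) (hα : ∀ n ≥ (N : ℤ), X.bigr (α + ι n) = ⊥)
    (hβ : ∀ n ≥ (N : ℤ), X.bigr (β + ι n) = ⊥) :
    IsRationalTriple N (fun n => op n (X.atOne (s - ι n) w₁ w₂)) (fun n => X.atOne s w₁ (op n w₂))
      (fun n => X.atOne s (op n w₁) w₂) := by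
  obtain ⟨p, hup⟩ := hu.homogeneous
  have hχ0 : ∀ z, z ≠ 0 → χ z ≠ 0 := fun z hz => (map_ne_zero χ).2 hz
  have hχ1 : ∀ z, z ≠ 1 → χ z ≠ 1 := fun z hz h => hz (χ.injective (by rw [h, map_one]))
  have hbot : ∀ {q : ℝ × ℝ} {x : F}, X.bigr q = ⊥ → x ∈ X.bigr q → x = 0 := fun h hx => by
    rwa [h, Submodule.mem_bot] at hx
  refine .of_dual fun φ => isRationalTriple_of_hasSum
    (f := fun z => φ (X.comp s (X.corr 3 ![u, w₁, w₂] ![χ z, 1, 0]))) ?_ ?_ ?_ ?_ ?_ ?_ ?_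
  · exact (X.contDiffOn_corr_three s u w₁ w₂ φ).comp hχd.contDiffOn
      fun z hz => ⟨hχ0 z hz.1, hχ1 z hz.2⟩
  · intro n hn
    rw [hbot (hs n hn) (X.atOne_mem _ _ _), map_zero, map_zero]
  · intro n hn
    rw [hbot (hβ n hn) (hu.mem hw₂ n), map_zero, map_zero]
  · intro n hn
    rw [hbot (hα n hn) (hu.mem hw₁ n), map_zero, LinearMap.zero_apply, map_zero]
  · intro z hz
    have hz0 : χ z ≠ 0 := hχ0 z (norm_pos_iff.1 (by linarith))
    have h := X.hasSum_comp_vertexOp hup w₁ w₂ (z := χ z) one_ne_zero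
      (by rw [hχn, norm_one]; exact hz) s φ
    have hinj : Function.Injective fun n => s - ι n := fun n m hnm =>
      hu.injective (sub_right_injective hnm)
    refine ((hinj.hasSum_iff ?_).2 h).of_forall_eq fun n => ?_
    · intro t ht
      have := hu.comp_eq_zero t _ (X.atOne_mem t w₁ w₂) s
        (fun n hn => ht ⟨n, by simp only [hn, add_sub_cancel_right]⟩) (χ z) hz0
      rw [← X.atOne_apply, this, map_zero]
    · have := hu.comp_eq (s - ι n) _ (X.atOne_mem _ w₁ w₂) (χ z) hz0 n
      rw [sub_add_cancel, hχ] at this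
      rw [Function.comp_apply, ← X.atOne_apply, this, map_smul, smul_eq_mul, mul_comm]
  · intro z hz0' hz
    have hz0 : χ z ≠ 0 := hχ0 z hz0'
    have hz1 : χ z ≠ 1 := hχ1 z (by rintro rfl; simp at hz)
    have h := X.hasSum_comp_vertexOp hw₁ u w₂ (z := 1) hz0
      (by rw [hχn, norm_one]; exact hz) s φ
    -- For `‖z‖ < 1` the field of `w₁` at `1` must stand to the left; permutation symmetry says that
    -- it is the same correlation function.
    rw [← X.corr_three_swap u w₁ w₂ hz1 hz0 one_ne_zero] at h
    have hinj : Function.Injective fun n => β + ι n := fun n m hnm =>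
      hu.injective (add_right_injective _ hnm)
    refine ((hinj.hasSum_iff ?_).2 h).of_forall_eq fun n => ?_
    · intro t ht
      rw [hu.comp_eq_zero β w₂ hw₂ t (fun n hn => ht ⟨n, hn.symm⟩) (χ z) hz0,
        X.comp_vertexOp_zero_right s one_ne_zero, map_zero]
    · rw [Function.comp_apply, hu.comp_eq β w₂ hw₂ (χ z) hz0 n, hχ, ← X.atOne_apply, map_smul,
        map_smul, smul_eq_mul, mul_comm]
  · intro z hz1' hz
    have hz1 : χ z ≠ 1 := hχ1 z hz1'
    have h := X.hasSum_vertexOp_comp u w₁ hw₂ hz1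
      (by rw [← map_one χ, ← map_sub, hχn]; exact hz) s φ
    have hinj : Function.Injective fun n => α + ι n := fun n m hnm =>
      hu.injective (add_right_injective _ hnm)
    refine ((hinj.hasSum_iff ?_).2 h).of_forall_eq fun n => ?_
    · intro t ht
      rw [hu.comp_eq_zero α w₁ hw₁ t (fun n hn => ht ⟨n, hn.symm⟩) _ (sub_ne_zero.2 hz1),
        X.comp_vertexOp_zero_left s one_ne_zero, map_zero]
    · rw [Function.comp_apply, hu.comp_eq α w₁ hw₁ _ (sub_ne_zero.2 hz1) n, map_sub, map_one, hχ,
        ← X.atOne_apply, map_smul, LinearMap.smul_apply, map_smul, smul_eq_mul, mul_comm]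

end BigradedFullFieldAlgebra

namespace FullFieldAlgebraOver

variable {A B F : Type*} [AddCommGroup A] [Module ℂ A] [AddCommGroup B] [Module ℂ B]
  [AddCommGroup F] [Module ℂ F] {VL : VertexOperatorAlgebra A} {VR : VertexOperatorAlgebra B}
  (X : FullFieldAlgebraOver VL VR F) {a : A} {b : B} {h : ℤ}

theorem hasModes_left (ha : a ∈ VL.gr h) :
    X.HasModes (X.ρ (a ⊗ₜ VR.vac)) (fun n => X.leftMode n a)
      (fun n => ((h : ℝ) - n - 1, 0)) (RingHom.id ℂ) where
  homogeneous := ⟨_, X.rho_mem ha VR.vac_mem⟩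
  injective m n hmn := by
    have := congrArg Prod.fst hmn
    simp only [sub_left_inj, sub_right_inj] at this
    exact_mod_cast this
  comp_eq p v hv z hz n := X.comp_vertexOp_left ha hv (by
    ext <;> simp only [Prod.fst_add, Prod.snd_add] <;> ring) hz
  comp_eq_zero p v hv s hs z hz := X.comp_vertexOp_left_ne ha hv (fun n hn => hs n (by
    rw [hn]; ext <;> simp only [Prod.fst_add, Prod.snd_add] <;> ring)) hz

theorem hasModes_right (hb : b ∈ VR.gr h) :
    X.HasModes (X.ρ (VL.vac ⊗ₜ b)) (fun n => X.rightMode n b)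
      (fun n => (0, (h : ℝ) - n - 1)) (starRingEnd ℂ) where
  homogeneous := ⟨_, X.rho_mem VL.vac_mem hb⟩
  injective m n hmn := by
    have := congrArg Prod.snd hmn
    simp only [sub_left_inj, sub_right_inj] at this
    exact_mod_cast this
  comp_eq p v hv z hz n := X.comp_vertexOp_right hb hv (by
    ext <;> simp only [Prod.fst_add, Prod.snd_add] <;> ring) hz
  comp_eq_zero p v hv s hs z hz := X.comp_vertexOp_right_ne hb hv (fun n hn => hs n (by
    rw [hn]; ext <;> simp only [Prod.fst_add, Prod.snd_add] <;> ring)) hz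

variable {α β s : ℝ × ℝ} {w₁ w₂ : F} {M : ℝ} {N : ℕ}

theorem isRationalTriple_left (hM : ∀ m n : ℝ, (n < M ∨ m < M) → X.bigr (m, n) = ⊥)
    (ha : a ∈ VL.gr h) (hw₁ : w₁ ∈ X.bigr α) (hw₂ : w₂ ∈ X.bigr β) (hs : s.1 - h + 1 - M ≤ N)
    (hα : α.1 + h - M ≤ N) (hβ : β.1 + h - M ≤ N) :
    IsRationalTriple N (fun n => X.leftMode n a (X.atOne (s - ((h : ℝ) - n - 1, 0)) w₁ w₂))
      (fun n => X.atOne s w₁ (X.leftMode n a w₂)) (fun n => X.atOne s (X.leftMode n a w₁) w₂) := by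
  have hge : ∀ {n : ℤ}, n ≥ N → (N : ℝ) ≤ n := fun hn => by exact_mod_cast hn
  refine (X.hasModes_left ha).isRationalTriple (fun _ => rfl) (fun _ => rfl) contDiff_id hw₁ hw₂
    (fun n hn => ?_) (fun n hn => ?_) (fun n hn => ?_)
  · have : (n : ℝ) < -N := by exact_mod_cast hn
    refine X.bigr_eq_bot hM (.inl ?_)
    simp only [Prod.fst_sub]
    linarith
  · have := hge hn
    refine X.bigr_eq_bot hM (.inl ?_)
    simp only [Prod.fst_add]
    linarith
  · have := hge hn
    refine X.bigr_eq_bot hM (.inl ?_)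
    simp only [Prod.fst_add]
    linarith

theorem isRationalTriple_right (hM : ∀ m n : ℝ, (n < M ∨ m < M) → X.bigr (m, n) = ⊥)
    (hb : b ∈ VR.gr h) (hw₁ : w₁ ∈ X.bigr α) (hw₂ : w₂ ∈ X.bigr β) (hs : s.2 - h + 1 - M ≤ N)
    (hα : α.2 + h - M ≤ N) (hβ : β.2 + h - M ≤ N) :
    IsRationalTriple N (fun n => X.rightMode n b (X.atOne (s - (0, (h : ℝ) - n - 1)) w₁ w₂))
      (fun n => X.atOne s w₁ (X.rightMode n b w₂)) (fun n => X.atOne s (X.rightMode n b w₁) w₂) := by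
  have hge : ∀ {n : ℤ}, n ≥ N → (N : ℝ) ≤ n := fun hn => by exact_mod_cast hn
  refine (X.hasModes_right hb).isRationalTriple Complex.conj_conj (fun _ => RCLike.norm_conj _)
    Complex.conjCLE.contDiff hw₁ hw₂ (fun n hn => ?_) (fun n hn => ?_) (fun n hn => ?_)
  · have : (n : ℝ) < -N := by exact_mod_cast hn
    refine X.bigr_eq_bot hM (.inr ?_)
    simp only [Prod.snd_sub]
    linarith
  · have := hge hn
    refine X.bigr_eq_bot hM (.inr ?_)
    simp only [Prod.snd_add]
    linarith
  · have := hge hn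
    refine X.bigr_eq_bot hM (.inr ?_)
    simp only [Prod.snd_add]
    linarith

end FullFieldAlgebraOver

section Laurent

variable {M M' : Type*} [AddCommGroup M] [Module ℂ M] [AddCommGroup M'] [Module ℂ M']

theorem jacobiIterate_zero (e : ℤ → M) (r : ℤ) : jacobiIterate e 0 r = e r := by
  rw [jacobiIterate, finsum_eq_single _ 0]
  · simp
  · intro i hi
    rw [Ring.choose_zero_pos _ (Nat.pos_of_ne_zero hi)]
    simp

theorem jacobiLeft_zero (c : ℤ → M) (p : ℤ) : jacobiLeft c p 0 = c p := by
  rw [jacobiLeft, finsum_eq_single _ 0]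
  · simp
  · intro i hi
    rw [Ring.choose_zero_pos _ (Nat.pos_of_ne_zero hi)]
    simp

theorem jacobiRight_zero (d : ℤ → M) (p : ℤ) : jacobiRight d p 0 = d p := by
  rw [jacobiRight, finsum_eq_single _ 0]
  · simp
  · intro i hi
    rw [Ring.choose_zero_pos _ (Nat.pos_of_ne_zero hi)]
    simp

theorem neg_one_pow_mul_choose_neg_one (i : ℕ) :
    (-1 : ℂ) ^ i * ((Ring.choose (-1 : ℤ) i : ℤ) : ℂ) = 1 := by
  have h : Ring.choose (-1 : ℤ) i = (-1) ^ i := by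
    have := Ring.choose_neg (1 : ℤ) i
    rw [this, add_sub_cancel_left, Ring.choose_natCast, Nat.choose_self, Units.smul_def,
      Int.coe_negOnePow_natCast]
    simp
  rw [h]
  push_cast
  rw [← mul_pow]
  simp

theorem IsRationalTriple.map {N : ℕ} {c d e : ℤ → M} (h : IsRationalTriple N c d e)
    (f : M →ₗ[ℂ] M') :
    IsRationalTriple N (fun n => f (c n)) (fun n => f (d n)) (fun n => f (e n)) where
  left_trunc n hn := by rw [h.left_trunc n hn, map_zero]
  right_trunc n hn := by rw [h.right_trunc n hn, map_zero]
  iter_trunc n hn := by rw [h.iter_trunc n hn, map_zero]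
  comm := by
    funext n
    rw [clearPoles_comp_linearMap, clearPoles_comp_linearMap, h.comm]
  assoc m := by
    rw [clearPolesOne_comp_linearMap, h.assoc m, map_sum]
    refine Finset.sum_congr rfl fun k _ => ?_
    rw [map_smul, clearPoles_comp_linearMap]

end Laurent

/-! ### Factorisation of the field of `a ⊗ b` -/

namespace FullFieldAlgebraOver

variable {A B F : Type*} [AddCommGroup A] [Module ℂ A] [AddCommGroup B] [Module ℂ B]
  [AddCommGroup F] [Module ℂ F] {VL : VertexOperatorAlgebra A} {VR : VertexOperatorAlgebra B}
  (X : FullFieldAlgebraOver VL VR F) {a : A} {b : B} {h h' : ℤ} {β s : ℝ × ℝ} {w : F}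

theorem leftMode_eq_zero {M : ℝ} (hM : ∀ m n : ℝ, (n < M ∨ m < M) → X.bigr (m, n) = ⊥)
    (ha : a ∈ VL.gr h) (hw : w ∈ X.bigr β) {n : ℤ} (hn : β.1 + h - M ≤ n) :
    X.leftMode n a w = 0 := by
  have := X.leftMode_mem ha hw n
  rwa [X.bigr_eq_bot hM (.inl (by simp only; linarith)), Submodule.mem_bot] at this

/-- The three expansions of the correlation function of `a ⊗ 𝟏`, `𝟏 ⊗ b` and `w`. -/
theorem exists_isRationalTriple_left_right (ha : a ∈ VL.gr h) (hb : b ∈ VR.gr h')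
    (hw : w ∈ X.bigr β) (s : ℝ × ℝ) : ∃ N : ℕ, IsRationalTriple N
      (fun n => X.leftMode n a (X.atOne (s - ((h : ℝ) - n - 1, 0)) (X.ρ (VL.vac ⊗ₜ b)) w))
      (fun n => X.atOne s (X.ρ (VL.vac ⊗ₜ b)) (X.leftMode n a w))
      (fun n => X.atOne s (X.leftMode n a (X.ρ (VL.vac ⊗ₜ b))) w) := by
  obtain ⟨M, hM⟩ := X.restricted.lower_truncated
  obtain ⟨N₁, h₁⟩ := exists_nat_ge (s.1 - h + 1 - M)
  obtain ⟨N₂, h₂⟩ := exists_nat_ge ((0 : ℝ) + h - M)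
  obtain ⟨N₃, h₃⟩ := exists_nat_ge (β.1 + h - M)
  refine ⟨N₁ + N₂ + N₃, X.isRationalTriple_left hM ha (X.rho_mem VL.vac_mem hb) hw ?_ ?_ ?_⟩ <;>
    push_cast
  · linarith [Nat.cast_nonneg (α := ℝ) N₂, Nat.cast_nonneg (α := ℝ) N₃]
  · linarith [Nat.cast_nonneg (α := ℝ) N₁, Nat.cast_nonneg (α := ℝ) N₃]
  · linarith [Nat.cast_nonneg (α := ℝ) N₁, Nat.cast_nonneg (α := ℝ) N₂]

/-- The Jacobi identity at `r = 0` is the commutator formula, and its iterates vanish because `a_i 𝟏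
= 0` for `i ≥ 0`. -/
theorem leftMode_atOne (ha : a ∈ VL.gr h) (hb : b ∈ VR.gr h') (hw : w ∈ X.bigr β) (s : ℝ × ℝ)
    (k : ℤ) :
    X.leftMode k a (X.atOne (s - ((h : ℝ) - k - 1, 0)) (X.ρ (VL.vac ⊗ₜ b)) w) =
      X.atOne s (X.ρ (VL.vac ⊗ₜ b)) (X.leftMode k a w) := by
  obtain ⟨N, hN⟩ := X.exists_isRationalTriple_left_right ha hb hw s
  have hj := hN.jacobiDefect_eq_zero k 0
  rw [jacobiDefect, jacobiLeft_zero, jacobiRight_zero, zpow_zero, one_smul] at hj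
  have he : jacobiIterate (fun n => X.atOne s (X.leftMode n a (X.ρ (VL.vac ⊗ₜ b))) w) k 0 = 0 := by
    refine (finsum_congr (g := fun _ : ℕ => (0 : F)) fun i => ?_).trans finsum_zero
    beta_reduce
    rw [X.leftMode_rho, VL.mode_vac_right (by omega)]
    simp
  rw [he, zero_sub, neg_eq_zero, sub_eq_zero] at hj
  exact hj

theorem leftMode_rightMode (k l : ℤ) (a : A) (b : B) (w : F) :
    X.leftMode k a (X.rightMode l b w) = X.rightMode l b (X.leftMode k a w) := by
  induction w using X.bigr_induction with
  | h0 => simp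
  | hadd x y hx hy => simp only [map_add, hx, hy]
  | h β w hw =>
  induction a using graded_induction VL.internal with
  | h0 => simp [leftMode]
  | hadd x y hx hy =>
    simp only [leftMode, map_add, TensorProduct.add_tmul, LinearMap.add_apply] at hx hy ⊢
    rw [hx, hy]
  | h h a ha =>
  induction b using graded_induction VR.internal with
  | h0 => simp [rightMode]
  | hadd x y hx hy =>
    simp only [rightMode, map_add, TensorProduct.tmul_add, LinearMap.add_apply] at hx hy ⊢
    rw [hx, hy]
  | h h' b hb =>
  have := X.leftMode_atOne ha hb hw (β.1 + h - k - 1, β.2 + h' - l - 1) k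
  have e : ((β.1 + h - k - 1, β.2 + h' - l - 1) - ((h : ℝ) - k - 1, 0) : ℝ × ℝ) =
      (β.1, β.2 + h' - l - 1) := by
    ext <;> simp only [Prod.fst_sub, Prod.snd_sub] <;> ring
  rw [← X.atOne_right hb (X.leftMode_mem ha hw k) l, ← this, ← X.atOne_right hb hw l, e]

/-- The Jacobi identity at `p = 0`, `r = -1`: the iterate is `(a_{-1} 𝟏) ⊗ b = a ⊗ b`, and the
products form a normally ordered product, in which the modes of `a` have been moved to the right by
commutation. -/
theorem atOne_tmul (ha : a ∈ VL.gr h) (hb : b ∈ VR.gr h') (hw : w ∈ X.bigr β) (s : ℝ × ℝ) :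
    X.atOne s (X.ρ (a ⊗ₜ b)) w =
      ∑ᶠ i : ℕ, (X.atOne s (X.ρ (VL.vac ⊗ₜ b)) (X.leftMode (-1 - i) a w) +
        X.atOne s (X.ρ (VL.vac ⊗ₜ b)) (X.leftMode i a w)) := by
  obtain ⟨N, hN⟩ := X.exists_isRationalTriple_left_right ha hb hw s
  have hj := hN.jacobiDefect_eq_zero 0 (-1)
  rw [jacobiDefect, jacobiIterate_zero, X.leftMode_rho, (VL.creation a).1, sub_eq_zero] at hj
  rw [hj, jacobiLeft, jacobiRight]
  simp only [neg_one_pow_mul_choose_neg_one, one_smul, X.leftMode_atOne ha hb hw, zero_add]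
  rw [zpow_neg_one, inv_neg, inv_one, neg_smul, one_smul, sub_neg_eq_add, ← finsum_add_distrib]
  · have ht := hN.left_trunc
    simp only [X.leftMode_atOne ha hb hw] at ht
    refine (Set.finite_lt_nat N).subset fun i hi => ?_
    by_contra hlt
    simp only [Set.mem_ofPred_eq, not_lt] at hlt
    exact hi (ht _ (by omega))
  · refine (Set.finite_lt_nat N).subset fun i hi => ?_
    by_contra hlt
    simp only [Set.mem_ofPred_eq, not_lt] at hlt
    exact hi (hN.right_trunc _ (by omega))

/-- The field of `𝟏 ⊗ b` preserves the left weight, so only the mode `k` of `a` reaches the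
prescribed weight. It stands in the second half of the normally ordered sum if `k ≥ 0`, in the first
half otherwise. -/
theorem atOne_tmul_eq (ha : a ∈ VL.gr h) (hb : b ∈ VR.gr h') (hw : w ∈ X.bigr β) (k l : ℤ) :
    X.atOne (β.1 + h - k - 1, β.2 + h' - l - 1) (X.ρ (a ⊗ₜ b)) w =
      X.leftMode k a (X.rightMode l b w) := by
  have hz : ∀ j : ℤ, j ≠ k → X.atOne (β.1 + h - k - 1, β.2 + h' - l - 1) (X.ρ (VL.vac ⊗ₜ b))
      (X.leftMode j a w) = 0 := fun j hj => by
    refine X.atOne_right_ne (h := h') (X.leftMode_mem ha hw j) fun n hn => hj ?_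
    have := congrArg Prod.fst hn
    simp only at this
    have : (j : ℝ) = k := by linarith
    exact_mod_cast this
  have hk : X.atOne (β.1 + h - k - 1, β.2 + h' - l - 1) (X.ρ (VL.vac ⊗ₜ b))
      (X.leftMode k a w) = X.leftMode k a (X.rightMode l b w) := by
    rw [X.leftMode_rightMode, ← X.atOne_right hb (X.leftMode_mem ha hw k) l]
  rw [X.atOne_tmul ha hb hw]
  rcases le_or_gt 0 k with h0 | h0
  · rw [finsum_eq_single _ k.toNat, hz _ (by omega), zero_add, Int.toNat_of_nonneg h0, hk]
    intro i hi
    rw [hz _ (by omega), hz _ (by omega), add_zero]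
  · rw [finsum_eq_single _ (-1 - k).toNat, hz ((-1 - k).toNat : ℤ) (by omega), add_zero,
      show -1 - ((-1 - k).toNat : ℤ) = k by omega, hk]
    intro i hi
    rw [hz _ (by omega), hz _ (by omega), add_zero]

theorem atOne_tmul_ne (ha : a ∈ VL.gr h) (hb : b ∈ VR.gr h') (hw : w ∈ X.bigr β)
    (hs : ∀ k l : ℤ, s ≠ (β.1 + h - k - 1, β.2 + h' - l - 1)) :
    X.atOne s (X.ρ (a ⊗ₜ b)) w = 0 := by
  have hz : ∀ j : ℤ, X.atOne s (X.ρ (VL.vac ⊗ₜ b)) (X.leftMode j a w) = 0 := fun j =>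
    X.atOne_right_ne (h := h') (X.leftMode_mem ha hw j) fun n hn => hs j n hn
  rw [X.atOne_tmul ha hb hw]
  simp [hz]

/-- This factorisation reduces the whole action of `VL ⊗ VR` on `F` to two commuting families of
modes. -/
theorem bimode_tmul (k l : ℤ) (a : A) (b : B) (w : F) :
    X.bimode k l (X.ρ (a ⊗ₜ b)) w = X.leftMode k a (X.rightMode l b w) := by
  induction w using X.bigr_induction with
  | h0 => simp
  | hadd x y hx hy => simp only [map_add, hx, hy]
  | h β w hw =>
  induction a using graded_induction VL.internal with
  | h0 => simp [leftMode]
  | hadd x y hx hy =>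
    simp only [leftMode, map_add, TensorProduct.add_tmul, LinearMap.add_apply] at hx hy ⊢
    rw [hx, hy]
  | h h a ha =>
  induction b using graded_induction VR.internal with
  | h0 => simp [rightMode]
  | hadd x y hx hy =>
    simp only [rightMode, map_add, TensorProduct.tmul_add, LinearMap.add_apply] at hx hy ⊢
    rw [hx, hy]
  | h h' b hb =>
  rw [X.bimode_of_mem (X.rho_mem ha hb) hw, ← X.atOne_tmul_eq ha hb hw]
  congr 3
  ext <;> simp only [Prod.fst_sub, Prod.snd_sub, Prod.fst_add, Prod.snd_add] <;> ring

theorem bimode_tmul_eq_zero {k l : ℝ} (hkl : ∀ k' l' : ℤ, (k, l) ≠ ((k' : ℝ), (l' : ℝ))) (a : A)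
    (b : B) (w : F) : X.bimode k l (X.ρ (a ⊗ₜ b)) w = 0 := by
  induction w using X.bigr_induction with
  | h0 => simp
  | hadd x y hx hy => simp only [map_add, hx, hy, add_zero]
  | h β w hw =>
  induction a using graded_induction VL.internal with
  | h0 => simp
  | hadd x y hx hy =>
    simp only [map_add, TensorProduct.add_tmul, LinearMap.add_apply, hx, hy, add_zero]
  | h h a ha =>
  induction b using graded_induction VR.internal with
  | h0 => simp
  | hadd x y hx hy =>
    simp only [map_add, TensorProduct.tmul_add, LinearMap.add_apply, hx, hy, add_zero]
  | h h' b hb =>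
  rw [X.bimode_of_mem (X.rho_mem ha hb) hw]
  refine X.atOne_tmul_ne ha hb hw fun k' l' hs => hkl k' l' ?_
  have h1 := congrArg Prod.fst hs
  have h2 := congrArg Prod.snd hs
  simp only [Prod.fst_sub, Prod.snd_sub, Prod.fst_add, Prod.snd_add] at h1 h2
  ext <;> simp only <;> linarith

end FullFieldAlgebraOver

/-! ## The diagonal modes -/

namespace BigradedFieldData

variable {F : Type*} [AddCommGroup F] [Module ℂ F] (X : BigradedFieldData F)

theorem gr_induction {x : ℝ} {p : F → Prop} (h : ∀ α : ℝ × ℝ, α.1 + α.2 = x → ∀ u ∈ X.bigr α, p u)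
    (hadd : ∀ u v, p u → p v → p (u + v)) (h0 : p 0) {u : F} (hu : u ∈ X.gr x) : p u := by
  have := finsum_induction p h0 (fun u v => hadd u v) (f := fun α => X.P α u) fun α => ?_
  · rwa [X.finsum_P] at this
  · by_cases hα : α.1 + α.2 = x
    · exact h α hα _ (X.P_mem α u)
    · simp only [X.P_of_mem_gr_ne hu hα]
      exact h0

end BigradedFieldData

namespace FullFieldAlgebraOver

variable {A B F : Type*} [AddCommGroup A] [Module ℂ A] [AddCommGroup B] [Module ℂ B]
  [AddCommGroup F] [Module ℂ F] {VL : VertexOperatorAlgebra A} {VR : VertexOperatorAlgebra B}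
  (X : FullFieldAlgebraOver VL VR F)

/-- For bihomogeneous `u` and `v` all terms have the same total weight but distinct biweights, so
`finite_weights` applies. -/
theorem diagMode_finite (k : ℝ) (u v : F) :
    (Function.support fun l : ℝ => X.bimode l (k - 1 - l) u v).Finite := by
  induction u using X.bigr_induction with
  | h0 => simp
  | hadd x y hx hy =>
    refine (hx.union hy).subset fun i hi => ?_
    by_contra h
    simp only [Set.mem_union, Function.mem_support, not_or, not_not] at h
    exact hi (by simp [h.1, h.2])
  | h α u hu =>
  induction v using X.bigr_induction with
  | h0 => simp
  | hadd x y hx hy =>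
    refine (hx.union hy).subset fun i hi => ?_
    by_contra h
    simp only [Set.mem_union, Function.mem_support, not_or, not_not] at h
    exact hi (by simp [h.1, h.2])
  | h β v hv =>
  have hinj : Function.Injective fun l : ℝ => α + β - (l + 1, k - 1 - l + 1) := fun l l' h => by
    have := congrArg Prod.fst h
    simp only [Prod.fst_sub] at this
    linarith
  refine ((X.finite_weights X.restricted (α.1 + α.2 + β.1 + β.2 - k - 1)).preimage
    hinj.injOn).subset fun l hl => ⟨?_, fun hbot => hl ?_⟩
  · simp only [Prod.fst_sub, Prod.snd_sub, Prod.fst_add, Prod.snd_add]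
    ring
  · have := X.atOne_mem (α + β - (l + 1, k - 1 - l + 1)) u v
    rw [hbot, Submodule.mem_bot] at this
    beta_reduce
    rw [X.bimode_of_mem hu hv, this]

/-- The coefficient of `x⁻ᵏ⁻¹` in `𝕐_f(·; x, x)`, as a bilinear map. -/
def diagBimode (k : ℝ) : F →ₗ[ℂ] F →ₗ[ℂ] F :=
  LinearMap.mk₂ ℂ (fun u v => X.diagMode k u v)
    (fun u u' v => by
      simp only [BigradedFieldData.diagMode, ← X.bimode_apply]
      rw [← finsum_add_distrib (X.diagMode_finite k u v) (X.diagMode_finite k u' v)]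
      simp)
    (fun c u v => by
      simp only [BigradedFieldData.diagMode, ← X.bimode_apply]
      rw [smul_finsum' c (X.diagMode_finite k u v)]
      simp)
    (fun u v v' => by
      simp only [BigradedFieldData.diagMode, ← X.bimode_apply]
      rw [← finsum_add_distrib (X.diagMode_finite k u v) (X.diagMode_finite k u v')]
      simp)
    (fun c u v => by
      simp only [BigradedFieldData.diagMode, ← X.bimode_apply]
      rw [smul_finsum' c (X.diagMode_finite k u v)]
      simp)

theorem diagBimode_apply (k : ℝ) (u v : F) : X.diagBimode k u v = X.diagMode k u v := rfl

theorem diagBimode_eq_finsum (k : ℝ) (u v : F) :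
    X.diagBimode k u v = ∑ᶠ l : ℝ, X.bimode l (k - 1 - l) u v := rfl

/-- A component of `𝕐(u; z, z̄)v` enters exactly one diagonal mode, which is fixed by total weight;
its coefficient is the component at `z = 1`. -/
theorem P_diagBimode_of_mem {α β : ℝ × ℝ} {u v : F} (hu : u ∈ X.bigr α) (hv : v ∈ X.bigr β) (k : ℝ)
    (s : ℝ × ℝ) : X.P s (X.diagBimode k u v) =
      if s.1 + s.2 = α.1 + α.2 + (β.1 + β.2) - k - 1 then X.atOne s u v else 0 := by
  rw [diagBimode_eq_finsum]
  have h := (X.P s).toAddMonoidHom.map_finsum (X.diagMode_finite k u v)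
  refine h.trans ?_
  simp only [LinearMap.toAddMonoidHom_coe, X.bimode_of_mem hu hv]
  split_ifs with hs
  · rw [finsum_eq_single _ (α.1 + β.1 - s.1 - 1)]
    · have e : α + β - (α.1 + β.1 - s.1 - 1 + 1, k - 1 - (α.1 + β.1 - s.1 - 1) + 1) = s := by
        ext <;> simp only [Prod.fst_sub, Prod.snd_sub, Prod.fst_add, Prod.snd_add] <;> linarith
      rw [e, X.P_of_mem (X.atOne_mem _ _ _)]
    · intro l hl
      refine X.P_of_mem_ne (X.atOne_mem _ _ _) fun h => hl ?_
      rw [h]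
      simp only [Prod.fst_sub, Prod.fst_add]
      ring
  · refine (finsum_congr (g := fun _ => (0 : F)) fun l => ?_).trans finsum_zero
    refine X.P_of_mem_ne (X.atOne_mem _ _ _) fun h => hs ?_
    rw [h]
    simp only [Prod.fst_sub, Prod.snd_sub, Prod.fst_add, Prod.snd_add]
    ring

/-- The weight condition involves total weights only. The extension is needed because a diagonal
mode of bihomogeneous vectors is homogeneous merely for the total weight. -/
theorem P_diagBimode {x y : ℝ} {u v : F} (hu : u ∈ X.gr x) (hv : v ∈ X.gr y) (k : ℝ)
    (s : ℝ × ℝ) : X.P s (X.diagBimode k u v) =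
      if s.1 + s.2 = x + y - k - 1 then X.atOne s u v else 0 := by
  refine X.gr_induction (p := fun u => X.P s (X.diagBimode k u v) =
      if s.1 + s.2 = x + y - k - 1 then X.atOne s u v else 0) (fun α hα u hu => ?_)
    (fun u u' h h' => ?_) ?_ hu
  · refine X.gr_induction (p := fun v => X.P s (X.diagBimode k u v) =
      if s.1 + s.2 = x + y - k - 1 then X.atOne s u v else 0) (fun β hβ v hv => ?_)
      (fun v v' h h' => ?_) ?_ hv
    · rw [X.P_diagBimode_of_mem hu hv, hα, hβ]
    · simp only [map_add, h, h']
      split_ifs <;> simp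
    · simp
  · simp only [map_add, LinearMap.add_apply, h, h']
    split_ifs <;> simp
  · simp

theorem diagBimode_mem_gr {x y : ℝ} {u v : F} (hu : u ∈ X.gr x) (hv : v ∈ X.gr y) (k : ℝ) :
    X.diagBimode k u v ∈ X.gr (x + y - k - 1) := by
  refine X.mem_gr_of_P fun p hp => ?_
  rw [X.P_diagBimode hu hv] at hp
  by_contra h
  exact hp (if_neg h)

theorem exists_gr_eq_bot : ∃ N : ℝ, ∀ r < N, X.gr r = ⊥ := by
  obtain ⟨M, hM⟩ := X.restricted.lower_truncated
  refine ⟨2 * M, fun r hr => (Submodule.eq_bot_iff _).2 fun x hx => X.P_ext fun p => ?_⟩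
  rw [map_zero]
  by_cases hp : p.1 + p.2 = r
  · have hmem := X.P_mem p x
    have hb : X.bigr p = ⊥ := by
      by_cases h1 : p.1 < M
      · exact X.bigr_eq_bot hM (.inl h1)
      · exact X.bigr_eq_bot hM (.inr (by linarith))
    rwa [hb, Submodule.mem_bot] at hmem
  · exact X.P_of_mem_gr_ne hx hp

theorem diagBimode_truncation (u v : F) : ∃ N : ℝ, ∀ k ≥ N, X.diagBimode k u v = 0 := by
  induction u using graded_induction X.internal with
  | h0 => exact ⟨0, fun k _ => by simp⟩
  | hadd x y hx hy =>
    obtain ⟨N, hN⟩ := hx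
    obtain ⟨N', hN'⟩ := hy
    refine ⟨max N N', fun k hk => ?_⟩
    rw [map_add, LinearMap.add_apply, hN k ((le_max_left _ _).trans hk),
      hN' k ((le_max_right _ _).trans hk), add_zero]
  | h x u hu =>
  induction v using graded_induction X.internal with
  | h0 => exact ⟨0, fun k _ => by simp⟩
  | hadd x y hx hy =>
    obtain ⟨N, hN⟩ := hx
    obtain ⟨N', hN'⟩ := hy
    refine ⟨max N N', fun k hk => ?_⟩
    rw [map_add, hN k ((le_max_left _ _).trans hk), hN' k ((le_max_right _ _).trans hk), add_zero]
  | h y v hv =>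
  obtain ⟨M, hM⟩ := X.exists_gr_eq_bot
  refine ⟨x + y - M, fun k hk => ?_⟩
  have := X.diagBimode_mem_gr hu hv k
  rwa [hM _ (by linarith), Submodule.mem_bot] at this

theorem diagBimode_truncation_int (u v : F) : ∃ N : ℤ, ∀ k : ℤ, k ≥ N → X.diagBimode k u v = 0 := by
  obtain ⟨N, hN⟩ := X.diagBimode_truncation u v
  refine ⟨⌈N⌉, fun k hk => hN k ?_⟩
  exact (Int.le_ceil N).trans (by exact_mod_cast hk)

theorem diagBimode_tmul (n : ℤ) (a : A) (b : B) (w : F) :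
    X.diagBimode n (X.ρ (a ⊗ₜ b)) w =
      ∑ᶠ k : ℤ, X.leftMode k a (X.rightMode (n - 1 - k) b w) := by
  have h : ∀ l ∉ Set.range ((↑) : ℤ → ℝ), X.bimode l (n - 1 - l) (X.ρ (a ⊗ₜ b)) w = 0 :=
    fun l hl => X.bimode_tmul_eq_zero (fun k' l' h => hl ⟨k', (congrArg Prod.fst h).symm⟩) a b w
  -- Terms with non-integral `l` vanish, so the sum over `ℝ` is one over `ℤ`.
  rw [diagBimode_eq_finsum, ← finsum_mem_univ, ← finsum_mem_inter_support, Set.univ_inter,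
    ← Set.inter_eq_self_of_subset_right (s := Set.range ((↑) : ℤ → ℝ)) (t := Function.support _)
      (fun l hl => by_contra fun h' => hl (h l h')), finsum_mem_inter_support,
    finsum_mem_range Int.cast_injective]
  refine finsum_congr fun k => ?_
  rw [← X.bimode_tmul]
  push_cast
  rfl

theorem diagBimode_rho_eq_zero {k : ℝ} (hk : ∀ n : ℤ, k ≠ n) (u : A ⊗[ℂ] B) (w : F) :
    X.diagBimode k (X.ρ u) w = 0 := by
  induction u using TensorProduct.induction_on with
  | zero => simp
  | add x y hx hy => simp only [map_add, LinearMap.add_apply, hx, hy, add_zero]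
  | tmul a b =>
    rw [diagBimode_eq_finsum]
    refine (finsum_congr (g := fun _ => (0 : F)) fun l => ?_).trans finsum_zero
    refine X.bimode_tmul_eq_zero (fun k' l' h => hk (k' + l' + 1) ?_) a b w
    have h1 := congrArg Prod.fst h
    have h2 := congrArg Prod.snd h
    simp only at h1 h2
    push_cast
    linarith

theorem rho_mode (n : ℤ) (u v : A ⊗[ℂ] B) :
    X.ρ ((tensorVOA VL VR).mode n u v) = X.diagBimode n (X.ρ u) (X.ρ v) := by
  induction u using TensorProduct.induction_on with
  | zero => simp
  | add x y hx hy => simp only [map_add, LinearMap.add_apply, hx, hy]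
  | tmul a b =>
    rw [diagBimode_tmul]
    refine (X.ρ.toAddMonoidHom.map_finsum (tensorBimode_finite VL VR n (a ⊗ₜ b) v)).trans ?_
    refine finsum_congr fun k => ?_
    rw [LinearMap.toAddMonoidHom_coe, ← X.bimode_rho, X.bimode_tmul]

end FullFieldAlgebraOver

/-! ## The Jacobi identity for the diagonal modes -/

namespace FullFieldAlgebraOver

variable {A B F : Type*} [AddCommGroup A] [Module ℂ A] [AddCommGroup B] [Module ℂ B]
  [AddCommGroup F] [Module ℂ F] {VL : VertexOperatorAlgebra A} {VR : VertexOperatorAlgebra B}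
  (X : FullFieldAlgebraOver VL VR F)

theorem leftMode_rightMode_finite (n : ℤ) (a : A) (b : B) (w : F) :
    (Function.support fun k : ℤ => X.leftMode k a (X.rightMode (n - 1 - k) b w)).Finite := by
  refine ((X.diagMode_finite n (X.ρ (a ⊗ₜ b)) w).preimage
    (f := ((↑) : ℤ → ℝ)) Int.cast_injective.injOn).subset fun k hk h => hk ?_
  beta_reduce
  rw [← X.bimode_tmul, ← h]
  push_cast
  rfl

variable {a : A} {b : B} {h h' : ℤ} {α β : ℝ × ℝ} {w w₁ w₂ : F}

theorem P_leftMode (ha : a ∈ VL.gr h) (k : ℤ) (s : ℝ × ℝ) (w : F) :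
    X.P s (X.leftMode k a w) = X.leftMode k a (X.P (s - ((h : ℝ) - k - 1, 0)) w) := by
  induction w using X.bigr_induction with
  | h0 => simp
  | hadd x y hx hy => simp only [map_add, hx, hy]
  | h β w hw =>
    by_cases hs : s = (β.1 + h - k - 1, β.2)
    · have e : s - ((h : ℝ) - k - 1, 0) = β := by
        rw [hs]
        ext <;> simp only [Prod.fst_sub, Prod.snd_sub] <;> ring
      rw [e, X.P_of_mem hw, hs, X.P_of_mem (X.leftMode_mem ha hw k)]
    · rw [X.P_of_mem_ne (X.leftMode_mem ha hw k) hs, X.P_of_mem_ne hw, map_zero]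
      rintro rfl
      apply hs
      ext <;> simp only [Prod.fst_sub, Prod.snd_sub] <;> ring

theorem P_rightMode (hb : b ∈ VR.gr h) (k : ℤ) (s : ℝ × ℝ) (w : F) :
    X.P s (X.rightMode k b w) = X.rightMode k b (X.P (s - (0, (h : ℝ) - k - 1)) w) := by
  induction w using X.bigr_induction with
  | h0 => simp
  | hadd x y hx hy => simp only [map_add, hx, hy]
  | h β w hw =>
    by_cases hs : s = (β.1, β.2 + h - k - 1)
    · have e : s - (0, (h : ℝ) - k - 1) = β := by
        rw [hs]
        ext <;> simp only [Prod.fst_sub, Prod.snd_sub] <;> ring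
      rw [e, X.P_of_mem hw, hs, X.P_of_mem (X.rightMode_mem hb hw k)]
    · rw [X.P_of_mem_ne (X.rightMode_mem hb hw k) hs, X.P_of_mem_ne hw, map_zero]
      rintro rfl
      apply hs
      ext <;> simp only [Prod.fst_sub, Prod.snd_sub] <;> ring

/-- The three expansions of the correlation function of `a ⊗ b`, `w₁` and `w₂` at `z̄ = z`. -/
theorem exists_isRationalTriple_diag (ha : a ∈ VL.gr h) (hb : b ∈ VR.gr h') (hw₁ : w₁ ∈ X.bigr α)
    (hw₂ : w₂ ∈ X.bigr β) (s : ℝ × ℝ) : ∃ N : ℕ, IsRationalTriple N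
      (fun n => ∑ᶠ k : ℤ, X.leftMode k a (X.rightMode (n - 1 - k) b
        (X.atOne (s - ((h : ℝ) - k - 1, 0) - (0, (h' : ℝ) - (n - 1 - k : ℤ) - 1)) w₁ w₂)))
      (fun n => X.atOne s w₁ (X.diagBimode n (X.ρ (a ⊗ₜ b)) w₂))
      (fun n => X.atOne s (X.diagBimode n (X.ρ (a ⊗ₜ b)) w₁) w₂) := by
  obtain ⟨M, hM⟩ := X.restricted.lower_truncated
  -- One bound for the pole orders at `∞`, `1` and `0` in both variables.
  obtain ⟨N, hN⟩ := exists_nat_ge (max (max (max (s.1 - h + 1 - M) (α.1 + h - M)) (β.1 + h - M))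
    (max (max (s.2 - h' + 1 - M) (α.2 + h' - M)) (β.2 + h' - M)))
  simp only [max_le_iff] at hN
  obtain ⟨⟨⟨h₁, h₂⟩, h₃⟩, ⟨⟨h₄, h₅⟩, h₆⟩⟩ := hN
  have hge : ∀ {n : ℤ}, n ≥ N → (N : ℝ) ≤ n := fun hn => by exact_mod_cast hn
  -- The first variable is that of the left modes, the second that of the right modes; they are
  -- treated as independent and identified only on the diagonal.
  have key := IsRationalTriple.diag (N := N)
    (cc := fun k l => X.leftMode k a (X.rightMode l b
      (X.atOne (s - ((h : ℝ) - k - 1, 0) - (0, (h' : ℝ) - l - 1)) w₁ w₂)))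
    (dc := fun k l => X.rightMode l b (X.atOne (s - (0, (h' : ℝ) - l - 1)) w₁ (X.leftMode k a w₂)))
    (dd := fun k l => X.atOne s w₁ (X.rightMode l b (X.leftMode k a w₂)))
    (de := fun k l => X.atOne s (X.rightMode l b w₁) (X.leftMode k a w₂))
    (ec := fun k l => X.rightMode l b (X.atOne (s - (0, (h' : ℝ) - l - 1)) (X.leftMode k a w₁) w₂))
    (ed := fun k l => X.atOne s (X.leftMode k a w₁) (X.rightMode l b w₂))
    (ee := fun k l => X.atOne s (X.rightMode l b (X.leftMode k a w₁)) w₂)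
    (fun l => by
      have := (X.isRationalTriple_left (s := s - (0, (h' : ℝ) - l - 1)) hM ha hw₁ hw₂ (N := N)
        (by simpa using h₁) h₂ h₃).map (X.rightMode l b)
      simp only [X.leftMode_rightMode]
      convert this using 5
      rw [sub_right_comm])
    (fun k => X.isRationalTriple_right hM hb hw₁ (X.leftMode_mem ha hw₂ k) h₄ h₅ h₆)
    (fun k => X.isRationalTriple_right hM hb (X.leftMode_mem ha hw₁ k) hw₂ h₄ h₅ h₆)
    (fun k l hl => by
      have hl' : (l : ℝ) < -N := by exact_mod_cast hl
      have := X.atOne_mem (s - ((h : ℝ) - k - 1, 0) - (0, (h' : ℝ) - l - 1)) w₁ w₂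
      rw [X.bigr_eq_bot hM (.inr (by simp only [Prod.snd_sub]; linarith)),
        Submodule.mem_bot] at this
      rw [this, map_zero, map_zero])
    (fun k l hk => by
      rw [X.leftMode_eq_zero hM ha hw₂ (h₃.trans (hge hk)), map_zero, map_zero])
    (fun k l hk => by
      rw [X.leftMode_eq_zero hM ha hw₁ (h₂.trans (hge hk)), map_zero, map_zero,
        LinearMap.zero_apply])
  refine ⟨2 * N, ?_⟩
  convert key using 1
  · rfl
  · funext n
    rw [X.diagBimode_tmul]
    refine ((X.atOne s w₁).toAddMonoidHom.map_finsum
      (X.leftMode_rightMode_finite n a b w₂)).trans (finsum_congr fun k => ?_)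
    rw [LinearMap.toAddMonoidHom_coe, X.leftMode_rightMode]
  · funext n
    rw [X.diagBimode_tmul]
    refine (((X.atOne s).flip w₂).toAddMonoidHom.map_finsum
      (X.leftMode_rightMode_finite n a b w₁)).trans (finsum_congr fun k => ?_)
    rw [LinearMap.toAddMonoidHom_coe, X.leftMode_rightMode, LinearMap.flip_apply]

theorem P_diagBimode_diagBimode (ha : a ∈ VL.gr h) (hb : b ∈ VR.gr h') (hw₁ : w₁ ∈ X.bigr α)
    (hw₂ : w₂ ∈ X.bigr β) (s : ℝ × ℝ) (n : ℤ) (κ : ℝ)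
    (hs : s.1 + s.2 = h + h' - n - 1 + (α.1 + α.2 + (β.1 + β.2) - κ - 1)) :
    X.P s (X.diagBimode n (X.ρ (a ⊗ₜ b)) (X.diagBimode κ w₁ w₂)) =
      ∑ᶠ k : ℤ, X.leftMode k a (X.rightMode (n - 1 - k) b
        (X.atOne (s - ((h : ℝ) - k - 1, 0) - (0, (h' : ℝ) - (n - 1 - k : ℤ) - 1)) w₁ w₂)) := by
  rw [X.diagBimode_tmul]
  refine ((X.P s).toAddMonoidHom.map_finsum
      (X.leftMode_rightMode_finite n a b _)).trans (finsum_congr fun k => ?_)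
  rw [LinearMap.toAddMonoidHom_coe, X.P_leftMode ha, X.P_rightMode hb,
    X.P_diagBimode_of_mem hw₁ hw₂, if_pos]
  simp only [Prod.fst_sub, Prod.snd_sub]
  push_cast
  linarith

theorem finite_iterate (u w₁ w₂ : F) (p r : ℤ) (q : ℝ) :
    (Function.support fun i : ℕ => ((Ring.choose p i : ℤ) : ℂ) •
      X.diagBimode (p + q - i) (X.diagBimode (r + i : ℤ) u w₁) w₂).Finite := by
  obtain ⟨N, hN⟩ := X.diagBimode_truncation_int u w₁
  refine (Set.finite_lt_nat (N - r).toNat).subset fun i hi => ?_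
  by_contra hlt
  simp only [Set.mem_ofPred_eq, not_lt] at hlt
  refine hi ?_
  beta_reduce
  rw [hN _ (by omega)]
  simp

theorem finite_left (u w₁ w₂ : F) (p r : ℤ) (q : ℝ) :
    (Function.support fun i : ℕ => ((-1 : ℂ) ^ i * ((Ring.choose r i : ℤ) : ℂ)) •
      X.diagBimode (p + r - i : ℤ) u (X.diagBimode (q + i) w₁ w₂)).Finite := by
  obtain ⟨N, hN⟩ := X.diagBimode_truncation w₁ w₂
  obtain ⟨K, hK⟩ := exists_nat_ge (N - q)
  refine (Set.finite_lt_nat K).subset fun i hi => ?_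
  by_contra hlt
  simp only [Set.mem_ofPred_eq, not_lt] at hlt
  refine hi ?_
  have : (K : ℝ) ≤ i := by exact_mod_cast hlt
  beta_reduce
  rw [hN (q + i) (by linarith)]
  simp

theorem finite_right (u w₁ w₂ : F) (p r : ℤ) (q : ℝ) :
    (Function.support fun i : ℕ => ((-1 : ℂ) ^ i * ((Ring.choose r i : ℤ) : ℂ)) •
      (-1 : ℂ) ^ r • X.diagBimode (q + r - i) w₁ (X.diagBimode (p + i : ℤ) u w₂)).Finite := by
  obtain ⟨N, hN⟩ := X.diagBimode_truncation_int u w₂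
  refine (Set.finite_lt_nat (N - p).toNat).subset fun i hi => ?_
  by_contra hlt
  simp only [Set.mem_ofPred_eq, not_lt] at hlt
  refine hi ?_
  beta_reduce
  rw [hN _ (by omega)]
  simp

/-- The Jacobi identity, as an identity between trilinear expressions. -/
def JacobiAt (u w₁ w₂ : F) (p r : ℤ) (q : ℝ) : Prop :=
  ∑ᶠ i : ℕ, ((Ring.choose p i : ℤ) : ℂ) •
      X.diagBimode (p + q - i) (X.diagBimode (r + i : ℤ) u w₁) w₂ =
    ∑ᶠ i : ℕ, ((-1 : ℂ) ^ i * ((Ring.choose r i : ℤ) : ℂ)) •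
        X.diagBimode (p + r - i : ℤ) u (X.diagBimode (q + i) w₁ w₂) -
      ∑ᶠ i : ℕ, ((-1 : ℂ) ^ i * ((Ring.choose r i : ℤ) : ℂ)) •
        (-1 : ℂ) ^ r • X.diagBimode (q + r - i) w₁ (X.diagBimode (p + i : ℤ) u w₂)

/-- The real exponent `q` enters only through a condition on the total weight of the component `s`.
If it fails, every term vanishes; if it holds, each outer mode of `w₁` becomes a component at `1`,
and the identity is the vanishing of the defect of the diagonal triple. -/
theorem jacobiAt_homogeneous (ha : a ∈ VL.gr h) (hb : b ∈ VR.gr h') (hw₁ : w₁ ∈ X.bigr α)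
    (hw₂ : w₂ ∈ X.bigr β) (p r : ℤ) (q : ℝ) : X.JacobiAt (X.ρ (a ⊗ₜ b)) w₁ w₂ p r q := by
  refine X.P_ext fun s => ?_
  set u := X.ρ (a ⊗ₜ b) with hu
  have hug : u ∈ X.gr ((h + h' : ℤ) : ℝ) := X.rho_mem_gr ha hb
  have hg₁ := X.bigr_le_gr _ hw₁
  have hg₂ := X.bigr_le_gr _ hw₂
  rw [map_sub]
  have e₁ := (X.P s).toAddMonoidHom.map_finsum (X.finite_iterate u w₁ w₂ p r q)
  have e₂ := (X.P s).toAddMonoidHom.map_finsum (X.finite_left u w₁ w₂ p r q)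
  have e₃ := (X.P s).toAddMonoidHom.map_finsum (X.finite_right u w₁ w₂ p r q)
  simp only [LinearMap.toAddMonoidHom_coe, map_smul] at e₁ e₂ e₃
  rw [e₁, e₂, e₃]
  by_cases hs : s.1 + s.2 = h + h' + (α.1 + α.2) + (β.1 + β.2) - p - q - r - 2
  · obtain ⟨N, hN⟩ := X.exists_isRationalTriple_diag ha hb hw₁ hw₂ s
    have hj := hN.jacobiDefect_eq_zero p r
    have f₁ : ∀ i : ℕ, X.P s (X.diagBimode (p + q - i) (X.diagBimode (r + i : ℤ) u w₁) w₂) =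
        X.atOne s (X.diagBimode (r + i : ℤ) u w₁) w₂ := fun i => by
      rw [X.P_diagBimode (X.diagBimode_mem_gr hug hg₁ _) hg₂, if_pos]
      push_cast
      linarith
    have f₂ : ∀ i : ℕ, X.P s (X.diagBimode (q + r - i) w₁ (X.diagBimode (p + i : ℤ) u w₂)) =
        X.atOne s w₁ (X.diagBimode (p + i : ℤ) u w₂) := fun i => by
      rw [X.P_diagBimode hg₁ (X.diagBimode_mem_gr hug hg₂ _), if_pos]
      push_cast
      linarith
    have f₃ : ∀ i : ℕ, X.P s (X.diagBimode (p + r - i : ℤ) u (X.diagBimode (q + i) w₁ w₂)) = _ :=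
      fun i => X.P_diagBimode_diagBimode ha hb hw₁ hw₂ s (p + r - i) (q + i) (by
        push_cast
        linarith)
    simp only [f₁, f₂, f₃]
    rw [jacobiDefect, sub_eq_zero] at hj
    refine hj.trans ?_
    rw [jacobiLeft, jacobiRight, smul_finsum]
    congr 1
    exact finsum_congr fun i => smul_comm _ _ _
  · have f₁ : ∀ i : ℕ, X.P s (X.diagBimode (p + q - i) (X.diagBimode (r + i : ℤ) u w₁) w₂) = 0 :=
      fun i => by
        rw [X.P_diagBimode (X.diagBimode_mem_gr hug hg₁ _) hg₂, if_neg]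
        push_cast
        exact fun h => hs (by linarith)
    have f₂ : ∀ i : ℕ, X.P s (X.diagBimode (q + r - i) w₁ (X.diagBimode (p + i : ℤ) u w₂)) = 0 :=
      fun i => by
        rw [X.P_diagBimode hg₁ (X.diagBimode_mem_gr hug hg₂ _), if_neg]
        push_cast
        exact fun h => hs (by linarith)
    have f₃ : ∀ i : ℕ, X.P s (X.diagBimode (p + r - i : ℤ) u (X.diagBimode (q + i) w₁ w₂)) = 0 :=
      fun i => by
        rw [X.P_diagBimode hug (X.diagBimode_mem_gr hg₁ hg₂ _), if_neg]
        push_cast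
        exact fun h => hs (by linarith)
    simp only [f₁, f₂, f₃, smul_zero, finsum_zero, sub_zero]

theorem JacobiAt.add_left {u u' w₁ w₂ : F} {p r : ℤ} {q : ℝ} (h : X.JacobiAt u w₁ w₂ p r q)
    (h' : X.JacobiAt u' w₁ w₂ p r q) : X.JacobiAt (u + u') w₁ w₂ p r q := by
  unfold JacobiAt at h h' ⊢
  simp only [map_add, LinearMap.add_apply, smul_add]
  rw [finsum_add_distrib (X.finite_iterate u w₁ w₂ p r q) (X.finite_iterate u' w₁ w₂ p r q),
    finsum_add_distrib (X.finite_left u w₁ w₂ p r q) (X.finite_left u' w₁ w₂ p r q),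
    finsum_add_distrib (X.finite_right u w₁ w₂ p r q) (X.finite_right u' w₁ w₂ p r q), h, h']
  abel

theorem JacobiAt.add_middle {u w₁ w₁' w₂ : F} {p r : ℤ} {q : ℝ} (h : X.JacobiAt u w₁ w₂ p r q)
    (h' : X.JacobiAt u w₁' w₂ p r q) : X.JacobiAt u (w₁ + w₁') w₂ p r q := by
  unfold JacobiAt at h h' ⊢
  simp only [map_add, LinearMap.add_apply, smul_add]
  rw [finsum_add_distrib (X.finite_iterate u w₁ w₂ p r q) (X.finite_iterate u w₁' w₂ p r q),
    finsum_add_distrib (X.finite_left u w₁ w₂ p r q) (X.finite_left u w₁' w₂ p r q),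
    finsum_add_distrib (X.finite_right u w₁ w₂ p r q) (X.finite_right u w₁' w₂ p r q), h, h']
  abel

theorem JacobiAt.add_right {u w₁ w₂ w₂' : F} {p r : ℤ} {q : ℝ} (h : X.JacobiAt u w₁ w₂ p r q)
    (h' : X.JacobiAt u w₁ w₂' p r q) : X.JacobiAt u w₁ (w₂ + w₂') p r q := by
  unfold JacobiAt at h h' ⊢
  simp only [map_add, smul_add]
  rw [finsum_add_distrib (X.finite_iterate u w₁ w₂ p r q) (X.finite_iterate u w₁ w₂' p r q),
    finsum_add_distrib (X.finite_left u w₁ w₂ p r q) (X.finite_left u w₁ w₂' p r q),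
    finsum_add_distrib (X.finite_right u w₁ w₂ p r q) (X.finite_right u w₁ w₂' p r q), h, h']
  abel

theorem jacobiAt (u : A ⊗[ℂ] B) (w₁ w₂ : F) (p r : ℤ) (q : ℝ) :
    X.JacobiAt (X.ρ u) w₁ w₂ p r q := by
  induction w₂ using X.bigr_induction with
  | h0 => simp [JacobiAt]
  | hadd x y hx hy => exact hx.add_right X hy
  | h β w₂ hw₂ =>
  induction w₁ using X.bigr_induction with
  | h0 => simp [JacobiAt]
  | hadd x y hx hy => exact hx.add_middle X hy
  | h α w₁ hw₁ =>
  induction u using TensorProduct.induction_on with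
  | zero => simp [JacobiAt]
  | add x y hx hy => rw [map_add]; exact hx.add_left X hy
  | tmul a b =>
  induction a using graded_induction VL.internal with
  | h0 => simp [JacobiAt]
  | hadd x y hx hy => rw [TensorProduct.add_tmul, map_add]; exact hx.add_left X hy
  | h h a ha =>
  induction b using graded_induction VR.internal with
  | h0 => simp [JacobiAt]
  | hadd x y hx hy => rw [TensorProduct.tmul_add, map_add]; exact hx.add_left X hy
  | h h' b hb => exact X.jacobiAt_homogeneous ha hb hw₁ hw₂ p r q

theorem jacobiIdentity_diagMode (Y : ℤ → A ⊗[ℂ] B → F → F)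
    (hY : ∀ n u w, Y n u w = X.diagBimode n (X.ρ u) w) :
    JacobiIdentity Y Y Y X.diagMode := by
  intro u w₁ w₂ p r q
  simp only [hY, ← X.diagBimode_apply, smul_sub]
  rw [finsum_sub_distrib (X.finite_left (X.ρ u) w₁ w₂ p r q)
    (X.finite_right (X.ρ u) w₁ w₂ p r q)]
  exact X.jacobiAt u w₁ w₂ p r q

end FullFieldAlgebraOver

/-! ## The Virasoro relations and the derivative property -/

theorem choose_three_cast (p : ℤ) :
    ((Ring.choose p 3 : ℤ) : ℂ) = (p : ℂ) * (p - 1) * (p - 2) / 6 := by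
  have h : ((3).factorial : ℤ) * Ring.choose p 3 = p * (p - 1) * (p - 2) := by
    have := Ring.descPochhammer_eq_factorial_smul_choose p 3
    rw [nsmul_eq_mul] at this
    rw [← this, ← Polynomial.eval_eq_smeval]
    simp [descPochhammer_succ_left]
    ring
  have h' : (6 : ℂ) * ((Ring.choose p 3 : ℤ) : ℂ) = p * (p - 1) * (p - 2) := by
    exact_mod_cast h
  rw [← h']
  ring

namespace VertexOperatorAlgebra

variable {C W : Type*} [AddCommGroup C] [Module ℂ C] [AddCommGroup W] [Module ℂ W]
  (V : VertexOperatorAlgebra C)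

/-- As `ω = L(-2) 𝟏`, the vector is `L(i-1) L(-2) 𝟏`, evaluated with the Virasoro relation and the
creation property. The case `i = 0` is `L(-1) ω`, handled by the derivative property instead. -/
theorem conf_mode_conf (i : ℕ) (hi : i ≠ 0) : V.mode i V.conf V.conf =
    if i = 1 then (2 : ℂ) • V.conf else if i = 3 then (V.charge / 2) • V.vac else 0 := by
  have h := V.virasoro (i - 1) (-2) V.vac
  rw [show ((i : ℤ) - 1 + 1) = i by ring, show (-2 + 1 : ℤ) = -1 by norm_num, (V.creation _).1,
    (V.creation V.conf).2 i (by positivity), map_zero, sub_zero] at h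
  rw [h]
  rcases Nat.lt_or_ge i 2 with h2 | h2
  · obtain rfl : i = 1 := by omega
    norm_num [(V.creation V.conf).1]
  · rw [(V.creation V.conf).2 _ (by omega), smul_zero, zero_add, if_neg (by omega : i ≠ 1)]
    by_cases h3 : i = 3
    · subst h3
      norm_num
      congr 1
      ring
    · rw [if_neg h3, if_neg (by omega), zero_smul]

theorem conf_mem : V.conf ∈ V.gr 2 := by
  refine V.mem_gr_of_eigen ?_
  have := V.conf_mode_conf 1 one_ne_zero
  rw [if_pos rfl] at this
  exact_mod_cast this

/-- The Virasoro relations follow from the commutator formula. -/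
theorem virasoro_of_commutator {op : ℤ → C →ₗ[ℂ] W →ₗ[ℂ] W}
    (hvac : ∀ n w, op n V.vac w = if n = -1 then w else 0)
    (hder : ∀ n w, op n (V.mode 0 V.conf V.conf) w = (-(n : ℂ)) • op (n - 1) V.conf w)
    (hcomm : ∀ p q w, op p V.conf (op q V.conf w) - op q V.conf (op p V.conf w) =
      ∑ᶠ i : ℕ, ((Ring.choose p i : ℤ) : ℂ) • op (p + q - i) (V.mode i V.conf V.conf) w)
    (m n : ℤ) (w : W) :
    op (m + 1) V.conf (op (n + 1) V.conf w) - op (n + 1) V.conf (op (m + 1) V.conf w) =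
      ((m : ℂ) - n) • op (m + n + 1) V.conf w
        + (if m + n = 0 then V.charge / 12 * ((m : ℂ) ^ 3 - m) else 0) • w := by
  rw [hcomm, finsum_eq_sum_range (B := 4)]
  -- With `p = m + 1` and `q = n + 1`, the term `i = 0` gives `-(m + n + 2) L(m+n)`, the term `i =
  -- 1` gives `2 (m + 1) L(m+n)`, and `i = 3` gives the central term `(m + 1 choose 3) c / 2`.
  · rw [Finset.sum_range_succ, Finset.sum_range_succ, Finset.sum_range_succ, Finset.sum_range_one,
      V.conf_mode_conf 1 (by norm_num), V.conf_mode_conf 2 (by norm_num),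
      V.conf_mode_conf 3 (by norm_num), Nat.cast_zero, hder, choose_three_cast]
    norm_num
    rw [hvac, show m + 1 + (n + 1) - 1 = m + n + 1 by ring, smul_smul, ← add_smul]
    congr 1
    · congr 1
      ring
    · by_cases hmn : m + n = 0
      · rw [if_pos (by omega), if_pos hmn, smul_smul]
        congr 1
        ring
      · rw [if_neg (by omega), if_neg hmn]
        simp
  · intro i hi
    rw [V.conf_mode_conf i (by omega), if_neg (by omega), if_neg (by omega)]
    simp

end VertexOperatorAlgebra

namespace FullFieldAlgebraOver

variable {A B F : Type*} [AddCommGroup A] [Module ℂ A] [AddCommGroup B] [Module ℂ B]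
  [AddCommGroup F] [Module ℂ F] {VL : VertexOperatorAlgebra A} {VR : VertexOperatorAlgebra B}
  (X : FullFieldAlgebraOver VL VR F)

theorem rho_vac : X.ρ (VL.vac ⊗ₜ VR.vac) = X.vac := X.ρ_hom.map_vac

/-- The vacuum axiom removes a vacuum in the last slot only; permutation symmetry moves it there. -/
theorem atOne_vac (s : ℝ × ℝ) (w : F) : X.atOne s X.vac w = X.P s w := by
  have h1 := X.permutation 2 (by norm_num) (Equiv.swap 0 1) ![X.vac, w] ![1, 0]
    (BigradedFieldData.pair_mem_configSpace one_ne_zero)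
  have e1 : (![X.vac, w] ∘ Equiv.swap 0 1 : Fin 2 → F) = Fin.snoc ![w] X.vac := by
    ext i; fin_cases i <;> rfl
  have e2 : (![1, 0] ∘ Equiv.swap 0 1 : Fin 2 → ℂ) = Fin.snoc ![0] 1 := by
    ext i; fin_cases i <;> rfl
  have e3 : (Fin.snoc ![0] 1 : Fin 2 → ℂ) = ![0, 1] := by
    ext i; fin_cases i <;> rfl
  have h2 := X.corr_vac 1 le_rfl ![w] ![0] 1 (by
    have := BigradedFieldData.pair_mem_configSpace (zero_ne_one (α := ℂ))
    rw [← e3] at this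
    exact this)
  rw [e1, e2] at h1
  rw [X.atOne_apply, FieldData.vertexOp, ← X.comp_corr_one, h1]
  exact congrArg (X.comp s) h2

theorem bimode_vac (k l : ℝ) (w : F) :
    X.bimode k l X.vac w = if k = -1 ∧ l = -1 then w else 0 := by
  induction w using X.bigr_induction with
  | h0 => simp
  | hadd x y hx hy => rw [map_add, hx, hy]; split_ifs <;> simp
  | h β w hw =>
    have hv := X.rho_mem VL.vac_mem VR.vac_mem
    rw [X.rho_vac] at hv
    rw [X.bimode_of_mem hv hw, X.atOne_vac]
    split_ifs with h
    · rw [h.1, h.2]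
      convert X.P_of_mem hw using 2
      ext : 1
      simp
    · refine X.P_of_mem_ne hw fun h' => h ?_
      have h1 := congrArg Prod.fst h'
      have h2 := congrArg Prod.snd h'
      simp only [Prod.fst_sub, Prod.snd_sub, Prod.fst_add, Prod.snd_add, Int.cast_zero] at h1 h2
      exact ⟨by linarith, by linarith⟩

theorem leftMode_vac (n : ℤ) (w : F) : X.leftMode n VL.vac w = if n = -1 then w else 0 := by
  have e : ((n : ℝ) = -1) ↔ n = -1 := by
    rw [← Int.cast_one, ← Int.cast_neg, Int.cast_inj]
  rw [leftMode, rho_vac, bimode_vac]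
  simp [e]

theorem rightMode_vac (n : ℤ) (w : F) : X.rightMode n VR.vac w = if n = -1 then w else 0 := by
  have e : ((n : ℝ) = -1) ↔ n = -1 := by
    rw [← Int.cast_one, ← Int.cast_neg, Int.cast_inj]
  rw [rightMode, rho_vac, bimode_vac]
  simp [e]

theorem diagBimode_left (n : ℤ) (a : A) (w : F) :
    X.diagBimode n (X.ρ (a ⊗ₜ VR.vac)) w = X.leftMode n a w := by
  rw [diagBimode_tmul, finsum_eq_single _ n]
  · rw [rightMode_vac, if_pos (by ring)]
  · intro k hk
    rw [rightMode_vac, if_neg (by omega), map_zero]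

theorem diagBimode_right (n : ℤ) (b : B) (w : F) :
    X.diagBimode n (X.ρ (VL.vac ⊗ₜ b)) w = X.rightMode n b w := by
  rw [diagBimode_tmul, finsum_eq_single _ (-1)]
  · rw [leftMode_vac, if_pos rfl]
    congr 2
    ring
  · intro k hk
    rw [leftMode_vac, if_neg hk]

theorem diagBimode_conf (n : ℤ) (w : F) : X.diagBimode n (X.ρ (tensorVOA VL VR).conf) w =
    X.leftMode n VL.conf w + X.rightMode n VR.conf w := by
  have h : (tensorVOA VL VR).conf = VL.conf ⊗ₜ[ℂ] VR.vac + VL.vac ⊗ₜ[ℂ] VR.conf := rfl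
  rw [h, map_add, map_add, LinearMap.add_apply, diagBimode_left, diagBimode_right]

theorem diagBimode_vac (n : ℤ) (w : F) :
    X.diagBimode n (X.ρ (tensorVOA VL VR).vac) w = if n = -1 then w else 0 :=
  (X.diagBimode_left n VL.vac w).trans (X.leftMode_vac n w)

theorem DL_eq_leftMode (w : F) : X.DL w = X.leftMode 0 VL.conf w := by
  rw [X.DL_eq, leftMode, X.bimode_apply, Int.cast_zero]

theorem DR_eq_rightMode (w : F) : X.DR w = X.rightMode 0 VR.conf w := by
  rw [X.DR_eq, rightMode, X.bimode_apply, Int.cast_zero]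

theorem diagBimode_conf_zero (w : F) :
    X.diagBimode 0 (X.ρ (tensorVOA VL VR).conf) w = X.DL w + X.DR w := by
  have := X.diagBimode_conf 0 w
  rwa [Int.cast_zero, ← DL_eq_leftMode, ← DR_eq_rightMode] at this

theorem diagBimode_conf_one {r : ℝ} {w : F} (hw : w ∈ X.gr r) :
    X.diagBimode 1 (X.ρ (tensorVOA VL VR).conf) w = (r : ℂ) • w := by
  have h := X.diagBimode_conf 1 w
  have h1 := LinearMap.congr_fun X.compat w
  have h2 := X.dL_eq w
  have h3 := X.dR_eq w
  rw [diagOp_of_mem _ _ hw, LinearMap.add_apply] at h1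
  rw [leftMode, rightMode, X.bimode_apply, X.bimode_apply, Int.cast_one, ← h2, ← h3] at h
  rw [h, h1]
  rfl

variable {α β : ℝ × ℝ} {w₁ w₂ : F}

/-- At `z = 1` the derivative property and the `𝐝ᴸ` bracket are two expressions for the same `∂/∂z`.
-/
theorem atOne_DL (hw₁ : w₁ ∈ X.bigr α) (hw₂ : w₂ ∈ X.bigr β) (s : ℝ × ℝ) :
    X.atOne s (X.DL w₁) w₂ = ((s.1 - α.1 - β.1 : ℝ) : ℂ) • X.atOne s w₁ w₂ := by
  rw [← sub_eq_zero, ← Module.forall_dual_apply_eq_zero_iff ℂ]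
  intro φ
  have h1 := X.DL_derivative w₁ w₂ 1 one_ne_zero s φ
  have h2 := X.dL_bracket w₁ w₂ 1 one_ne_zero s φ
  rw [← h1, X.dL_of_mem hw₁, X.dL_of_mem hw₂] at h2
  simp only [← X.atOne_apply, map_smul, LinearMap.smul_apply, smul_eq_mul, one_mul] at h2
  rw [map_sub, map_smul, smul_eq_mul]
  push_cast
  linear_combination -h2

theorem atOne_DR (hw₁ : w₁ ∈ X.bigr α) (hw₂ : w₂ ∈ X.bigr β) (s : ℝ × ℝ) :
    X.atOne s (X.DR w₁) w₂ = ((s.2 - α.2 - β.2 : ℝ) : ℂ) • X.atOne s w₁ w₂ := by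
  rw [← sub_eq_zero, ← Module.forall_dual_apply_eq_zero_iff ℂ]
  intro φ
  have h1 := X.DR_derivative w₁ w₂ 1 one_ne_zero s φ
  have h2 := X.dR_bracket w₁ w₂ 1 one_ne_zero s φ
  rw [← h1, X.dR_of_mem hw₁, X.dR_of_mem hw₂] at h2
  simp only [← X.atOne_apply, map_smul, LinearMap.smul_apply, smul_eq_mul, map_one, one_mul] at h2
  rw [map_sub, map_smul, smul_eq_mul]
  push_cast
  linear_combination -h2

theorem conf_mode_zero_mem {r : ℝ} {w : F} (hw : w ∈ X.gr r) : X.DL w + X.DR w ∈ X.gr (r + 1) := by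
  rw [← diagBimode_conf_zero]
  have h1 := X.rho_mem_gr VL.conf_mem VR.vac_mem
  have h2 := X.rho_mem_gr VL.vac_mem VR.conf_mem
  rw [add_zero] at h1
  rw [zero_add] at h2
  have h3 : X.ρ (tensorVOA VL VR).conf ∈ X.gr ((2 : ℤ) : ℝ) := by
    have := add_mem h1 h2
    rwa [← map_add] at this
  have := X.diagBimode_mem_gr h3 hw 0
  convert this using 2
  push_cast
  ring

/-- The `L(-1)`-derivative property. -/
theorem diagBimode_derivative (k : ℝ) (w₁ w₂ : F) : X.diagBimode k (X.DL w₁ + X.DR w₁) w₂ =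
    (-(k : ℂ)) • X.diagBimode (k - 1) w₁ w₂ := by
  induction w₁ using X.bigr_induction with
  | h0 => simp
  | hadd x y hx hy =>
    have e : X.DL (x + y) + X.DR (x + y) = (X.DL x + X.DR x) + (X.DL y + X.DR y) := by
      rw [map_add, map_add]
      abel
    rw [e]
    simp only [map_add, LinearMap.add_apply, smul_add] at hx hy ⊢
    rw [← hx, ← hy]
  | h α w₁ hw₁ =>
  induction w₂ using X.bigr_induction with
  | h0 => simp
  | hadd x y hx hy => rw [map_add, hx, hy, map_add, smul_add]
  | h β w₂ hw₂ =>
  refine X.P_ext fun s => ?_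
  rw [map_smul, X.P_diagBimode_of_mem hw₁ hw₂,
    X.P_diagBimode (X.conf_mode_zero_mem (X.bigr_le_gr _ hw₁)) (X.bigr_le_gr _ hw₂)]
  by_cases hs : s.1 + s.2 = α.1 + α.2 + (β.1 + β.2) - k
  · rw [if_pos (by linarith), if_pos (by linarith), map_add, LinearMap.add_apply,
      X.atOne_DL hw₁ hw₂, X.atOne_DR hw₁ hw₂, ← add_smul]
    congr 1
    rw [← Complex.ofReal_add, ← Complex.ofReal_neg]
    congr 1
    linarith
  · rw [if_neg fun h => hs (by linarith), if_neg fun h => hs (by linarith), smul_zero]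

/-- The Jacobi identity at `r = 0`, where both products reduce to their first term. -/
theorem diagBimode_commutator (u : A ⊗[ℂ] B) (v w : F) (p q : ℤ) :
    X.diagBimode p (X.ρ u) (X.diagBimode q v w) - X.diagBimode q v (X.diagBimode p (X.ρ u) w) =
      ∑ᶠ i : ℕ, ((Ring.choose p i : ℤ) : ℂ) •
        X.diagBimode (p + q - i : ℤ) (X.diagBimode (i : ℤ) (X.ρ u) v) w := by
  have h := X.jacobiAt u v w p 0 q
  unfold JacobiAt at h
  rw [finsum_eq_single (fun i : ℕ => ((-1 : ℂ) ^ i * ((Ring.choose 0 i : ℤ) : ℂ)) • _) 0,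
    finsum_eq_single (fun i : ℕ => ((-1 : ℂ) ^ i * ((Ring.choose 0 i : ℤ) : ℂ)) • _) 0] at h
  · simp only [pow_zero, Ring.choose_zero_right, Int.cast_one, mul_one, one_smul, zpow_zero,
      Nat.cast_zero, add_zero, sub_zero, Int.cast_zero, zero_add] at h
    rw [← h]
    refine finsum_congr fun i => ?_
    push_cast
    rfl
  · intro i hi
    rw [Ring.choose_zero_pos _ (Nat.pos_of_ne_zero hi)]
    simp
  · intro i hi
    rw [Ring.choose_zero_pos _ (Nat.pos_of_ne_zero hi)]
    simp

/-- The modes of `a ⊗ 𝟏`, as bilinear maps. -/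
def leftAction (n : ℤ) : A →ₗ[ℂ] F →ₗ[ℂ] F :=
  X.bimode n (-1) ∘ₗ X.ρ ∘ₗ (TensorProduct.mk ℂ A B).flip VR.vac

/-- The modes of `𝟏 ⊗ b`, as bilinear maps. -/
def rightAction (n : ℤ) : B →ₗ[ℂ] F →ₗ[ℂ] F :=
  X.bimode (-1) n ∘ₗ X.ρ ∘ₗ TensorProduct.mk ℂ A B VL.vac

/-- The modes of `ωL ⊗ 𝟏` are also diagonal modes, so the commutator formula and the derivative
property on `F` apply to them. -/
theorem virasoro_left (m n : ℤ) (w : F) :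
    X.leftMode (m + 1) VL.conf (X.leftMode (n + 1) VL.conf w)
        - X.leftMode (n + 1) VL.conf (X.leftMode (m + 1) VL.conf w) =
      ((m : ℂ) - n) • X.leftMode (m + n + 1) VL.conf w
        + (if m + n = 0 then VL.charge / 12 * ((m : ℂ) ^ 3 - m) else 0) • w := by
  refine VL.virasoro_of_commutator (op := X.leftAction) X.leftMode_vac (fun n w => ?_)
    (fun p q w => ?_) m n w
  · change X.leftMode n (VL.mode 0 VL.conf VL.conf) w = _ • X.leftMode (n - 1) VL.conf w
    have h := X.diagBimode_derivative n (X.ρ (VL.conf ⊗ₜ VR.vac)) w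
    rw [DL_eq_leftMode, leftMode_rho, X.DR_rho_vac, add_zero, diagBimode_left] at h
    rw [h, ← diagBimode_left]
    push_cast
    rfl
  · have h := X.diagBimode_commutator (VL.conf ⊗ₜ VR.vac) (X.ρ (VL.conf ⊗ₜ VR.vac)) w p q
    simp only [diagBimode_left, leftMode_rho] at h
    exact h

theorem virasoro_right (m n : ℤ) (w : F) :
    X.rightMode (m + 1) VR.conf (X.rightMode (n + 1) VR.conf w)
        - X.rightMode (n + 1) VR.conf (X.rightMode (m + 1) VR.conf w) =
      ((m : ℂ) - n) • X.rightMode (m + n + 1) VR.conf w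
        + (if m + n = 0 then VR.charge / 12 * ((m : ℂ) ^ 3 - m) else 0) • w := by
  refine VR.virasoro_of_commutator (op := X.rightAction) X.rightMode_vac (fun n w => ?_)
    (fun p q w => ?_) m n w
  · change X.rightMode n (VR.mode 0 VR.conf VR.conf) w = _ • X.rightMode (n - 1) VR.conf w
    have h := X.diagBimode_derivative n (X.ρ (VL.vac ⊗ₜ VR.conf)) w
    rw [DR_eq_rightMode, rightMode_rho, X.DL_rho_vac, zero_add, diagBimode_right] at h
    rw [h, ← diagBimode_right]
    push_cast
    rfl
  · have h := X.diagBimode_commutator (VL.vac ⊗ₜ VR.conf) (X.ρ (VL.vac ⊗ₜ VR.conf)) w p q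
    simp only [diagBimode_right, rightMode_rho] at h
    exact h

/-- The left and right modes commute, so the mixed terms cancel and the central charges add. -/
theorem virasoro (m n : ℤ) (w : F) :
    X.diagBimode (m + 1 : ℤ) (X.ρ (tensorVOA VL VR).conf)
          (X.diagBimode (n + 1 : ℤ) (X.ρ (tensorVOA VL VR).conf) w)
        - X.diagBimode (n + 1 : ℤ) (X.ρ (tensorVOA VL VR).conf)
          (X.diagBimode (m + 1 : ℤ) (X.ρ (tensorVOA VL VR).conf) w) =
      ((m : ℂ) - n) • X.diagBimode (m + n + 1 : ℤ) (X.ρ (tensorVOA VL VR).conf) w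
        + (if m + n = 0 then (tensorVOA VL VR).charge / 12 * ((m : ℂ) ^ 3 - m) else 0) • w := by
  have hc : (tensorVOA VL VR).charge = VL.charge + VR.charge := rfl
  have e : (if m + n = 0 then (tensorVOA VL VR).charge / 12 * ((m : ℂ) ^ 3 - m) else 0) =
      (if m + n = 0 then VL.charge / 12 * ((m : ℂ) ^ 3 - m) else 0) +
        (if m + n = 0 then VR.charge / 12 * ((m : ℂ) ^ 3 - m) else 0) := by
    rw [hc]
    split_ifs
    · ring
    · ring
  rw [e]
  simp only [diagBimode_conf, map_add, leftMode_rightMode, add_smul, smul_add]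
  have h₁ := X.virasoro_left m n w
  have h₂ := X.virasoro_right m n w
  rw [sub_eq_iff_eq_add] at h₁ h₂
  rw [h₁, h₂]
  abel

end FullFieldAlgebraOver

end

theorem mainTheorem5 {A B F : Type*} [AddCommGroup A] [Module ℂ A] [AddCommGroup B] [Module ℂ B]
    [AddCommGroup F] [Module ℂ F] (VL : VertexOperatorAlgebra A) (VR : VertexOperatorAlgebra B)
    (X : FullFieldAlgebraOver VL VR F) :
    (∀ (u : A ⊗[ℂ] B) (w : F) (k : ℝ), (∀ n : ℤ, k ≠ n) → X.diagMode k (X.ρ u) w = 0) ∧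
    IsVOAModule (tensorVOA VL VR) X.gr (fun n u w => X.diagMode n (X.ρ u) w) ∧
    IsIntertwiningOperator (tensorVOA VL VR) (fun n u w => X.diagMode n (X.ρ u) w)
      (fun n u w => X.diagMode n (X.ρ u) w) (fun n u w => X.diagMode n (X.ρ u) w)
      X.diagMode := by
  have hder : ∀ (k : ℝ) (w₁ w₂ : F), X.diagBimode k
      (X.diagBimode (0 : ℤ) (X.ρ (tensorVOA VL VR).conf) w₁) w₂ =
      (-(k : ℂ)) • X.diagBimode (k - 1) w₁ w₂ := fun k w₁ w₂ => by
    rw [Int.cast_zero, X.diagBimode_conf_zero, X.diagBimode_derivative]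
  refine ⟨fun u w k hk => X.diagBimode_rho_eq_zero hk u w, ?_, ?_⟩
  · exact
      { internal := X.internal
        finite_dim := X.finiteDimensional_gr X.restricted
        bounded := X.exists_gr_eq_bot
        linear_left := fun n w => (((X.diagBimode n).flip w) ∘ₗ X.ρ).isLinear
        linear_right := fun n u => (X.diagBimode n (X.ρ u)).isLinear
        truncation := fun u w => X.diagBimode_truncation_int (X.ρ u) w
        vacuum := X.diagBimode_vac
        -- The intertwining identity with middle vector `ρ w₁` and integral `q`; `rho_mode` moves
        -- the iterate inside `ρ`.
        jacobi := fun u w₁ w₂ p r q => by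
          have h := X.jacobiIdentity_diagMode (fun n u w => X.diagMode n (X.ρ u) w)
            (fun _ _ _ => rfl) u (X.ρ w₁) w₂ p r q
          simp only [← X.diagBimode_apply, X.rho_mode, Int.cast_id] at h ⊢
          push_cast at h ⊢
          exact h
        virasoro := X.virasoro
        grading := fun r w hw => by
          have := X.diagBimode_conf_one hw
          rwa [← Int.cast_one] at this
        derivative := fun n u w => by
          have h := hder n (X.ρ u) w
          rw [← X.rho_mode] at h
          simp only [← X.diagBimode_apply]
          push_cast at h ⊢
          exact h }
  · exact
      { linear_left := fun k w => ((X.diagBimode k).flip w).isLinear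
        linear_right := fun k w => (X.diagBimode k w).isLinear
        truncation := X.diagBimode_truncation
        jacobi := X.jacobiIdentity_diagMode _ fun _ _ _ => rfl
        derivative := hder }
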